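/- **Theorem 3.1 (big pieces global $Tb$).** Let $n\in\mathbb N$ and let $m,\alpha>0$, $K$, $C_b$, $c_{\mathrm{acc}}>0$, $\delta_0<1$, $C_0$, $C_1$ and $s>0$ be real numbers. There are constants $c,C\in(0,\infty)$, depending only on these parameters, such that the following holds. Let $s_t\colon\mathbb R^n\times\mathbb R^n\to\mathbb C$, $t>0$, be kernels, jointly measurable in $(t,x,y)$, such that $$|s_t(x,y)|\le K\frac{t^\alpha}{(t+|x-y|)^{m+\alpha}},\qquad |s_t(x,y)-s_t(x,z)|\le K\frac{|y-z|^\alpha}{(t+|x-y|)^{m+\alpha}}\ \text{ whenever } |y-z|<t/2 .$$ Let $Q\subset\mathbb R^n$ be a closed cube with sides parallel to the axes, centre $c_Q$ and side length $\ell(Q)>0$. Let $\sigma$ be a finite Borel measure on $\mathbb R^n$ with $\operatorname{spt}\sigma\subset Q$, and for $f\in L^1(\sigma)$ put $$V_{\sigma,Q}f(x)=\Big(\int_0^{\ell(Q)}\Big|\int s_t(x,y)f(y)\,d\sigma(y)\Big|^2\frac{dt}{t}\Big)^{1/2}\in[0,\infty].$$ Let $N\in\mathbb Z$ be defined by $2^{N-3}\le\ell(Q)<2^{N-2}$.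 For $w\in\Omega:=[-2^{N-1},2^{N-1})^n$ let $\mathcal D(w)$ be the collection of all (half-open) dyadic subcubes of $Q^*(w)=c_Q+w+[-2^N,2^N)^n$, including $Q^*(w)$ itself. Let $b\colon\mathbb R^n\to\mathbb C$ be a $\sigma$-measurable function with $\|b\|_{L^\infty(\sigma)}\le C_b$, and for $w\in\Omega$ let $T_w$ be the union of the maximal cubes $R\in\mathcal D(w)$ for which $$\Big|\int_R b\,d\sigma\Big|<c_{\mathrm{acc}}\,\sigma(R).$$ Let $H\subset\mathbb R^n$ be a $\sigma$-measurable set such that * $\sigma(H\cup T_w)\le\delta_0\,\sigma(Q)$ for every $w\in\Omega$; * every ball $B_r$ of radius $r>0$ with $\sigma(B_r)>C_0r^m$ satisfies $B_r\subset H$; * $\sup_{\lambda>0}\lambda^s\,\sigma(\{x\in Q\setminus H:\ V_{\sigma,Q}b(x)>\lambda\})\le C_1\,\sigma(Q)$. Then there is a Borel set $G_Q\subset Q\setminus H$ such that * (a) $\sigma(G_Q)\ge c\,\sigma(Q)$; * (b) $\|1_{G_Q}V_{\sigma,Q}f\|_{L^2(\sigma)}\le C\,\|f\|_{L^2(\sigma)}$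 for every $f\in L^2(\sigma)$. -/

import Mathlib

open MeasureTheory
open scoped ENNReal

namespace SquareTb

/-- A measurable family of kernels `k t x y`, `t > 0`, satisfying with constant `K` the size
condition and the Hölder condition in the `y` variable (no regularity in `x` is required). -/
structure IsKernel {n : ℕ} (m α K : ℝ)
    (k : ℝ → EuclideanSpace ℝ (Fin n) → EuclideanSpace ℝ (Fin n) → ℂ) : Prop where
  measurable : Measurable
    (fun p : Set.Ioi (0 : ℝ) × EuclideanSpace ℝ (Fin n) × EuclideanSpace ℝ (Fin n) =>
      k p.1 p.2.1 p.2.2)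
  size : ∀ t : ℝ, 0 < t → ∀ x y, ‖k t x y‖ ≤ K * (t ^ α / (t + dist x y) ^ (m + α))
  holder : ∀ t : ℝ, 0 < t → ∀ x y z, dist y z < t / 2 →
    ‖k t x y - k t x z‖ ≤ K * (dist y z ^ α / (t + dist x y) ^ (m + α))

/-- `θ_t^σ f (x) = ∫ k_t(x,y) f(y) dσ(y)`. -/
noncomputable def theta {n : ℕ}
    (k : ℝ → EuclideanSpace ℝ (Fin n) → EuclideanSpace ℝ (Fin n) → ℂ)
    (σ : Measure (EuclideanSpace ℝ (Fin n))) (f : EuclideanSpace ℝ (Fin n) → ℂ)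
    (t : ℝ) (x : EuclideanSpace ℝ (Fin n)) : ℂ :=
  ∫ y, k t x y * f y ∂σ

/-- The vertical square function truncated at height `l`, with values in `[0, ∞]`:
`V f (x) = (∫_0^l |θ_t^σ f (x)|² dt / t)^{1/2}`. -/
noncomputable def squareFn {n : ℕ}
    (k : ℝ → EuclideanSpace ℝ (Fin n) → EuclideanSpace ℝ (Fin n) → ℂ)
    (σ : Measure (EuclideanSpace ℝ (Fin n))) (l : ℝ) (f : EuclideanSpace ℝ (Fin n) → ℂ)
    (x : EuclideanSpace ℝ (Fin n)) : ℝ≥0∞ :=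
  (∫⁻ t in Set.Ioo 0 l, ‖theta k σ f t x‖ₑ ^ 2 / ENNReal.ofReal t) ^ (1 / 2 : ℝ)

/-- The closed cube with centre `z`, side length `l` and sides parallel to the axes. -/
def cube {n : ℕ} (z : EuclideanSpace ℝ (Fin n)) (l : ℝ) : Set (EuclideanSpace ℝ (Fin n)) :=
  {x | ∀ i, |x i - z i| ≤ l / 2}

/-- The half-open cube `∏ [a_i, a_i + L)`. -/
def hoCube {n : ℕ} (a : Fin n → ℝ) (L : ℝ) : Set (EuclideanSpace ℝ (Fin n)) :=
  {x | ∀ i, a i ≤ x i ∧ x i < a i + L}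

/-- The dyadic grid of the half-open cube `∏ [a_i, a_i + L)`: the cube itself and all its dyadic
descendants; those of generation `j` have side length `2^{-j} L`. -/
def dyadicGrid {n : ℕ} (a : Fin n → ℝ) (L : ℝ) : Set (Set (EuclideanSpace ℝ (Fin n))) :=
  {R | ∃ (j : ℕ) (v : Fin n → ℕ), (∀ i, v i < 2 ^ j) ∧
    R = hoCube (fun i => a i + v i * (L / 2 ^ j)) (L / 2 ^ j)}

/-- For `l > 0`, the integer `N` determined by `2^{N-3} ≤ l < 2^{N-2}`. -/
noncomputable def gridScale (l : ℝ) : ℤ := Int.log 2 l + 3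

theorem gridScale_spec {l : ℝ} (hl : 0 < l) :
    (2 : ℝ) ^ (gridScale l - 3) ≤ l ∧ l < (2 : ℝ) ^ (gridScale l - 2) := by
  have h1 := Int.zpow_log_le_self (b := 2) (by norm_num) hl
  have h2 := Int.lt_zpow_succ_log_self (b := 2) (by norm_num) l
  have e1 : gridScale l - 3 = Int.log 2 l := by unfold gridScale; ring
  have e2 : gridScale l - 2 = Int.log 2 l + 1 := by unfold gridScale; ring
  rw [e1, e2]
  exact ⟨by exact_mod_cast h1, by exact_mod_cast h2⟩

/-- The parameter set `Ω = [-2^{N-1}, 2^{N-1})^n` of the random grids of a cube of side `l`. -/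
def gridParams (n : ℕ) (l : ℝ) : Set (Fin n → ℝ) :=
  {w | ∀ i, -(2 : ℝ) ^ (gridScale l - 1) ≤ w i ∧ w i < (2 : ℝ) ^ (gridScale l - 1)}

/-- The grid `𝒟(w)` attached to the cube with centre `z` and side length `l`: the dyadic grid of
the shifted cube `Q^*(w) = z + w + [-2^N, 2^N)^n`. -/
def randomGrid {n : ℕ} (z : EuclideanSpace ℝ (Fin n)) (l : ℝ) (w : Fin n → ℝ) :
    Set (Set (EuclideanSpace ℝ (Fin n))) :=
  dyadicGrid (fun i => z i + w i - (2 : ℝ) ^ gridScale l) (2 * (2 : ℝ) ^ gridScale l)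

/-- `T_w`: the union of the maximal cubes `R ∈ 𝒟(w)` with `|∫_R b dσ| < c σ(R)`. -/
def stoppingSet {n : ℕ} (σ : Measure (EuclideanSpace ℝ (Fin n)))
    (b : EuclideanSpace ℝ (Fin n) → ℂ) (c : ℝ) (z : EuclideanSpace ℝ (Fin n)) (l : ℝ)
    (w : Fin n → ℝ) : Set (EuclideanSpace ℝ (Fin n)) :=
  ⋃₀ {R | Maximal (fun R' => R' ∈ randomGrid z l w ∧ ‖∫ x in R', b x ∂σ‖ < c * σ.real R') R}

end SquareTb

/-! Fix a dyadic grid and let `E_i` denote averaging over its cubes of generation `i`. At times `t ~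
2^{-i} L`, compare `θ_t f` with `θ_t 1 · E_i f`. With `D_j = E_{j+1} - E_j`, the error splits into
terms of two kinds. For `j ≥ i`, `θ_t D_j f` is small by the Hölder condition, as `D_j f` has mean
zero on cubes of generation `j`. For `j < i`, `θ_t D_j f - θ_t 1 · D_j f(x)` is small by the decay
of the kernel, provided `x` is far from the boundaries of its larger cubes ("good at generation
`i`"). Both gain geometrically in `|i - j|`, so Schur's test and Bessel's inequality bound the
square function of the error in `L²` over good points of polynomial growth
(`tsum_lintegral_avgError_le`).

This is used twice. For `b`: discard `H`, the stopping set, and the points where `V b` or the total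
error of `b` is large. On the remaining stable set `|E_i b| ≥ c_acc` at every generation, so `θ_t 1`
is controlled by `θ_t b` and the error, and its square function over good generations is bounded
pointwise (`tsum_timePiece_one_le_of_mem_stableSet`). For general `f`: the main term is at most this
bound times `sup_i |E_i f|²`, and the `L²` maximal inequality (`lintegral_iSup_fiberAvg_sq_le`)
finishes (`tsum_lintegral_timePiece_le`). The pointwise bound makes a Carleson embedding and
`b`-adapted martingale differences unnecessary.

Goodness is obtained by shifting the grid at random. For given `x` and `i` it fails with probability
at most `τ`, while every stable set has measure at least `4τ σ(Q)`. Let `G` be the set of points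
that are stable with probability at least `2τ`. Fubini gives `σ(G) ≥ 2τ σ(Q)`
(`le_measureReal_frequentSet`). A point of `G` is both stable and good at generation `i` with
probability at least `τ`, so averaging the estimate over the shifts bounds `τ ∫_G (V f)²`
(`mul_lintegral_frequentSet_le`). Goodness is needed at one generation at a time, never at all of
them simultaneously. -/

namespace SquareTb

/-! ### Weighted Cauchy–Schwarz inequalities. -/

theorem sq_lintegral_mul_le {X : Type*} [MeasurableSpace X] {μ : Measure X} {p g : X → ℝ≥0∞}
    (hp : AEMeasurable p μ) (hg : AEMeasurable g μ) :
    (∫⁻ x, p x * g x ∂μ) ^ 2 ≤ (∫⁻ x, p x ∂μ) * ∫⁻ x, p x * g x ^ 2 ∂μ := by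
  have key := ENNReal.lintegral_mul_le_Lp_mul_Lq μ (p := 2) (q := 2)
    Real.HolderConjugate.two_two (f := fun x => p x ^ (1 / 2 : ℝ))
    (g := fun x => p x ^ (1 / 2 : ℝ) * g x) (hp.pow_const _) ((hp.pow_const _).mul hg)
  have h1 : ∀ y : ℝ≥0∞, (y ^ (1 / 2 : ℝ)) ^ (2 : ℝ) = y := fun y => by
    rw [← ENNReal.rpow_mul]; norm_num
  have h3 : ∀ y : ℝ≥0∞, y ^ (1 / 2 : ℝ) * y ^ (1 / 2 : ℝ) = y := fun y => by
    rw [← ENNReal.rpow_add_of_nonneg _ _ (by norm_num) (by norm_num)]; norm_num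
  simp only [Pi.mul_apply, ENNReal.mul_rpow_of_nonneg _ _ (zero_le_two (α := ℝ)), h1,
    ← mul_assoc, h3] at key
  calc (∫⁻ x, p x * g x ∂μ) ^ 2
      ≤ ((∫⁻ x, p x ∂μ) ^ (1 / 2 : ℝ) * (∫⁻ x, p x * g x ^ (2 : ℝ) ∂μ) ^ (1 / 2 : ℝ)) ^ 2 :=
        pow_le_pow_left' key 2
    _ = _ := by
        rw [mul_pow, ← ENNReal.rpow_two, ← ENNReal.rpow_two, h1, h1]
        simp only [ENNReal.rpow_two]

theorem sq_tsum_mul_le (q h : ℕ → ℝ≥0∞) :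
    (∑' j, q j * h j) ^ 2 ≤ (∑' j, q j) * ∑' j, q j * h j ^ 2 := by
  have := sq_lintegral_mul_le (μ := Measure.count (α := ℕ)) (p := q) (g := h)
    (measurable_of_countable _).aemeasurable (measurable_of_countable _).aemeasurable
  simpa only [lintegral_count] using this

theorem add_sq_le_two_mul (a b : ℝ≥0∞) : (a + b) ^ 2 ≤ 2 * a ^ 2 + 2 * b ^ 2 := by
  have h := ENNReal.rpow_add_le_mul_rpow_add_rpow a b (p := 2) (by norm_num)
  norm_num at h
  rwa [← mul_add]

theorem enorm_add_sq_le (a b : ℂ) : ‖a + b‖ₑ ^ 2 ≤ 2 * ‖a‖ₑ ^ 2 + 2 * ‖b‖ₑ ^ 2 :=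
  (pow_le_pow_left' (enorm_add_le _ _) 2).trans (add_sq_le_two_mul _ _)

/-! ### Averages over a countable partition, given as the fibres of a map. -/

section Average

theorem iUnion_fiber {X ι : Type*} {π : X → ι} : ⋃ v, π ⁻¹' {v} = Set.univ := by
  ext x; simp

theorem pairwise_disjoint_fiber {X ι : Type*} {π : X → ι} :
    Pairwise (Function.onFun Disjoint fun v => π ⁻¹' {v}) := by
  intro v w hvw
  exact Disjoint.preimage _ (by simpa using hvw)

variable {X ι 𝕜 : Type*} [MeasurableSpace X] [RCLike 𝕜]

/-- The average of `f` over the fibre of `π` through `x`. -/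
noncomputable def fiberAvg (σ : Measure X) (π : X → ι) (f : X → 𝕜) (x : X) : 𝕜 :=
  ⨍ y in π ⁻¹' {π x}, f y ∂σ

variable {σ : Measure X} {π : X → ι} {f g u : X → 𝕜}

theorem fiberAvg_congr_point {x y : X} (h : π x = π y) : fiberAvg σ π f x = fiberAvg σ π f y := by
  simp only [fiberAvg, h]

theorem fiberAvg_congr_ae (h : f =ᵐ[σ] g) (x : X) : fiberAvg σ π f x = fiberAvg σ π g x := by
  unfold fiberAvg
  exact average_congr (ae_restrict_of_ae h)

theorem enorm_fiberAvg_le (x : X) :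
    ‖fiberAvg σ π f x‖ₑ ≤ (∫⁻ y in π ⁻¹' {π x}, ‖f y‖ₑ ∂σ) / σ (π ⁻¹' {π x}) := by
  unfold fiberAvg
  rw [average_eq', div_eq_mul_inv, mul_comm]
  refine (enorm_integral_le_lintegral_enorm _).trans ?_
  rw [lintegral_smul_measure, Measure.restrict_apply_univ, smul_eq_mul]

theorem memLp_two_iff_lintegral (hf : AEStronglyMeasurable f σ) :
    MemLp f 2 σ ↔ ∫⁻ x, ‖f x‖ₑ ^ 2 ∂σ < ∞ := by
  rw [MemLp, and_iff_right hf, eLpNorm_lt_top_iff_lintegral_rpow_enorm_lt_top (by simp) (by simp)]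
  simp

variable [MeasurableSpace ι] [MeasurableSingletonClass ι]

theorem setIntegral_fiberAvg [IsFiniteMeasure σ] (hπ : Measurable π) (v : ι) :
    ∫ x in π ⁻¹' {v}, fiberAvg σ π f x ∂σ = ∫ x in π ⁻¹' {v}, f x ∂σ := by
  rw [setIntegral_congr_fun (g := fun _ => ⨍ y in π ⁻¹' {v}, f y ∂σ)
    (hπ (measurableSet_singleton v))]
  · exact integral_average _ _
  · intro x hx
    simp only [Set.mem_preimage, Set.mem_singleton_iff] at hx
    simp only [fiberAvg, hx]

variable [Countable ι]

theorem measurable_fiberAvg (hπ : Measurable π) : Measurable (fiberAvg σ π f) := by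
  have : fiberAvg σ π f = (fun v => ⨍ y in π ⁻¹' {v}, f y ∂σ) ∘ π := rfl
  rw [this]
  exact (measurable_of_countable _).comp hπ

theorem lintegral_eq_tsum_fiber (hπ : Measurable π) (φ : X → ℝ≥0∞) :
    ∫⁻ x, φ x ∂σ = ∑' v, ∫⁻ x in π ⁻¹' {v}, φ x ∂σ := by
  rw [← lintegral_iUnion (fun v => hπ (measurableSet_singleton v)) pairwise_disjoint_fiber,
    iUnion_fiber, setLIntegral_univ]

/-- A function with mean zero on the fibres is orthogonal to functions constant on fibres. -/
theorem integral_mul_eq_zero_of_fiber (hπ : Measurable π) (hu : ∀ x y, π x = π y → u x = u y)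
    (hint : Integrable (fun x => u x * g x) σ) (h0 : ∀ v, ∫ x in π ⁻¹' {v}, g x ∂σ = 0) :
    ∫ x, u x * g x ∂σ = 0 := by
  rw [← setIntegral_univ, ← iUnion_fiber (π := π),
    integral_iUnion (fun v => hπ (measurableSet_singleton v)) pairwise_disjoint_fiber
      hint.integrableOn]
  refine (tsum_congr fun v => ?_).trans tsum_zero
  rcases (π ⁻¹' {v}).eq_empty_or_nonempty with h | ⟨x₀, hx₀⟩
  · simp [h]
  · rw [setIntegral_congr_fun (g := fun x => u x₀ * g x) (hπ (measurableSet_singleton v)),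
      integral_const_mul, h0, mul_zero]
    intro x hx
    simp only [Set.mem_preimage, Set.mem_singleton_iff] at hx hx₀
    simp only [hu x x₀ (hx.trans hx₀.symm)]

variable [IsFiniteMeasure σ]

/-- Cauchy–Schwarz on each fibre. Null fibres are treated apart because `σ R * (σ R)⁻¹ = 1` fails
there. -/
theorem lintegral_enorm_fiberAvg_sq_le (hπ : Measurable π) (hf : AEStronglyMeasurable f σ) :
    ∫⁻ x, ‖fiberAvg σ π f x‖ₑ ^ 2 ∂σ ≤ ∫⁻ x, ‖f x‖ₑ ^ 2 ∂σ := by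
  rw [lintegral_eq_tsum_fiber hπ, lintegral_eq_tsum_fiber (σ := σ) hπ (fun x => ‖f x‖ₑ ^ 2)]
  refine ENNReal.tsum_le_tsum fun v => ?_
  set R := π ⁻¹' {v} with hR
  have hRm : MeasurableSet R := hπ (measurableSet_singleton v)
  by_cases h0 : σ R = 0
  · rw [Measure.restrict_eq_zero.2 h0]; simp
  have hCS : (∫⁻ y in R, ‖f y‖ₑ ∂σ) ^ 2 ≤ σ R * ∫⁻ y in R, ‖f y‖ₑ ^ 2 ∂σ := by
    have := sq_lintegral_mul_le (μ := σ.restrict R) (p := fun _ => 1) (g := fun y => ‖f y‖ₑ)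
      aemeasurable_const hf.enorm.restrict
    simpa using this
  calc ∫⁻ x in R, ‖fiberAvg σ π f x‖ₑ ^ 2 ∂σ
      ≤ ∫⁻ x in R, ((∫⁻ y in R, ‖f y‖ₑ ∂σ) / σ R) ^ 2 ∂σ := by
        refine setLIntegral_mono measurable_const fun x hx => ?_
        have hx' : π x = v := hx
        have := enorm_fiberAvg_le (σ := σ) (π := π) (f := f) x
        rw [hx'] at this
        exact pow_le_pow_left' this 2
    _ = ((∫⁻ y in R, ‖f y‖ₑ ∂σ) / σ R) ^ 2 * σ R := by simp
    _ ≤ σ R * (∫⁻ y in R, ‖f y‖ₑ ^ 2 ∂σ) * (σ R)⁻¹ ^ 2 * σ R := by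
        rw [div_eq_mul_inv, mul_pow]
        gcongr
    _ = (σ R * (σ R)⁻¹) * (σ R * (σ R)⁻¹) * (∫⁻ y in R, ‖f y‖ₑ ^ 2 ∂σ) := by ring
    _ = _ := by rw [ENNReal.mul_inv_cancel h0 (measure_ne_top _ _)]; simp

theorem memLp_fiberAvg (hπ : Measurable π) (hf : MemLp f 2 σ) : MemLp (fiberAvg σ π f) 2 σ := by
  rw [memLp_two_iff_lintegral (measurable_fiberAvg hπ).aestronglyMeasurable]
  exact (lintegral_enorm_fiberAvg_sq_le hπ hf.1).trans_lt ((memLp_two_iff_lintegral hf.1).1 hf)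

end Average

/-! ### Martingale differences of a refining sequence of partitions. -/

section Martingale

theorem eq_of_refine {X ι : Type*} {π : ℕ → X → ι} (href : ∀ j x y, π (j + 1) x = π (j + 1) y → π j x = π j y)
    {i j : ℕ} (hij : i ≤ j) {x y : X} (h : π j x = π j y) : π i x = π i y := by
  induction j, hij using Nat.le_induction with
  | base => exact h
  | succ j _ ih => exact ih (href j x y h)

variable {X ι 𝕜 : Type*} [MeasurableSpace X] [RCLike 𝕜]

/-- The difference of the averages of `f` over two consecutive partitions. -/
noncomputable def fiberDiff (σ : Measure X) (π : ℕ → X → ι) (f : X → 𝕜) (j : ℕ) (x : X) : 𝕜 :=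
  fiberAvg σ (π (j + 1)) f x - fiberAvg σ (π j) f x

theorem sum_fiberDiff {σ : Measure X} {π : ℕ → X → ι} {f : X → 𝕜} (J : ℕ) (x : X) :
    fiberAvg σ (π J) f x = fiberAvg σ (π 0) f x + ∑ j ∈ Finset.range J, fiberDiff σ π f j x := by
  simp only [fiberDiff, Finset.sum_range_sub (fun j => fiberAvg σ (π j) f x)]
  ring

theorem fiberDiff_congr_point {σ : Measure X} {π : ℕ → X → ι} {f : X → 𝕜}
    (href : ∀ j x y, π (j + 1) x = π (j + 1) y → π j x = π j y) {j : ℕ} {x y : X}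
    (h : π (j + 1) x = π (j + 1) y) : fiberDiff σ π f j x = fiberDiff σ π f j y := by
  simp only [fiberDiff, fiberAvg_congr_point h, fiberAvg_congr_point (href j x y h)]

theorem lintegral_enorm_sq_eq {σ : Measure X} {f : X → 𝕜} (hf : MemLp f 2 σ) :
    ∫⁻ x, ‖f x‖ₑ ^ 2 ∂σ = ENNReal.ofReal (∫ x, ‖f x‖ ^ 2 ∂σ) := by
  rw [ofReal_integral_eq_lintegral_ofReal hf.norm.integrable_sq
    (Filter.Eventually.of_forall fun x => by positivity)]
  refine lintegral_congr fun x => ?_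
  rw [ENNReal.ofReal_pow (norm_nonneg _), ofReal_norm]

variable [MeasurableSpace ι] [MeasurableSingletonClass ι] [Countable ι]
variable {σ : Measure X} [IsFiniteMeasure σ] {π : ℕ → X → ι} {f : X → 𝕜}

/-- Tower property: the indicator of a coarse fibre is constant on fine fibres, hence orthogonal to
`f` minus its fine average. -/
theorem setIntegral_fiberAvg_of_le (hπ : ∀ j, Measurable (π j))
    (href : ∀ j x y, π (j + 1) x = π (j + 1) y → π j x = π j y) (hf : MemLp f 2 σ)
    {i j : ℕ} (hij : i ≤ j) (v : ι) :
    ∫ x in π i ⁻¹' {v}, fiberAvg σ (π j) f x ∂σ = ∫ x in π i ⁻¹' {v}, f x ∂σ := by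
  have hR : MeasurableSet (π i ⁻¹' {v}) := hπ i (measurableSet_singleton v)
  have hA : Integrable (fiberAvg σ (π j) f) σ :=
    (memLp_fiberAvg (hπ j) hf).integrable (by norm_num)
  have hI : Integrable f σ := hf.integrable (by norm_num)
  rw [← sub_eq_zero, ← integral_sub hA.integrableOn hI.integrableOn, ← integral_indicator hR]
  have hind : (π i ⁻¹' {v}).indicator (fun x => fiberAvg σ (π j) f x - f x) =
      fun x => (π i ⁻¹' {v}).indicator (fun _ => (1 : 𝕜)) x * (fiberAvg σ (π j) f x - f x) := by
    ext x
    by_cases hx : x ∈ π i ⁻¹' {v} <;> simp [hx]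
  rw [hind]
  refine integral_mul_eq_zero_of_fiber (hπ j) (fun x y hxy => ?_) ?_ (fun w => ?_)
  · have := eq_of_refine href hij hxy
    have hmem : x ∈ π i ⁻¹' {v} ↔ y ∈ π i ⁻¹' {v} := by
      simp only [Set.mem_preimage, this]
    by_cases hx : x ∈ π i ⁻¹' {v}
    · rw [Set.indicator_of_mem hx, Set.indicator_of_mem (hmem.1 hx)]
    · rw [Set.indicator_of_notMem hx, Set.indicator_of_notMem (hmem.not.1 hx)]
  · rw [← hind]
    exact (hA.sub hI).indicator hR
  · rw [integral_sub hA.integrableOn hI.integrableOn, setIntegral_fiberAvg (hπ j), sub_self]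

theorem memLp_fiberDiff (hπ : ∀ j, Measurable (π j)) (hf : MemLp f 2 σ) (j : ℕ) :
    MemLp (fiberDiff σ π f j) 2 σ :=
  (memLp_fiberAvg (hπ (j + 1)) hf).sub (memLp_fiberAvg (hπ j) hf)

theorem setIntegral_fiberDiff (hπ : ∀ j, Measurable (π j))
    (href : ∀ j x y, π (j + 1) x = π (j + 1) y → π j x = π j y) (hf : MemLp f 2 σ)
    {i j : ℕ} (hij : i ≤ j) (v : ι) :
    ∫ x in π i ⁻¹' {v}, fiberDiff σ π f j x ∂σ = 0 := by
  have hA : ∀ j, Integrable (fiberAvg σ (π j) f) σ := fun j =>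
    (memLp_fiberAvg (hπ j) hf).integrable (by norm_num)
  simp only [fiberDiff]
  rw [integral_sub (hA _).integrableOn (hA _).integrableOn,
    setIntegral_fiberAvg_of_le hπ href hf (hij.trans j.le_succ),
    setIntegral_fiberAvg_of_le hπ href hf hij, sub_self]

/-- Pythagoras: the cross term pairs a function constant on the fibres of `π j` with one of mean
zero on them. Iterated, it gives Bessel's inequality for the differences. -/
theorem integral_norm_sq_fiberAvg_succ (hπ : ∀ j, Measurable (π j))
    (href : ∀ j x y, π (j + 1) x = π (j + 1) y → π j x = π j y) (hf : MemLp f 2 σ) (j : ℕ) :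
    ∫ x, ‖fiberAvg σ (π (j + 1)) f x‖ ^ 2 ∂σ =
      ∫ x, ‖fiberAvg σ (π j) f x‖ ^ 2 ∂σ + ∫ x, ‖fiberDiff σ π f j x‖ ^ 2 ∂σ := by
  have hA := memLp_fiberAvg (hπ j) hf
  have hD := memLp_fiberDiff hπ hf j
  have hint : Integrable (fun x => star (fiberAvg σ (π j) f x) * fiberDiff σ π f j x) σ :=
    hA.star.integrable_mul hD
  have h0 : ∫ x, star (fiberAvg σ (π j) f x) * fiberDiff σ π f j x ∂σ = 0 :=
    integral_mul_eq_zero_of_fiber (hπ j)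
      (fun x y hxy => by simp only [fiberAvg_congr_point hxy]) hint
      (setIntegral_fiberDiff hπ href hf le_rfl)
  have hre : ∫ x, RCLike.re (star (fiberAvg σ (π j) f x) * fiberDiff σ π f j x) ∂σ = 0 := by
    rw [integral_re hint, h0, map_zero]
  have hpt : ∀ x, ‖fiberAvg σ (π (j + 1)) f x‖ ^ 2 = (‖fiberAvg σ (π j) f x‖ ^ 2 +
      ‖fiberDiff σ π f j x‖ ^ 2) +
        2 * RCLike.re (star (fiberAvg σ (π j) f x) * fiberDiff σ π f j x) := fun x => by
    have h1 : fiberAvg σ (π (j + 1)) f x = fiberAvg σ (π j) f x + fiberDiff σ π f j x := by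
      simp [fiberDiff]
    rw [h1, @norm_add_sq 𝕜]
    simp only [RCLike.inner_apply, RCLike.star_def]
    rw [mul_comm (fiberDiff σ π f j x)]
    ring
  simp only [hpt]
  rw [integral_add (f := fun x => ‖fiberAvg σ (π j) f x‖ ^ 2 + ‖fiberDiff σ π f j x‖ ^ 2)
    (hA.norm.integrable_sq.add hD.norm.integrable_sq) (hint.re.const_mul 2),
    integral_add hA.norm.integrable_sq hD.norm.integrable_sq, integral_const_mul, hre]
  ring

theorem tsum_lintegral_fiberDiff_le (hπ : ∀ j, Measurable (π j))
    (href : ∀ j x y, π (j + 1) x = π (j + 1) y → π j x = π j y) (hf : MemLp f 2 σ) :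
    ∑' j, ∫⁻ x, ‖fiberDiff σ π f j x‖ₑ ^ 2 ∂σ ≤ ∫⁻ x, ‖f x‖ₑ ^ 2 ∂σ := by
  refine ENNReal.tsum_le_of_sum_range_le fun J => ?_
  have hsum : ∀ J : ℕ, ∑ j ∈ Finset.range J, ∫ x, ‖fiberDiff σ π f j x‖ ^ 2 ∂σ ≤
      ∫ x, ‖fiberAvg σ (π J) f x‖ ^ 2 ∂σ := by
    intro J
    induction J with
    | zero => simpa using integral_nonneg fun x => by positivity
    | succ J ih =>
      rw [Finset.sum_range_succ, integral_norm_sq_fiberAvg_succ hπ href hf J]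
      gcongr
  simp only [lintegral_enorm_sq_eq (memLp_fiberDiff hπ hf _)]
  rw [← ENNReal.ofReal_sum_of_nonneg fun j _ => integral_nonneg fun x => by positivity]
  calc _ ≤ ENNReal.ofReal (∫ x, ‖fiberAvg σ (π J) f x‖ ^ 2 ∂σ) := ENNReal.ofReal_le_ofReal (hsum J)
    _ = ∫⁻ x, ‖fiberAvg σ (π J) f x‖ₑ ^ 2 ∂σ :=
      (lintegral_enorm_sq_eq (memLp_fiberAvg (hπ J) hf)).symm
    _ ≤ _ := lintegral_enorm_fiberAvg_sq_le (hπ J) hf.1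

end Martingale

/-! ### Doob's maximal inequality in `L²`. -/

section Maximal

variable {X ι : Type*} [MeasurableSpace X]

/-- The maximum of the first `J + 1` averages of `u`. -/
noncomputable def fiberMax (σ : Measure X) (π : ℕ → X → ι) (u : X → ℝ) : ℕ → X → ℝ
  | 0, x => fiberAvg σ (π 0) u x
  | J + 1, x => max (fiberMax σ π u J x) (fiberAvg σ (π (J + 1)) u x)

theorem fiberAvg_le_fiberMax {σ : Measure X} {π : ℕ → X → ι} {u : X → ℝ} {i J : ℕ} (h : i ≤ J)
    (x : X) : fiberAvg σ (π i) u x ≤ fiberMax σ π u J x := by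
  induction J, h using Nat.le_induction with
  | base => cases i with
    | zero => exact le_rfl
    | succ i => exact le_max_right _ _
  | succ J _ ih => exact ih.trans (le_max_left _ _)

theorem fiberMax_congr_point {σ : Measure X} {π : ℕ → X → ι} {u : X → ℝ}
    (href : ∀ j x y, π (j + 1) x = π (j + 1) y → π j x = π j y) {J : ℕ} {x y : X}
    (h : π J x = π J y) : fiberMax σ π u J x = fiberMax σ π u J y := by
  induction J with
  | zero => exact fiberAvg_congr_point h
  | succ J ih => simp only [fiberMax, ih (href J x y h), fiberAvg_congr_point h]

theorem fiberAvg_nonneg {σ : Measure X} {π : X → ι} {u : X → ℝ} (hu : ∀ x, 0 ≤ u x) (x : X) :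
    0 ≤ fiberAvg σ π u x := by
  unfold fiberAvg
  rw [average_eq']
  exact integral_nonneg hu

theorem norm_fiberAvg_le {σ : Measure X} {π : X → ι} {f : X → ℂ} (x : X) :
    ‖fiberAvg σ π f x‖ ≤ fiberAvg σ π (fun y => ‖f y‖) x := by
  unfold fiberAvg
  rw [average_eq', average_eq']
  exact norm_integral_le_integral_norm _

variable [MeasurableSpace ι] [MeasurableSingletonClass ι] [Countable ι]
variable {σ : Measure X} [IsFiniteMeasure σ] {π : ℕ → X → ι} {u : X → ℝ}

theorem memLp_fiberMax (hπ : ∀ j, Measurable (π j)) (hu : MemLp u 2 σ) (J : ℕ) :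
    MemLp (fiberMax σ π u J) 2 σ := by
  induction J with
  | zero => exact memLp_fiberAvg (hπ 0) hu
  | succ J ih => exact ih.sup (memLp_fiberAvg (hπ (J + 1)) hu)

/-- With `M` the running maximum and `A` the current average, the integral of `2 M A - M²` is
nondecreasing in `J`. Replacing `A_J` by `A_{J+1}` costs nothing, as `M_J` is constant on the fibres
of `π J`. Then replacing `M_J` by `max M_J A_{J+1}` can only increase the integrand, since `2 M A -
M² ≤ A²`. No weak-type estimate is involved. -/
theorem integral_fiberMax_potential_nonneg (hπ : ∀ j, Measurable (π j))
    (href : ∀ j x y, π (j + 1) x = π (j + 1) y → π j x = π j y) (hu : MemLp u 2 σ) (J : ℕ) :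
    0 ≤ ∫ x, (2 * (fiberMax σ π u J x * fiberAvg σ (π J) u x) - fiberMax σ π u J x ^ 2) ∂σ := by
  have hInt : ∀ J, Integrable (fun x => 2 * (fiberMax σ π u J x * fiberAvg σ (π J) u x) -
      fiberMax σ π u J x ^ 2) σ := fun J =>
    (((memLp_fiberMax hπ hu J).integrable_mul (memLp_fiberAvg (hπ J) hu)).const_mul 2).sub
      (memLp_fiberMax hπ hu J).integrable_sq
  induction J with
  | zero =>
    refine integral_nonneg fun x => ?_
    simp only [fiberMax, Pi.zero_apply]
    nlinarith [sq_nonneg (fiberAvg σ (π 0) u x)]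
  | succ J ih =>
    have hMD : Integrable (fun x => fiberMax σ π u J x * fiberDiff σ π u J x) σ :=
      (memLp_fiberMax hπ hu J).integrable_mul (memLp_fiberDiff hπ hu J)
    have h0 : ∫ x, fiberMax σ π u J x * fiberDiff σ π u J x ∂σ = 0 :=
      integral_mul_eq_zero_of_fiber (hπ J) (fun x y hxy => fiberMax_congr_point href hxy) hMD
        (setIntegral_fiberDiff hπ href hu le_rfl)
    calc 0 ≤ ∫ x, (2 * (fiberMax σ π u J x * fiberAvg σ (π J) u x) -
          fiberMax σ π u J x ^ 2) ∂σ +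
            2 * ∫ x, fiberMax σ π u J x * fiberDiff σ π u J x ∂σ := by rw [h0]; linarith
      _ = ∫ x, (2 * (fiberMax σ π u J x * fiberAvg σ (π J) u x) -
          fiberMax σ π u J x ^ 2 + 2 * (fiberMax σ π u J x * fiberDiff σ π u J x)) ∂σ := by
          rw [integral_add (hInt J) (hMD.const_mul 2), integral_const_mul]
      _ ≤ _ := by
          refine integral_mono ((hInt J).add (hMD.const_mul 2)) (hInt (J + 1)) fun x => ?_
          simp only [fiberMax, fiberDiff]
          rcases le_total (fiberAvg σ (π (J + 1)) u x) (fiberMax σ π u J x) with h | h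
          · rw [max_eq_left h]
            exact le_of_eq (by ring)
          · rw [max_eq_right h]
            nlinarith [sq_nonneg (fiberAvg σ (π (J + 1)) u x - fiberMax σ π u J x)]

/-- Absorb `2 M A ≤ 2 A² + M² / 2` in the nonnegativity of the potential. -/
theorem integral_fiberMax_sq_le (hπ : ∀ j, Measurable (π j))
    (href : ∀ j x y, π (j + 1) x = π (j + 1) y → π j x = π j y) (hu : MemLp u 2 σ) (J : ℕ) :
    ∫ x, fiberMax σ π u J x ^ 2 ∂σ ≤ 4 * ∫ x, fiberAvg σ (π J) u x ^ 2 ∂σ := by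
  have hM := memLp_fiberMax hπ hu J
  have hA := memLp_fiberAvg (hπ J) hu
  have h := integral_fiberMax_potential_nonneg hπ href hu J
  have h2 : ∫ x, (2 * (fiberMax σ π u J x * fiberAvg σ (π J) u x) - fiberMax σ π u J x ^ 2) ∂σ ≤
      ∫ x, (2 * fiberAvg σ (π J) u x ^ 2 - (1 / 2) * fiberMax σ π u J x ^ 2) ∂σ := by
    refine integral_mono (((hM.integrable_mul hA).const_mul 2).sub hM.integrable_sq)
      ((hA.integrable_sq.const_mul 2).sub (hM.integrable_sq.const_mul (1 / 2))) fun x => ?_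
    simp only
    nlinarith [sq_nonneg (2 * fiberAvg σ (π J) u x - fiberMax σ π u J x)]
  rw [integral_sub (hA.integrable_sq.const_mul 2) (hM.integrable_sq.const_mul (1 / 2)),
    integral_const_mul, integral_const_mul] at h2
  linarith

/-- The maximal inequality in `L²` for the averages over a refining sequence of partitions. -/
theorem lintegral_iSup_fiberAvg_sq_le (hπ : ∀ j, Measurable (π j))
    (href : ∀ j x y, π (j + 1) x = π (j + 1) y → π j x = π j y) {f : X → ℂ} (hf : MemLp f 2 σ) :
    ∫⁻ x, ⨆ i, ‖fiberAvg σ (π i) f x‖ₑ ^ 2 ∂σ ≤ 4 * ∫⁻ x, ‖f x‖ₑ ^ 2 ∂σ := by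
  -- Passing to `‖f‖` makes the running maxima nonnegative, so their squares increase with `J` and
  -- monotone convergence applies.
  set u : X → ℝ := fun x => ‖f x‖ with hu_def
  have hu : MemLp u 2 σ := hf.norm
  have hmeas : ∀ J, Measurable (fiberMax σ π u J) := fun J => by
    induction J with
    | zero => exact measurable_fiberAvg (hπ 0)
    | succ J ih => exact ih.max (measurable_fiberAvg (hπ _))
  have hnn : ∀ J x, 0 ≤ fiberMax σ π u J x := fun J x =>
    (fiberAvg_nonneg (fun y => norm_nonneg _) x).trans (fiberAvg_le_fiberMax le_rfl x)
  calc ∫⁻ x, ⨆ i, ‖fiberAvg σ (π i) f x‖ₑ ^ 2 ∂σ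
      ≤ ∫⁻ x, ⨆ J, ENNReal.ofReal (fiberMax σ π u J x ^ 2) ∂σ := by
        refine lintegral_mono fun x => iSup_mono fun J => ?_
        rw [← ofReal_norm, ← ENNReal.ofReal_pow (norm_nonneg _)]
        refine ENNReal.ofReal_le_ofReal (pow_le_pow_left₀ (norm_nonneg _) ?_ 2)
        exact (norm_fiberAvg_le x).trans (fiberAvg_le_fiberMax le_rfl x)
    _ = ⨆ J, ∫⁻ x, ENNReal.ofReal (fiberMax σ π u J x ^ 2) ∂σ := by
        refine lintegral_iSup (fun J => ((hmeas J).pow_const 2).ennreal_ofReal) ?_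
        refine monotone_nat_of_le_succ fun J x => ENNReal.ofReal_le_ofReal ?_
        exact pow_le_pow_left₀ (hnn J x) (le_max_left _ _) 2
    _ ≤ _ := by
        refine iSup_le fun J => ?_
        rw [← ofReal_integral_eq_lintegral_ofReal (memLp_fiberMax hπ hu J).integrable_sq
          (Filter.Eventually.of_forall fun x => by positivity)]
        calc _ ≤ ENNReal.ofReal (4 * ∫ x, fiberAvg σ (π J) u x ^ 2 ∂σ) :=
              ENNReal.ofReal_le_ofReal (integral_fiberMax_sq_le hπ href hu J)
          _ = 4 * ∫⁻ x, ‖fiberAvg σ (π J) u x‖ₑ ^ 2 ∂σ := by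
              rw [ENNReal.ofReal_mul (by norm_num),
                lintegral_enorm_sq_eq (memLp_fiberAvg (hπ J) hu)]
              simp
          _ ≤ _ := by
              gcongr 4 * ?_
              refine (lintegral_enorm_fiberAvg_sq_le (hπ J) hu.1).trans_eq ?_
              simp [hu_def]

end Maximal

/-! ### The size kernel and Schur's test. -/

/-- The kernel `t^β / (t + |x - y|)^{m + β}`. -/
noncomputable def decay {X : Type*} [PseudoMetricSpace X] (m β t : ℝ) (x y : X) : ℝ :=
  t ^ β / (t + dist x y) ^ (m + β)

section Decay

variable {X : Type*} [PseudoMetricSpace X] {m β t : ℝ}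

theorem decay_nonneg (ht : 0 < t) (x y : X) : 0 ≤ decay m β t x y := by
  unfold decay
  have : 0 < t + dist x y := by positivity
  positivity

theorem decay_comm (x y : X) : decay m β t x y = decay m β t y x := by
  simp only [decay, dist_comm]

/-- Splits the exponent: `α - β` is available as a gain away from the diagonal, while the rest, `β >
0`, keeps the kernel integrable. It is applied with `β = α / 2`. -/
theorem decay_eq_mul (ht : 0 < t) (α : ℝ) (x y : X) :
    decay m α t x y = (t / (t + dist x y)) ^ (α - β) * decay m β t x y := by
  unfold decay
  have h : 0 < t + dist x y := by positivity
  rw [Real.div_rpow ht.le h.le, div_mul_div_comm, ← Real.rpow_add ht, ← Real.rpow_add h]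
  congr 2 <;> ring

theorem decay_mono {α : ℝ} (ht : 0 < t) (hαβ : β ≤ α) (x y : X) :
    decay m α t x y ≤ decay m β t x y := by
  rw [decay_eq_mul ht α (β := β)]
  have h : 0 < t + dist x y := by positivity
  refine mul_le_of_le_one_left (decay_nonneg ht x y) (Real.rpow_le_one (by positivity) ?_ ?_)
  · rw [div_le_one h]; linarith [dist_nonneg (x := x) (y := y)]
  · linarith

theorem decay_le_of_dist_ge {α d : ℝ} (ht : 0 < t) (hαβ : β ≤ α) (hd : 0 < d) {x y : X}
    (hxy : d ≤ dist x y) : decay m α t x y ≤ (t / d) ^ (α - β) * decay m β t x y := by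
  rw [decay_eq_mul ht α (β := β)]
  have := decay_nonneg (m := m) (β := β) ht x y
  gcongr
  linarith

/-- Lets one kernel, at the scale `T`, serve for all times attached to a generation. -/
theorem decay_le_scale {T : ℝ} (hm : 0 < m) (hβ : 0 < β) (hT : T / 2 ≤ t) (ht : 0 < t)
    (htT : t ≤ T) (x y : X) : decay m β t x y ≤ 2 ^ (m + β) * decay m β T x y := by
  unfold decay
  have hd := dist_nonneg (x := x) (y := y)
  have hT0 : 0 < T := ht.trans_le htT
  have h1 : 0 < T + dist x y := by linarith
  have h2 : (T + dist x y) / 2 ≤ t + dist x y := by linarith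
  calc t ^ β / (t + dist x y) ^ (m + β) ≤ T ^ β / ((T + dist x y) / 2) ^ (m + β) := by gcongr
    _ = _ := by
      rw [Real.div_rpow h1.le (by norm_num)]
      field_simp

theorem decay_le_rpow_neg (hm : 0 < m) (hβ : 0 < β) (ht : 0 < t) (x y : X) :
    decay m β t x y ≤ t ^ (-m) := by
  unfold decay
  have hd := dist_nonneg (x := x) (y := y)
  calc t ^ β / (t + dist x y) ^ (m + β) ≤ t ^ β / t ^ (m + β) := by gcongr; linarith
    _ = t ^ (-m) := by rw [← Real.rpow_sub ht]; congr 1; ring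

variable [MeasurableSpace X] [OpensMeasurableSpace X]

theorem measurable_decay [SecondCountableTopology X] :
    Measurable (fun p : X × X => decay m β t p.1 p.2) := by
  unfold decay
  fun_prop

theorem measurable_decay_right (x : X) : Measurable (fun y : X => decay m β t x y) := by
  unfold decay
  fun_prop

/-- The constant in the bound for the integral of `decay`. -/
noncomputable def decayConst (m β : ℝ) : ℝ := 2 ^ (m + β) * (1 - 2 ^ (-β))⁻¹

theorem decayConst_pos (hβ : 0 < β) : 0 < decayConst m β := by
  have : (2 : ℝ) ^ (-β) < 1 := Real.rpow_lt_one_of_one_lt_of_neg (by norm_num) (by linarith)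
  unfold decayConst
  have h2 : 0 < 1 - (2 : ℝ) ^ (-β) := by linarith
  positivity

/-- Sum over the balls `B(x, 2^k t)`: the growth `2^{km}` against the decay `2^{-k(m+β)}` leaves a
geometric series of ratio `2^{-β}`. Growth is needed only for balls centred at `x`. -/
theorem lintegral_decay_le {σ : Measure X} {A : ℝ} {x : X} (hm : 0 < m) (hβ : 0 < β) (ht : 0 < t)
    (hA : 0 ≤ A) (hx : ∀ r, 0 < r → σ (Metric.ball x r) ≤ ENNReal.ofReal (A * r ^ m)) :
    ∫⁻ y, ENNReal.ofReal (decay m β t x y) ∂σ ≤ ENNReal.ofReal (A * decayConst m β) := by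
  set c : ℕ → ℝ := fun k => t ^ (-m) * 2 ^ (m + β) * (2 ^ (-(m + β))) ^ k with hc
  have hc0 : ∀ k, 0 ≤ c k := fun k => by positivity
  have hpt : ∀ y, ENNReal.ofReal (decay m β t x y) ≤
      ∑' k : ℕ, (Metric.ball x (2 ^ k * t)).indicator (fun _ => ENNReal.ofReal (c k)) y := by
    intro y
    have hex : ∃ k : ℕ, dist x y < 2 ^ k * t := by
      obtain ⟨k, hk⟩ := pow_unbounded_of_one_lt (dist x y / t) (one_lt_two (α := ℝ))
      exact ⟨k, by rwa [div_lt_iff₀ ht] at hk⟩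
    -- Take the least such `k`: minimality bounds `dist x y` from below, and when `k = 0` the
    -- summand `t` alone suffices.
    obtain ⟨k, hk1, hk2⟩ : ∃ k : ℕ, dist x y < 2 ^ k * t ∧ 2 ^ k * t / 2 ≤ t + dist x y := by
      classical
      refine ⟨Nat.find hex, Nat.find_spec hex, ?_⟩
      have hd := dist_nonneg (x := x) (y := y)
      rcases Nat.eq_zero_or_pos (Nat.find hex) with h | h
      · rw [h]; simp only [pow_zero, one_mul]; linarith
      · have := Nat.find_min hex (Nat.sub_lt h one_pos)
        rw [not_lt] at this
        obtain ⟨j, hj⟩ := Nat.exists_eq_succ_of_ne_zero h.ne'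
        rw [hj] at this ⊢
        simp only [Nat.succ_eq_add_one, Nat.add_sub_cancel] at this
        rw [Nat.succ_eq_add_one, pow_succ]
        linarith
    refine le_trans ?_ (ENNReal.le_tsum k)
    rw [Set.indicator_of_mem (by rwa [Metric.mem_ball, dist_comm])]
    refine ENNReal.ofReal_le_ofReal ?_
    unfold decay
    calc t ^ β / (t + dist x y) ^ (m + β) ≤ t ^ β / (2 ^ k * t / 2) ^ (m + β) := by gcongr
      _ = c k := by
        rw [hc]
        simp only
        rw [Real.div_rpow (by positivity) (by norm_num), Real.mul_rpow (by positivity) ht.le,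
          Real.rpow_neg ht.le, Real.rpow_neg (by norm_num : (0 : ℝ) ≤ 2) (m + β), inv_pow,
          ← Real.rpow_natCast, ← Real.rpow_natCast, ← Real.rpow_mul (by norm_num),
          ← Real.rpow_mul (by norm_num), mul_comm (k : ℝ), Real.rpow_add ht]
        have := Real.rpow_pos_of_pos ht β
        field_simp
  have h2β : (2 : ℝ) ^ (-β) < 1 :=
    Real.rpow_lt_one_of_one_lt_of_neg (by norm_num) (by linarith)
  have h2β0 : (0 : ℝ) ≤ 2 ^ (-β) := by positivity
  calc ∫⁻ y, ENNReal.ofReal (decay m β t x y) ∂σ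
      ≤ ∫⁻ y, ∑' k : ℕ, (Metric.ball x (2 ^ k * t)).indicator
          (fun _ => ENNReal.ofReal (c k)) y ∂σ := lintegral_mono hpt
    _ = ∑' k : ℕ, ENNReal.ofReal (c k) * σ (Metric.ball x (2 ^ k * t)) := by
        rw [lintegral_tsum fun k =>
          (measurable_const.indicator Metric.isOpen_ball.measurableSet).aemeasurable]
        refine tsum_congr fun k => ?_
        rw [lintegral_indicator_const Metric.isOpen_ball.measurableSet]
    _ ≤ ∑' k : ℕ, ENNReal.ofReal (A * 2 ^ (m + β) * (2 ^ (-β)) ^ k) := by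
        refine ENNReal.tsum_le_tsum fun k => ?_
        refine (mul_le_mul_right (hx _ (by positivity)) _).trans_eq ?_
        rw [← ENNReal.ofReal_mul (hc0 k)]
        congr 1
        rw [hc]
        simp only
        rw [Real.mul_rpow (by positivity) ht.le, Real.rpow_neg ht.le, neg_add,
          Real.rpow_add (by norm_num) (-m), mul_pow, Real.rpow_neg (by norm_num : (0 : ℝ) ≤ 2) m,
          inv_pow, ← Real.rpow_natCast 2 k, ← Real.rpow_natCast (2 ^ m) k,
          ← Real.rpow_mul (by norm_num), ← Real.rpow_mul (by norm_num), mul_comm m (k : ℝ)]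
        have := Real.rpow_pos_of_pos ht m
        field_simp
    _ = ENNReal.ofReal (A * decayConst m β) := by
        rw [← ENNReal.ofReal_tsum_of_nonneg (fun k => by positivity)
          ((summable_geometric_of_lt_one h2β0 h2β).mul_left _), tsum_mul_left,
          tsum_geometric_of_lt_one h2β0 h2β, decayConst, mul_assoc]

/-- Schur's test with the outer integral restricted to `F`, since growth is known only at points of
`F`. -/
theorem lintegral_sq_lintegral_decay_le [SecondCountableTopology X] {σ : Measure X} [SFinite σ]
    {A : ℝ} {F : Set X} (hm : 0 < m) (hβ : 0 < β) (ht : 0 < t)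
    (hA : 0 ≤ A) (hF : MeasurableSet F)
    (hx : ∀ x ∈ F, ∀ r, 0 < r → σ (Metric.ball x r) ≤ ENNReal.ofReal (A * r ^ m))
    {g : X → ℝ≥0∞} (hg : Measurable g) :
    ∫⁻ x in F, (∫⁻ y, ENNReal.ofReal (decay m β t x y) * g y ∂σ) ^ 2 ∂σ ≤
      ENNReal.ofReal (2 ^ m * (A * decayConst m β) ^ 2) * ∫⁻ y, g y ^ 2 ∂σ := by
  have hC := decayConst_pos (m := m) hβ
  -- A ball about an arbitrary `y` that meets `F` at `x` lies in the ball about `x` of twice the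
  -- radius, at the cost `2^m`.
  have hF' : ∀ y, ∀ r, 0 < r → (σ.restrict F) (Metric.ball y r) ≤
      ENNReal.ofReal (2 ^ m * A * r ^ m) := by
    intro y r hr
    rw [Measure.restrict_apply Metric.isOpen_ball.measurableSet]
    rcases (Metric.ball y r ∩ F).eq_empty_or_nonempty with h | ⟨x, hxy, hxF⟩
    · simp [h]
    · refine (measure_mono (t := Metric.ball x (2 * r)) ?_).trans
        ((hx x hxF (2 * r) (by positivity)).trans_eq ?_)
      · intro z hz
        have h1 := Metric.mem_ball.1 hz.1
        have h2 := Metric.mem_ball'.1 hxy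
        rw [Metric.mem_ball]
        linarith [dist_triangle z y x]
      · rw [Real.mul_rpow (by norm_num) hr.le]
        ring_nf
  have hdm : Measurable (fun p : X × X => ENNReal.ofReal (decay m β t p.1 p.2)) :=
    measurable_decay.ennreal_ofReal
  calc ∫⁻ x in F, (∫⁻ y, ENNReal.ofReal (decay m β t x y) * g y ∂σ) ^ 2 ∂σ
      ≤ ∫⁻ x in F, ENNReal.ofReal (A * decayConst m β) *
          ∫⁻ y, ENNReal.ofReal (decay m β t x y) * g y ^ 2 ∂σ ∂σ := by
        refine setLIntegral_mono' hF fun x hxF => ?_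
        refine (sq_lintegral_mul_le (measurable_decay_right x).ennreal_ofReal.aemeasurable
          hg.aemeasurable).trans ?_
        gcongr
        exact lintegral_decay_le hm hβ ht hA (hx x hxF)
    _ = ENNReal.ofReal (A * decayConst m β) *
          ∫⁻ y, ∫⁻ x in F, ENNReal.ofReal (decay m β t x y) * g y ^ 2 ∂σ ∂σ := by
        rw [lintegral_const_mul' _ _ ENNReal.ofReal_ne_top, lintegral_lintegral_swap]
        exact (hdm.mul ((hg.comp measurable_snd).pow_const 2)).aemeasurable
    _ ≤ ENNReal.ofReal (A * decayConst m β) *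
          ∫⁻ y, ENNReal.ofReal (2 ^ m * A * decayConst m β) * g y ^ 2 ∂σ := by
        gcongr with y
        rw [lintegral_mul_const _ (by
          simp only [decay_comm _ y]; exact (measurable_decay_right y).ennreal_ofReal)]
        gcongr
        simp only [decay_comm _ y]
        exact lintegral_decay_le hm hβ ht (by positivity) (hF' y)
    _ = _ := by
        rw [lintegral_const_mul' _ _ ENNReal.ofReal_ne_top, ← mul_assoc,
          ← ENNReal.ofReal_mul (by positivity)]
        congr 2
        ring

end Decay

/-! ### Cancellation and off-diagonal estimates for `theta`. -/

section Kernel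

variable {n : ℕ} {m α K : ℝ}
  {k : ℝ → EuclideanSpace ℝ (Fin n) → EuclideanSpace ℝ (Fin n) → ℂ}
  {σ : Measure (EuclideanSpace ℝ (Fin n))}

theorem IsKernel.nonneg_const (hk : IsKernel m α K k) : 0 ≤ K := by
  have h := (norm_nonneg _).trans (hk.size 1 one_pos 0 0)
  simpa using h

theorem IsKernel.norm_le_decay (hk : IsKernel m α K k) {t : ℝ} (ht : 0 < t)
    (x y : EuclideanSpace ℝ (Fin n)) : ‖k t x y‖ ≤ K * decay m α t x y := hk.size t ht x y

theorem IsKernel.measurable_right (hk : IsKernel m α K k) {t : ℝ} (ht : 0 < t)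
    (x : EuclideanSpace ℝ (Fin n)) : Measurable (k t x) :=
  hk.measurable.comp (f := fun y => ((⟨t, ht⟩ : Set.Ioi (0 : ℝ)), x, y)) (by fun_prop)

theorem IsKernel.integrable_mul (hk : IsKernel m α K k) (hm : 0 < m) (hα : 0 < α) {t : ℝ}
    (ht : 0 < t) (x : EuclideanSpace ℝ (Fin n)) {f : EuclideanSpace ℝ (Fin n) → ℂ}
    (hf : Integrable f σ) : Integrable (fun y => k t x y * f y) σ :=
  hf.bdd_mul (c := K * t ^ (-m)) (hk.measurable_right ht x).aestronglyMeasurable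
    (Filter.Eventually.of_forall fun y => (hk.norm_le_decay ht x y).trans
      (mul_le_mul_of_nonneg_left (decay_le_rpow_neg hm hα ht x y) hk.nonneg_const))

theorem IsKernel.theta_sub (hk : IsKernel m α K k) (hm : 0 < m) (hα : 0 < α) {t : ℝ}
    (ht : 0 < t) (x : EuclideanSpace ℝ (Fin n)) {f g : EuclideanSpace ℝ (Fin n) → ℂ}
    (hf : Integrable f σ) (hg : Integrable g σ) :
    theta k σ (fun y => f y - g y) t x = theta k σ f t x - theta k σ g t x := by
  unfold theta
  rw [← integral_sub (hk.integrable_mul hm hα ht x hf) (hk.integrable_mul hm hα ht x hg)]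
  simp only [mul_sub]

theorem IsKernel.theta_add (hk : IsKernel m α K k) (hm : 0 < m) (hα : 0 < α) {t : ℝ}
    (ht : 0 < t) (x : EuclideanSpace ℝ (Fin n)) {f g : EuclideanSpace ℝ (Fin n) → ℂ}
    (hf : Integrable f σ) (hg : Integrable g σ) :
    theta k σ (fun y => f y + g y) t x = theta k σ f t x + theta k σ g t x := by
  unfold theta
  rw [← integral_add (hk.integrable_mul hm hα ht x hf) (hk.integrable_mul hm hα ht x hg)]
  simp only [mul_add]

theorem IsKernel.theta_sum (hk : IsKernel m α K k) (hm : 0 < m) (hα : 0 < α) {t : ℝ}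
    (ht : 0 < t) (x : EuclideanSpace ℝ (Fin n)) {g : ℕ → EuclideanSpace ℝ (Fin n) → ℂ}
    (s : Finset ℕ) (hg : ∀ j, Integrable (g j) σ) :
    theta k σ (fun y => ∑ j ∈ s, g j y) t x = ∑ j ∈ s, theta k σ (g j) t x := by
  unfold theta
  rw [← integral_finsetSum s fun j _ => hk.integrable_mul hm hα ht x (hg j)]
  simp only [Finset.mul_sum]

theorem theta_congr_ae {f g : EuclideanSpace ℝ (Fin n) → ℂ} (h : f =ᵐ[σ] g) (t : ℝ)
    (x : EuclideanSpace ℝ (Fin n)) : theta k σ f t x = theta k σ g t x :=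
  integral_congr_ae (h.mono fun y hy => by simp only [hy])

theorem theta_const_mul (a : ℂ) (t : ℝ) (x : EuclideanSpace ℝ (Fin n)) :
    theta k σ (fun _ => a) t x = theta k σ (fun _ => 1) t x * a := by
  unfold theta
  rw [← integral_mul_const]
  simp

/-- Cancellation: for `g` of mean zero on the pieces of a partition into sets of diameter at
most `d`, the Hölder condition yields the factor `(d / t) ^ α`. -/
theorem IsKernel.enorm_theta_le_of_fiber {ι : Type*} [MeasurableSpace ι]
    [MeasurableSingletonClass ι] [Countable ι] {π : EuclideanSpace ℝ (Fin n) → ι}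
    (hk : IsKernel m α K k) (hm : 0 < m) (hα : 0 < α) {t β d : ℝ} (hβα : β ≤ α)
    (ht : 0 < t) (x : EuclideanSpace ℝ (Fin n)) (hπ : Measurable π)
    (hd : ∀ y z, π y = π z → dist y z ≤ d) (hd0 : 0 ≤ d)
    {g : EuclideanSpace ℝ (Fin n) → ℂ} (hg : Integrable g σ)
    (h0 : ∀ v, ∫ y in π ⁻¹' {v}, g y ∂σ = 0) :
    ‖theta k σ g t x‖ₑ ≤ ENNReal.ofReal (K * (2 * d / t) ^ α) *
      ∫⁻ y, ENNReal.ofReal (decay m β t x y) * ‖g y‖ₑ ∂σ := by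
  have hK := hk.nonneg_const
  suffices h : ∃ ψ : EuclideanSpace ℝ (Fin n) → ℂ,
      theta k σ g t x = ∫ y, ψ y * g y ∂σ ∧
      ∀ y, ‖ψ y‖ ≤ K * (2 * d / t) ^ α * decay m β t x y by
    obtain ⟨ψ, h1, h2⟩ := h
    rw [h1, ← lintegral_const_mul' _ _ ENNReal.ofReal_ne_top]
    refine (enorm_integral_le_lintegral_enorm _).trans (lintegral_mono fun y => ?_)
    rw [enorm_mul, ← mul_assoc, ← ENNReal.ofReal_mul (by positivity), ← ofReal_norm]
    gcongr
    exact h2 y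
  -- If `d ≥ t / 2` the Hölder condition may be unavailable, but then `2 d / t ≥ 1` and the size
  -- condition already suffices. Hence the factor `2` in the bound.
  rcases lt_or_ge d (t / 2) with hdt | hdt
  -- Subtract the kernel at a chosen representative of each fibre. This function factors through the
  -- countable `ι`, so it is measurable, and it integrates to zero against `g`.
  · have hinv : ∀ y, π (Function.invFun π (π y)) = π y := fun y => Function.invFun_eq ⟨y, rfl⟩
    set φ : EuclideanSpace ℝ (Fin n) → ℂ := fun y => k t x (Function.invFun π (π y)) with hφ
    have hφm : Measurable φ :=
      (measurable_of_countable fun v => k t x (Function.invFun π v)).comp hπ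
    have hφint : Integrable (fun y => φ y * g y) σ :=
      hg.bdd_mul (c := K * t ^ (-m)) hφm.aestronglyMeasurable
        (Filter.Eventually.of_forall fun y => (hk.norm_le_decay ht x _).trans
          (mul_le_mul_of_nonneg_left (decay_le_rpow_neg hm hα ht x _) hk.nonneg_const))
    have hφ0 : ∫ y, φ y * g y ∂σ = 0 :=
      integral_mul_eq_zero_of_fiber hπ (fun y z hyz => by simp only [hφ, hyz]) hφint h0
    refine ⟨fun y => k t x y - φ y, ?_, fun y => ?_⟩
    · simp only [sub_mul]
      rw [integral_sub (hk.integrable_mul hm hα ht x hg) hφint, hφ0, sub_zero, theta]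
    · have hyd : dist y (Function.invFun π (π y)) ≤ d := hd _ _ (hinv y).symm
      have hpos : 0 < t + dist x y := by positivity
      calc ‖k t x y - φ y‖
          ≤ K * (dist y (Function.invFun π (π y)) ^ α / (t + dist x y) ^ (m + α)) :=
            hk.holder t ht x y _ (hyd.trans_lt hdt)
        _ ≤ K * ((2 * d) ^ α / (t + dist x y) ^ (m + α)) := by gcongr; linarith
        _ = K * (2 * d / t) ^ α * decay m α t x y := by
            unfold decay
            rw [Real.div_rpow (by positivity) ht.le]
            have := Real.rpow_pos_of_pos ht α
            field_simp
        _ ≤ _ := by gcongr; exact decay_mono ht hβα x y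
  · refine ⟨k t x, rfl, fun y => (hk.norm_le_decay ht x y).trans ?_⟩
    have h1 : (1 : ℝ) ≤ (2 * d / t) ^ α := by
      refine Real.one_le_rpow ?_ hα.le
      rw [le_div_iff₀ ht]; linarith
    have h2 := decay_nonneg (m := m) (β := β) ht x y
    calc K * decay m α t x y ≤ K * decay m β t x y := by gcongr; exact decay_mono ht hβα x y
      _ = K * 1 * decay m β t x y := by ring
      _ ≤ _ := by gcongr

/-- Off-diagonal decay: for `g` constant on a set that contains the `d`-neighbourhood of `x`. -/
theorem IsKernel.enorm_theta_sub_le (hk : IsKernel m α K k) (hm : 0 < m) (hα : 0 < α) {t β d : ℝ}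
    (hβα : β ≤ α) (ht : 0 < t) (hd : 0 < d) (x : EuclideanSpace ℝ (Fin n)) [IsFiniteMeasure σ]
    {g : EuclideanSpace ℝ (Fin n) → ℂ} (hg : Integrable g σ)
    (hx : ∀ y, dist x y < d → g y = g x) :
    ‖theta k σ g t x - theta k σ (fun _ => 1) t x * g x‖ₑ ≤
      ENNReal.ofReal (K * (t / d) ^ (α - β)) *
        (∫⁻ y, ENNReal.ofReal (decay m β t x y) * ‖g y‖ₑ ∂σ +
          ‖g x‖ₑ * ∫⁻ y, ENNReal.ofReal (decay m β t x y) ∂σ) := by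
  have hK := hk.nonneg_const
  rw [← theta_const_mul (σ := σ) (g x) t x, ← hk.theta_sub hm hα ht x hg (integrable_const _)]
  calc ‖theta k σ (fun y => g y - g x) t x‖ₑ
      ≤ ∫⁻ y, ENNReal.ofReal (K * (t / d) ^ (α - β)) *
          (ENNReal.ofReal (decay m β t x y) * ‖g y‖ₑ +
            ‖g x‖ₑ * ENNReal.ofReal (decay m β t x y)) ∂σ := by
        refine (enorm_integral_le_lintegral_enorm _).trans (lintegral_mono fun y => ?_)
        rcases lt_or_ge (dist x y) d with hxy | hxy
        · simp [hx y hxy]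
        · rw [enorm_mul]
          calc ‖k t x y‖ₑ * ‖g y - g x‖ₑ
              ≤ ENNReal.ofReal (K * (t / d) ^ (α - β) * decay m β t x y) *
                  (‖g y‖ₑ + ‖g x‖ₑ) := by
                gcongr
                · rw [← ofReal_norm]
                  refine ENNReal.ofReal_le_ofReal ((hk.norm_le_decay ht x y).trans ?_)
                  rw [mul_assoc]
                  gcongr
                  exact decay_le_of_dist_ge ht hβα hd hxy
                · exact enorm_sub_le
            _ = _ := by
                rw [ENNReal.ofReal_mul (by positivity)]
                ring
    _ = _ := by
        rw [lintegral_const_mul' _ _ ENNReal.ofReal_ne_top,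
          lintegral_add_right _ ((measurable_decay_right x).ennreal_ofReal.const_mul _),
          lintegral_const_mul' _ _ enorm_ne_top]

theorem lintegral_decay_mul_le_scale {m β t T : ℝ} (hm : 0 < m) (hβ : 0 < β) (hT : T / 2 ≤ t)
    (ht : 0 < t) (htT : t ≤ T) (x : EuclideanSpace ℝ (Fin n))
    (g : EuclideanSpace ℝ (Fin n) → ℝ≥0∞) :
    ∫⁻ y, ENNReal.ofReal (decay m β t x y) * g y ∂σ ≤
      ENNReal.ofReal (2 ^ (m + β)) * ∫⁻ y, ENNReal.ofReal (decay m β T x y) * g y ∂σ := by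
  rw [← lintegral_const_mul' _ _ ENNReal.ofReal_ne_top]
  refine lintegral_mono fun y => ?_
  rw [← mul_assoc, ← ENNReal.ofReal_mul (by positivity)]
  gcongr
  exact decay_le_scale hm hβ hT ht htT x y

theorem lintegral_decay_mul_le_rpow_neg {m β t : ℝ} (hm : 0 < m) (hβ : 0 < β)
    (ht : 0 < t) (x : EuclideanSpace ℝ (Fin n)) (g : EuclideanSpace ℝ (Fin n) → ℝ≥0∞) :
    ∫⁻ y, ENNReal.ofReal (decay m β t x y) * g y ∂σ ≤ ENNReal.ofReal (t ^ (-m)) * ∫⁻ y, g y ∂σ := by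
  rw [← lintegral_const_mul' _ _ ENNReal.ofReal_ne_top]
  refine lintegral_mono fun y => ?_
  gcongr
  exact decay_le_rpow_neg hm hβ ht x y

end Kernel

/-! ### Grids, good points, and the times attached to a generation. -/

/-- A refining sequence of countable partitions (the fibres of the `π i`), those of generation
`i` having diameter at most `D L 2^{-i}`, such that for `x ∈ F` almost all of the space is in the
same piece of generation `0` as `x`. -/
structure IsGrid {n : ℕ} {ι : Type*} [MeasurableSpace ι] (σ : Measure (EuclideanSpace ℝ (Fin n)))
    (π : ℕ → EuclideanSpace ℝ (Fin n) → ι) (L D : ℝ) (F : Set (EuclideanSpace ℝ (Fin n))) :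
    Prop where
  measurable : ∀ j, Measurable (π j)
  refines : ∀ j x y, π (j + 1) x = π (j + 1) y → π j x = π j y
  diam : ∀ j x y, π j x = π j y → dist x y ≤ D * (L / 2 ^ j)
  top : ∀ x ∈ F, ∀ᵐ y ∂σ, π 0 y = π 0 x

/-- A point is good at generation `i` if it is well inside its pieces of the previous
generations. -/
def IsGood {n : ℕ} {ι : Type*} (π : ℕ → EuclideanSpace ℝ (Fin n) → ι) (L η : ℝ) (i : ℕ)
    (x : EuclideanSpace ℝ (Fin n)) : Prop :=
  ∀ j, 1 ≤ j → j ≤ i → ∀ y, dist x y < η * (3 / 4) ^ (i - j) * (L / 2 ^ j) → π j y = π j x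

/-- The times attached to generation `i`. -/
def timeSet (L l : ℝ) (i : ℕ) : Set ℝ := Set.Ioc (L / 2 ^ i / 2) (L / 2 ^ i) ∩ Set.Ioo 0 l

theorem measurableSet_timeSet (L l : ℝ) (i : ℕ) : MeasurableSet (timeSet L l i) :=
  measurableSet_Ioc.inter measurableSet_Ioo

theorem pairwise_disjoint_timeSet {L l : ℝ} (hL : 0 < L) :
    Pairwise (Function.onFun Disjoint (timeSet L l)) := by
  have key : ∀ i j, i < j → Disjoint (timeSet L l i) (timeSet L l j) := by
    intro i j hij
    rw [Set.disjoint_left]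
    rintro t ⟨⟨h1, -⟩, -⟩ ⟨⟨-, h2⟩, -⟩
    have : L / 2 ^ j ≤ L / 2 ^ i / 2 := by
      rw [div_div, ← pow_succ]
      gcongr
      · norm_num
      · omega
    linarith
  intro i j hij
  rcases lt_or_gt_of_ne hij with h | h
  · exact key i j h
  · exact (key j i h).symm

theorem iUnion_timeSet {L l : ℝ} (hl : l ≤ L) : ⋃ i, timeSet L l i = Set.Ioo 0 l := by
  ext t
  simp only [Set.mem_iUnion, timeSet, Set.mem_inter_iff, exists_and_right, and_iff_right_iff_imp]
  rintro ⟨h0, h1⟩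
  have hL : 0 < L := by linarith
  obtain ⟨i, hi1, hi2⟩ := exists_nat_pow_near (x := L / t) (y := (2 : ℝ))
    (by rw [one_le_div h0]; linarith) one_lt_two
  refine ⟨i, ?_, ?_⟩
  · rw [div_div, ← pow_succ, div_lt_comm₀ (by positivity) h0]
    exact hi2
  · rw [le_div_comm₀ h0 (by positivity)]
    exact hi1

theorem lintegral_Ioo_eq_tsum_timeSet {L l : ℝ} (hL : 0 < L) (hl : l ≤ L) (φ : ℝ → ℝ≥0∞) :
    ∫⁻ t in Set.Ioo 0 l, φ t = ∑' i, ∫⁻ t in timeSet L l i, φ t := by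
  rw [← iUnion_timeSet hl, lintegral_iUnion (measurableSet_timeSet L l)
    (pairwise_disjoint_timeSet hL)]

/-- The interval `(T/2, T]` has length `T/2` and `1/t ≤ 2/T` on it, so its `dt/t` mass is at most
`1`. -/
theorem lintegral_timeSet_le {L l : ℝ} (hL : 0 < L) (i : ℕ) {φ : ℝ → ℝ≥0∞} {B : ℝ≥0∞}
    (h : ∀ t ∈ timeSet L l i, φ t ≤ B) :
    ∫⁻ t in timeSet L l i, φ t / ENNReal.ofReal t ≤ B := by
  have hT : 0 < L / 2 ^ i / 2 := by positivity
  calc ∫⁻ t in timeSet L l i, φ t / ENNReal.ofReal t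
      ≤ ∫⁻ t in timeSet L l i, B / ENNReal.ofReal (L / 2 ^ i / 2) := by
        refine setLIntegral_mono' (measurableSet_timeSet L l i) fun t ht => ?_
        exact ENNReal.div_le_div (h t ht) (ENNReal.ofReal_le_ofReal ht.1.1.le)
    _ ≤ B / ENNReal.ofReal (L / 2 ^ i / 2) * ENNReal.ofReal (L / 2 ^ i / 2) := by
        rw [setLIntegral_const]
        gcongr
        refine (measure_mono Set.inter_subset_left).trans ?_
        rw [Real.volume_Ioc]
        exact ENNReal.ofReal_le_ofReal (by linarith)
    _ = B := ENNReal.div_mul_cancel (by simpa using hT) ENNReal.ofReal_ne_top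

/-- With truncated subtraction the exponent is `|i - j|`, so the sum is dominated by two geometric
series. -/
theorem tsum_pow_dist_le {r : ℝ} (h0 : 0 ≤ r) (h1 : r < 1) (i : ℕ) :
    ∑' j : ℕ, ENNReal.ofReal (r ^ ((i - j) + (j - i))) ≤ ENNReal.ofReal (2 / (1 - r)) := by
  have hg : ∑' s : ℕ, ENNReal.ofReal (r ^ s) = ENNReal.ofReal (1 / (1 - r)) := by
    rw [← ENNReal.ofReal_tsum_of_nonneg (fun s => by positivity)
      (summable_geometric_of_lt_one h0 h1), tsum_geometric_of_lt_one h0 h1, one_div]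
  have hr : 0 < 1 - r := by linarith
  have key : ∀ J, ∑ j ∈ Finset.range J, ENNReal.ofReal (r ^ ((i - j) + (j - i))) ≤
      ∑ j ∈ Finset.range (i + J), ENNReal.ofReal (r ^ ((i - j) + (j - i))) := fun J =>
    Finset.sum_le_sum_of_subset (Finset.range_mono (by omega))
  refine ENNReal.tsum_le_of_sum_range_le fun J => (key J).trans ?_
  rw [Finset.sum_range_add]
  have e2 : (2 / (1 - r)) = 1 / (1 - r) + 1 / (1 - r) := by ring
  rw [e2, ENNReal.ofReal_add (by positivity) (by positivity), ← hg]
  refine add_le_add ?_ ?_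
  · rw [← Finset.sum_range_reflect]
    refine le_trans (Finset.sum_le_sum fun j hj => ?_) (ENNReal.sum_le_tsum (Finset.range i))
    refine ENNReal.ofReal_le_ofReal (pow_le_pow_of_le_one h0 h1.le ?_)
    have := Finset.mem_range.1 hj
    omega
  · refine le_trans (Finset.sum_le_sum fun j hj => ?_) (ENNReal.sum_le_tsum (Finset.range J))
    refine ENNReal.ofReal_le_ofReal (pow_le_pow_of_le_one h0 h1.le ?_)
    omega

/-! ### Expansion of the averaging error into martingale differences. -/

section Error

variable {n : ℕ} {ι : Type*}

/-- The error made when `θ_t f` is replaced by `θ_t 1` times an average of `f`. -/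
noncomputable def avgError (k : ℝ → EuclideanSpace ℝ (Fin n) → EuclideanSpace ℝ (Fin n) → ℂ)
    (σ : Measure (EuclideanSpace ℝ (Fin n))) (π : EuclideanSpace ℝ (Fin n) → ι)
    (f : EuclideanSpace ℝ (Fin n) → ℂ) (t : ℝ) (x : EuclideanSpace ℝ (Fin n)) : ℂ :=
  theta k σ f t x - theta k σ (fun _ => 1) t x * fiberAvg σ π f x

/-- The contribution of a single generation of differences to `avgError`. -/
noncomputable def diffError (k : ℝ → EuclideanSpace ℝ (Fin n) → EuclideanSpace ℝ (Fin n) → ℂ)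
    (σ : Measure (EuclideanSpace ℝ (Fin n))) (π : ℕ → EuclideanSpace ℝ (Fin n) → ι)
    (f : EuclideanSpace ℝ (Fin n) → ℂ) (i j : ℕ) (t : ℝ) (x : EuclideanSpace ℝ (Fin n)) : ℂ :=
  theta k σ (fiberDiff σ π f j) t x -
    theta k σ (fun _ => 1) t x * (if j < i then fiberDiff σ π f j x else 0)

variable {m α K L D A η : ℝ}
  {k : ℝ → EuclideanSpace ℝ (Fin n) → EuclideanSpace ℝ (Fin n) → ℂ}
  {σ : Measure (EuclideanSpace ℝ (Fin n))} [IsFiniteMeasure σ]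
  [MeasurableSpace ι] [MeasurableSingletonClass ι] [Countable ι]
  {π : ℕ → EuclideanSpace ℝ (Fin n) → ι} {F : Set (EuclideanSpace ℝ (Fin n))}
  {f : EuclideanSpace ℝ (Fin n) → ℂ}

theorem enorm_avgError_le_add (hk : IsKernel m α K k) (hm : 0 < m) (hα : 0 < α)
    (hπ : IsGrid σ π L D F) (hf : MemLp f 2 σ) {x : EuclideanSpace ℝ (Fin n)} (hx : x ∈ F)
    {t : ℝ} (ht : 0 < t) {i J : ℕ} (hiJ : i ≤ J) :
    ‖avgError k σ (π i) f t x‖ₑ ≤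
      ‖theta k σ (fun y => f y - fiberAvg σ (π J) f y) t x‖ₑ + ∑' j, ‖diffError k σ π f i j t x‖ₑ := by
  have hI : Integrable f σ := hf.integrable (by norm_num)
  have hA : ∀ j, Integrable (fiberAvg σ (π j) f) σ := fun j =>
    (memLp_fiberAvg (hπ.measurable j) hf).integrable (by norm_num)
  have hD : ∀ j, Integrable (fiberDiff σ π f j) σ := fun j => (hA (j + 1)).sub (hA j)
  have h1 : theta k σ (fiberAvg σ (π J) f) t x = theta k σ (fun _ => 1) t x *
      fiberAvg σ (π 0) f x + ∑ j ∈ Finset.range J, theta k σ (fiberDiff σ π f j) t x := by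
    have e : fiberAvg σ (π J) f = fun y => fiberAvg σ (π 0) f y +
        ∑ j ∈ Finset.range J, fiberDiff σ π f j y := funext fun y => sum_fiberDiff J y
    rw [e, hk.theta_add hm hα ht x (hA 0) (integrable_finsetSum _ fun j _ => hD j),
      hk.theta_sum hm hα ht x _ hD, ← theta_const_mul]
    congr 1
    -- The average of generation `0` is almost everywhere its value at `x`, so generation `0`
    -- contributes no error.
    exact theta_congr_ae ((hπ.top x hx).mono fun y hy => fiberAvg_congr_point hy) t x
  have h2 : fiberAvg σ (π i) f x = fiberAvg σ (π 0) f x +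
      ∑ j ∈ Finset.range J, (if j < i then fiberDiff σ π f j x else 0) := by
    rw [sum_fiberDiff i x, ← Finset.sum_filter]
    congr 2
    ext j
    simp only [Finset.mem_range, Finset.mem_filter]
    omega
  have h3 : avgError k σ (π i) f t x = theta k σ (fun y => f y - fiberAvg σ (π J) f y) t x +
      ∑ j ∈ Finset.range J, diffError k σ π f i j t x := by
    simp only [avgError, diffError, Finset.sum_sub_distrib, ← Finset.mul_sum]
    rw [hk.theta_sub hm hα ht x hI (hA J), h1, h2]
    ring
  rw [h3]
  refine (enorm_add_le _ _).trans ?_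
  gcongr
  exact (enorm_sum_le _ _).trans (ENNReal.sum_le_tsum _)

/-- Deliberately crude: all that matters is a finite bound independent of the partition. -/
theorem lintegral_enorm_sub_fiberAvg_le {π : EuclideanSpace ℝ (Fin n) → ι} (hπ : Measurable π)
    (hf : MemLp f 2 σ) :
    ∫⁻ y, ‖f y - fiberAvg σ π f y‖ₑ ∂σ ≤ 4 * ∫⁻ y, ‖f y‖ₑ ^ 2 ∂σ + σ Set.univ := by
  have hpt : ∀ a : ℝ≥0∞, a ≤ a ^ 2 + 1 := fun a => by
    rcases le_total a 1 with h | h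
    · exact h.trans le_add_self
    · exact (le_self_pow h two_ne_zero).trans le_self_add
  calc ∫⁻ y, ‖f y - fiberAvg σ π f y‖ₑ ∂σ
      ≤ ∫⁻ y, ((2 * ‖f y‖ₑ ^ 2 + 2 * ‖fiberAvg σ π f y‖ₑ ^ 2) + 1) ∂σ := by
        refine lintegral_mono fun y => (hpt _).trans ?_
        gcongr
        simpa [sub_eq_add_neg] using enorm_add_sq_le (f y) (-fiberAvg σ π f y)
    _ = 2 * ∫⁻ y, ‖f y‖ₑ ^ 2 ∂σ + 2 * ∫⁻ y, ‖fiberAvg σ π f y‖ₑ ^ 2 ∂σ + σ Set.univ := by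
        have hm := ((measurable_fiberAvg (σ := σ) (f := f) hπ).enorm.pow_const 2).const_mul 2
        rw [lintegral_add_right _ measurable_const, lintegral_add_right _ hm,
          lintegral_const_mul' _ _ (by simp), lintegral_const_mul' _ _ (by simp)]
        simp
    _ ≤ 2 * ∫⁻ y, ‖f y‖ₑ ^ 2 ∂σ + 2 * ∫⁻ y, ‖f y‖ₑ ^ 2 ∂σ + σ Set.univ := by
        gcongr 2 * ∫⁻ y, ‖f y‖ₑ ^ 2 ∂σ + 2 * ?_ + σ Set.univ
        exact lintegral_enorm_fiberAvg_sq_le hπ hf.1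
    _ = _ := by rw [← two_mul, ← mul_assoc]; norm_num

/-- At fixed `t` the remainder `θ_t (f - E_J f)` tends to `0`: it has mean zero on cubes whose
diameter tends to `0`, so cancellation applies. Convergence of the martingale itself is not needed.
-/
theorem enorm_avgError_le_tsum (hk : IsKernel m α K k) (hm : 0 < m) (hα : 0 < α) (hL : 0 < L)
    (hD : 0 ≤ D) (hπ : IsGrid σ π L D F) (hf : MemLp f 2 σ) {x : EuclideanSpace ℝ (Fin n)}
    (hx : x ∈ F) {t : ℝ} (ht : 0 < t) (i : ℕ) :
    ‖avgError k σ (π i) f t x‖ₑ ≤ ∑' j, ‖diffError k σ π f i j t x‖ₑ := by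
  set S := ∑' j, ‖diffError k σ π f i j t x‖ₑ
  set B := 4 * ∫⁻ y, ‖f y‖ₑ ^ 2 ∂σ + σ Set.univ with hB
  have hBtop : B ≠ ∞ := by
    have := ((memLp_two_iff_lintegral hf.1).1 hf).ne
    finiteness
  have hI : Integrable f σ := hf.integrable (by norm_num)
  have hA : ∀ j, Integrable (fiberAvg σ (π j) f) σ := fun j =>
    (memLp_fiberAvg (hπ.measurable j) hf).integrable (by norm_num)
  have hbound : ∀ J, i ≤ J → ‖avgError k σ (π i) f t x‖ₑ ≤
      ENNReal.ofReal (K * (2 * (D * (L / 2 ^ J)) / t) ^ α) * (ENNReal.ofReal (t ^ (-m)) * B) + S := by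
    intro J hJ
    refine (enorm_avgError_le_add hk hm hα hπ hf hx ht hJ).trans ?_
    gcongr
    refine (hk.enorm_theta_le_of_fiber hm hα le_rfl ht x (hπ.measurable J) (hπ.diam J)
      (by positivity) (hI.sub (hA J)) (fun v => ?_)).trans ?_
    · simp only [Pi.sub_apply]
      rw [integral_sub hI.integrableOn (hA J).integrableOn, setIntegral_fiberAvg (hπ.measurable J),
        sub_self]
    · gcongr
      refine (lintegral_decay_mul_le_rpow_neg hm hα ht x _).trans ?_
      gcongr
      exact lintegral_enorm_sub_fiberAvg_le (hπ.measurable J) hf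
  have hlim : Filter.Tendsto (fun J : ℕ => ENNReal.ofReal (K * (2 * (D * (L / 2 ^ J)) / t) ^ α) *
      (ENNReal.ofReal (t ^ (-m)) * B) + S) Filter.atTop (nhds (0 * (ENNReal.ofReal (t ^ (-m)) * B)
        + S)) := by
    refine Filter.Tendsto.add (ENNReal.Tendsto.mul_const ?_ (Or.inr (by finiteness)))
      tendsto_const_nhds
    rw [← ENNReal.ofReal_zero]
    refine (ENNReal.continuous_ofReal.tendsto 0).comp ?_
    have h1 : Filter.Tendsto (fun J : ℕ => 2 * (D * (L / 2 ^ J)) / t) Filter.atTop (nhds 0) := by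
      have h2 := (tendsto_pow_atTop_nhds_zero_of_lt_one (r := (1 / 2 : ℝ)) (by norm_num)
        (by norm_num)).const_mul (2 * D * L / t)
      rw [mul_zero] at h2
      refine h2.congr fun J => ?_
      rw [div_pow, one_pow]
      ring
    have h3 := (h1.rpow_const (p := α) (Or.inr hα.le)).const_mul K
    rwa [Real.zero_rpow hα.ne', mul_zero] at h3
  rw [zero_mul, zero_add] at hlim
  exact ge_of_tendsto hlim (Filter.eventually_atTop.2 ⟨i, hbound⟩)

end Error

/-- The constant in the bound for `diffError`. -/
noncomputable def diffConst (m α K D A η : ℝ) : ℝ :=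
  K * (4 * D) ^ α * 2 ^ (m + α / 2) +
    K * (3 / (2 * η)) ^ (α / 2) * (2 ^ (m + α / 2) + A * decayConst m (α / 2))

/-- The constant in the square function bound for `avgError`. -/
noncomputable def errorConst (m α K D A η : ℝ) : ℝ :=
  diffConst m α K D A η ^ 2 * (2 / (1 - (2 / 3) ^ (α / 2))) ^ 2 *
    (2 * (2 ^ m * (A * decayConst m (α / 2)) ^ 2) + 2)

/-! ### Almost orthogonality and the square function of the error. -/

section ErrorBound

variable {n : ℕ} {ι : Type*} {m α K L D A η : ℝ}
  {k : ℝ → EuclideanSpace ℝ (Fin n) → EuclideanSpace ℝ (Fin n) → ℂ}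
  {σ : Measure (EuclideanSpace ℝ (Fin n))} [IsFiniteMeasure σ]
  [MeasurableSpace ι] [MeasurableSingletonClass ι] [Countable ι]
  {π : ℕ → EuclideanSpace ℝ (Fin n) → ι} {F : Set (EuclideanSpace ℝ (Fin n))}
  {f : EuclideanSpace ℝ (Fin n) → ℂ}

/-- Differences finer than `t`: the gain comes from their cancellation, at every point `x`. -/
theorem enorm_diffError_le_of_le (hk : IsKernel m α K k) (hm : 0 < m) (hα : 0 < α) (hL : 0 < L)
    (hD : 0 ≤ D) (hπ : IsGrid σ π L D F) (hf : MemLp f 2 σ) (x : EuclideanSpace ℝ (Fin n))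
    {i j : ℕ} (hij : i ≤ j) {t : ℝ} (ht : t ∈ Set.Ioc (L / 2 ^ i / 2) (L / 2 ^ i)) :
    ‖diffError k σ π f i j t x‖ₑ ≤
      ENNReal.ofReal (K * (4 * D) ^ α * 2 ^ (m + α / 2) * ((2 / 3) ^ (α / 2)) ^ (j - i)) *
        ∫⁻ y, ENNReal.ofReal (decay m (α / 2) (L / 2 ^ i) x y) * ‖fiberDiff σ π f j y‖ₑ ∂σ := by
  have hK := hk.nonneg_const
  have hT : 0 < L / 2 ^ i := by positivity
  have ht0 : 0 < t := by linarith [ht.1]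
  have hDI : Integrable (fiberDiff σ π f j) σ :=
    (memLp_fiberDiff hπ.measurable hf j).integrable (by norm_num)
  have h1 := hk.enorm_theta_le_of_fiber hm hα (β := α / 2) (by linarith) ht0 x (hπ.measurable j)
    (hπ.diam j) (by positivity) hDI (setIntegral_fiberDiff hπ.measurable hπ.refines hf le_rfl)
  have h2 := lintegral_decay_mul_le_scale (σ := σ) hm (half_pos hα) ht.1.le ht0 ht.2 x
    (fun y => ‖fiberDiff σ π f j y‖ₑ)
  simp only [diffError, if_neg (not_lt.2 hij), mul_zero, sub_zero]
  refine h1.trans ((mul_le_mul_right h2 _).trans ?_)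
  rw [← mul_assoc, ← ENNReal.ofReal_mul (by positivity)]
  refine mul_le_mul' (ENNReal.ofReal_le_ofReal ?_) le_rfl
  have h3 : 2 * (D * (L / 2 ^ j)) / t ≤ 4 * D * (1 / 2) ^ (j - i) := by
    rw [div_le_iff₀ ht0]
    have e : L / 2 ^ j = (L / 2 ^ i) * (1 / 2) ^ (j - i) := by
      rw [div_pow, one_pow, div_mul_div_comm, mul_one, ← pow_add, Nat.add_sub_cancel' hij]
    rw [e]
    have : L / 2 ^ i ≤ 2 * t := by linarith [ht.1]
    calc 2 * (D * (L / 2 ^ i * (1 / 2) ^ (j - i))) ≤ 2 * (D * (2 * t * (1 / 2) ^ (j - i))) := by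
          gcongr
      _ = _ := by ring
  -- The gain `2^{-α}` per generation is weakened to the ratio that occurs for `j < i`, so that one
  -- weight covers both cases.
  have h4 : ((1 / 2 : ℝ) ^ (j - i)) ^ α ≤ ((2 / 3) ^ (α / 2)) ^ (j - i) := by
    rw [← Real.rpow_natCast, ← Real.rpow_natCast, ← Real.rpow_mul (by norm_num), mul_comm,
      Real.rpow_mul (by norm_num)]
    refine Real.rpow_le_rpow (by positivity) ?_ (by positivity)
    calc (1 / 2 : ℝ) ^ α ≤ (2 / 3) ^ α := Real.rpow_le_rpow (by norm_num) (by norm_num) hα.le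
      _ ≤ (2 / 3) ^ (α / 2) :=
        Real.rpow_le_rpow_of_exponent_ge (by norm_num) (by norm_num) (by linarith)
  calc K * (2 * (D * (L / 2 ^ j)) / t) ^ α * 2 ^ (m + α / 2)
      ≤ K * (4 * D * (1 / 2) ^ (j - i)) ^ α * 2 ^ (m + α / 2) := by gcongr
    _ = K * (4 * D) ^ α * 2 ^ (m + α / 2) * ((1 / 2) ^ (j - i)) ^ α := by
        rw [Real.mul_rpow (by positivity) (by positivity)]; ring
    _ ≤ _ := by gcongr

/-- Differences coarser than `t`: goodness makes the difference constant on the `d`-ball about `x`,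
so only the tail of the kernel beyond `d` contributes. -/
theorem enorm_diffError_le_of_lt (hk : IsKernel m α K k) (hm : 0 < m) (hα : 0 < α) (hL : 0 < L)
    (hη : 0 < η) (hA : 0 ≤ A) (hπ : IsGrid σ π L D F) (hf : MemLp f 2 σ)
    {x : EuclideanSpace ℝ (Fin n)}
    (hx : ∀ r, 0 < r → σ (Metric.ball x r) ≤ ENNReal.ofReal (A * r ^ m))
    {i j : ℕ} (hg : IsGood π L η i x) (hij : j < i) {t : ℝ}
    (ht : t ∈ Set.Ioc (L / 2 ^ i / 2) (L / 2 ^ i)) :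
    ‖diffError k σ π f i j t x‖ₑ ≤
      ENNReal.ofReal (K * (3 / (2 * η)) ^ (α / 2) * (2 ^ (m + α / 2) + A * decayConst m (α / 2)) *
        ((2 / 3) ^ (α / 2)) ^ (i - j)) *
        (∫⁻ y, ENNReal.ofReal (decay m (α / 2) (L / 2 ^ i) x y) * ‖fiberDiff σ π f j y‖ₑ ∂σ +
          ‖fiberDiff σ π f j x‖ₑ) := by
  have hK := hk.nonneg_const
  have hC := decayConst_pos (m := m) (half_pos hα)
  have hT : 0 < L / 2 ^ i := by positivity
  have ht0 : 0 < t := by linarith [ht.1]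
  have hDI : Integrable (fiberDiff σ π f j) σ :=
    (memLp_fiberDiff hπ.measurable hf j).integrable (by norm_num)
  -- The difference of index `j` is constant on cubes of generation `j + 1`, so goodness is used
  -- only at generations at least `1`.
  set d := η * (3 / 4) ^ (i - (j + 1)) * (L / 2 ^ (j + 1)) with hd
  have hd0 : 0 < d := by positivity
  have h1 := hk.enorm_theta_sub_le hm hα (β := α / 2) (by linarith) ht0 hd0 x hDI
    (fun y hy => fiberDiff_congr_point hπ.refines (hg (j + 1) (by omega) hij y hy))
  have h2 := lintegral_decay_mul_le_scale (σ := σ) hm (half_pos hα) ht.1.le ht0 ht.2 x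
    (fun y => ‖fiberDiff σ π f j y‖ₑ)
  have h3 := lintegral_decay_le hm (half_pos hα) ht0 hA hx
  simp only [diffError, if_pos hij]
  set I := ∫⁻ y, ENNReal.ofReal (decay m (α / 2) (L / 2 ^ i) x y) * ‖fiberDiff σ π f j y‖ₑ ∂σ
  set a := ‖fiberDiff σ π f j x‖ₑ
  -- The ratio `3/4` in the definition of goodness exceeds `1/2`, so `t / d` still decays, by `(1/2)
  -- / (3/4) = 2/3` per generation. It is less than `1`, so the probabilities of failing to be good
  -- are summable.
  have h4 : t / d ≤ 3 / (2 * η) * (2 / 3) ^ (i - j) := by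
    obtain ⟨s, rfl⟩ : ∃ s, i = j + 1 + s := ⟨i - (j + 1), by omega⟩
    have e1 : j + 1 + s - (j + 1) = s := by omega
    have e2 : j + 1 + s - j = s + 1 := by omega
    rw [div_le_iff₀ hd0, hd, e1, e2]
    refine ht.2.trans (le_of_eq ?_)
    rw [pow_add (2 : ℝ) (j + 1) s, pow_succ (2 / 3 : ℝ) s]
    have : (3 / 4 : ℝ) ^ s = (3 / 2) ^ s / 2 ^ s := by rw [← div_pow]; norm_num
    rw [this, div_pow, div_pow]
    field_simp
  have h5 : (t / d) ^ (α - α / 2) ≤ (3 / (2 * η)) ^ (α / 2) * ((2 / 3) ^ (α / 2)) ^ (i - j) := by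
    have e : α - α / 2 = α / 2 := by ring
    rw [e]
    refine (Real.rpow_le_rpow (by positivity) h4 (by positivity)).trans (le_of_eq ?_)
    rw [Real.mul_rpow (by positivity) (by positivity), ← Real.rpow_natCast,
      ← Real.rpow_natCast, ← Real.rpow_mul (by norm_num), ← Real.rpow_mul (by norm_num),
      mul_comm (α / 2)]
  calc _ ≤ ENNReal.ofReal (K * (t / d) ^ (α - α / 2)) *
        (ENNReal.ofReal (2 ^ (m + α / 2)) * I + a * ENNReal.ofReal (A * decayConst m (α / 2))) := by
        refine h1.trans ?_
        gcongr
    _ ≤ ENNReal.ofReal (K * ((3 / (2 * η)) ^ (α / 2) * ((2 / 3) ^ (α / 2)) ^ (i - j))) *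
        (ENNReal.ofReal (2 ^ (m + α / 2) + A * decayConst m (α / 2)) * (I + a)) := by
        rw [mul_add (ENNReal.ofReal (2 ^ (m + α / 2) + A * decayConst m (α / 2))), mul_comm a]
        gcongr
        · exact le_add_of_nonneg_right (by positivity)
        · exact le_add_of_nonneg_left (by positivity)
    _ = _ := by
        rw [← mul_assoc, ← ENNReal.ofReal_mul (by positivity)]
        congr 2
        ring

theorem enorm_diffError_le (hk : IsKernel m α K k) (hm : 0 < m) (hα : 0 < α) (hL : 0 < L)
    (hD : 0 ≤ D) (hη : 0 < η) (hA : 0 ≤ A) (hπ : IsGrid σ π L D F) (hf : MemLp f 2 σ)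
    {x : EuclideanSpace ℝ (Fin n)}
    (hx : ∀ r, 0 < r → σ (Metric.ball x r) ≤ ENNReal.ofReal (A * r ^ m))
    {i j : ℕ} (hg : IsGood π L η i x) {t : ℝ}
    (ht : t ∈ Set.Ioc (L / 2 ^ i / 2) (L / 2 ^ i)) :
    ‖diffError k σ π f i j t x‖ₑ ≤ ENNReal.ofReal (diffConst m α K D A η) *
      (ENNReal.ofReal (((2 / 3) ^ (α / 2)) ^ ((i - j) + (j - i))) *
        (∫⁻ y, ENNReal.ofReal (decay m (α / 2) (L / 2 ^ i) x y) * ‖fiberDiff σ π f j y‖ₑ ∂σ +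
          ‖fiberDiff σ π f j x‖ₑ)) := by
  have hK := hk.nonneg_const
  have hC := decayConst_pos (m := m) (half_pos hα)
  have hdc : 0 ≤ diffConst m α K D A η := by unfold diffConst; positivity
  rw [← mul_assoc, ← ENNReal.ofReal_mul hdc]
  rcases le_or_gt i j with hij | hij
  · refine (enorm_diffError_le_of_le hk hm hα hL hD hπ hf x hij ht).trans ?_
    rw [Nat.sub_eq_zero_of_le hij, zero_add]
    unfold diffConst
    gcongr
    · exact le_add_of_nonneg_right (by positivity)
    · exact le_self_add
  · refine (enorm_diffError_le_of_lt hk hm hα hL hη hA hπ hf hx hg hij ht).trans ?_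
    rw [Nat.sub_eq_zero_of_le hij.le, add_zero]
    unfold diffConst
    gcongr
    exact le_add_of_nonneg_left (by positivity)

/-- The square function estimate for `avgError` over good points. -/
theorem tsum_lintegral_avgError_le (hk : IsKernel m α K k) (hm : 0 < m) (hα : 0 < α) (hL : 0 < L)
    (hD : 0 ≤ D) (hη : 0 < η) (hA : 0 ≤ A) (hπ : IsGrid σ π L D F) (hf : MemLp f 2 σ)
    (hF : MeasurableSet F)
    (hx : ∀ x ∈ F, ∀ r, 0 < r → σ (Metric.ball x r) ≤ ENNReal.ofReal (A * r ^ m))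
    {Γ : ℕ → Set (EuclideanSpace ℝ (Fin n))} (hΓm : ∀ i, MeasurableSet (Γ i))
    (hΓ : ∀ i, ∀ x ∈ Γ i, IsGood π L η i x) (l : ℝ) :
    ∑' i, ∫⁻ x in F ∩ Γ i, (∫⁻ t in timeSet L l i,
        ‖avgError k σ (π i) f t x‖ₑ ^ 2 / ENNReal.ofReal t) ∂σ ≤
      ENNReal.ofReal (errorConst m α K D A η) * ∫⁻ x, ‖f x‖ₑ ^ 2 ∂σ := by
  have hK := hk.nonneg_const
  have hC := decayConst_pos (m := m) (half_pos hα)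
  have hdc : 0 ≤ diffConst m α K D A η := by unfold diffConst; positivity
  set r : ℝ := (2 / 3) ^ (α / 2) with hr
  have hr0 : 0 ≤ r := by positivity
  have hr1 : r < 1 := Real.rpow_lt_one (by norm_num) (by norm_num) (half_pos hα)
  have hr2 : 0 < 1 - r := by linarith
  set q : ℕ → ℕ → ℝ≥0∞ := fun i j => ENNReal.ofReal (r ^ ((i - j) + (j - i))) with hq
  set P : ℕ → ℕ → EuclideanSpace ℝ (Fin n) → ℝ≥0∞ := fun i j x =>
    ∫⁻ y, ENNReal.ofReal (decay m (α / 2) (L / 2 ^ i) x y) * ‖fiberDiff σ π f j y‖ₑ ∂σ with hP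
  set d : ℕ → EuclideanSpace ℝ (Fin n) → ℝ≥0∞ := fun j x => ‖fiberDiff σ π f j x‖ₑ with hd
  have hdm : ∀ j, Measurable (d j) := fun j =>
    ((measurable_fiberAvg (hπ.measurable _)).sub (measurable_fiberAvg (hπ.measurable _))).enorm
  have hPm : ∀ i j, Measurable (P i j) := fun i j => by
    refine Measurable.lintegral_prod_right' (f := fun p : EuclideanSpace ℝ (Fin n) ×
      EuclideanSpace ℝ (Fin n) => ENNReal.ofReal (decay m (α / 2) (L / 2 ^ i) p.1 p.2) * d j p.2) ?_
    exact measurable_decay.ennreal_ofReal.mul ((hdm j).comp measurable_snd)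
  set S : ℝ≥0∞ := ENNReal.ofReal (2 / (1 - r)) with hS
  set c : ℝ≥0∞ := ENNReal.ofReal (diffConst m α K D A η) with hc
  set B : ℝ≥0∞ := ENNReal.ofReal (2 * (2 ^ m * (A * decayConst m (α / 2)) ^ 2) + 2) with hB
  have hpt : ∀ i, ∀ x ∈ F ∩ Γ i, ∫⁻ t in timeSet L l i,
      ‖avgError k σ (π i) f t x‖ₑ ^ 2 / ENNReal.ofReal t ≤
        c ^ 2 * (S * ∑' j, q i j * (P i j x + d j x) ^ 2) := by
    rintro i x ⟨hxF, hxΓ⟩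
    refine lintegral_timeSet_le hL i fun t ht => ?_
    have ht0 : 0 < t := ht.2.1
    -- Cauchy–Schwarz with the weights `q i j`, whose sum over `j` is bounded uniformly in `i`.
    calc ‖avgError k σ (π i) f t x‖ₑ ^ 2 ≤ (c * ∑' j, q i j * (P i j x + d j x)) ^ 2 := by
          refine pow_le_pow_left' ((enorm_avgError_le_tsum hk hm hα hL hD hπ hf hxF ht0 i).trans ?_) 2
          rw [← ENNReal.tsum_mul_left]
          exact ENNReal.tsum_le_tsum fun j =>
            enorm_diffError_le hk hm hα hL hD hη hA hπ hf (hx x hxF) (hΓ i x hxΓ) ht.1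
      _ ≤ _ := by
          rw [mul_pow]
          gcongr
          refine (sq_tsum_mul_le _ _).trans ?_
          gcongr
          exact tsum_pow_dist_le hr0 hr1 i
  have hint : ∀ i j, ∫⁻ x in F, (P i j x + d j x) ^ 2 ∂σ ≤ B * ∫⁻ x, d j x ^ 2 ∂σ := by
    intro i j
    have hT : 0 < L / 2 ^ i := by positivity
    calc ∫⁻ x in F, (P i j x + d j x) ^ 2 ∂σ
        ≤ ∫⁻ x in F, (2 * P i j x ^ 2 + 2 * d j x ^ 2) ∂σ :=
          lintegral_mono fun x => add_sq_le_two_mul _ _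
      _ = 2 * ∫⁻ x in F, P i j x ^ 2 ∂σ + 2 * ∫⁻ x in F, d j x ^ 2 ∂σ := by
          rw [lintegral_add_right _ (((hdm j).pow_const 2).const_mul 2),
            lintegral_const_mul' _ _ (by simp), lintegral_const_mul' _ _ (by simp)]
      _ ≤ 2 * (ENNReal.ofReal (2 ^ m * (A * decayConst m (α / 2)) ^ 2) * ∫⁻ x, d j x ^ 2 ∂σ) +
            2 * ∫⁻ x, d j x ^ 2 ∂σ := by
          gcongr
          · exact lintegral_sq_lintegral_decay_le hm (half_pos hα) hT hA hF hx (hdm j)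
          · exact Measure.restrict_le_self
      _ = B * ∫⁻ x, d j x ^ 2 ∂σ := by
          rw [hB, ENNReal.ofReal_add (by positivity) (by norm_num),
            ENNReal.ofReal_mul (p := 2) (by norm_num)]
          simp only [ENNReal.ofReal_ofNat]
          ring
  have hterm : ∀ i, ∫⁻ x in F ∩ Γ i, (∫⁻ t in timeSet L l i,
      ‖avgError k σ (π i) f t x‖ₑ ^ 2 / ENNReal.ofReal t) ∂σ ≤
        c ^ 2 * S * ∑' j, q i j * (B * ∫⁻ x, d j x ^ 2 ∂σ) := by
    intro i
    calc _ ≤ ∫⁻ x in F ∩ Γ i, c ^ 2 * (S * ∑' j, q i j * (P i j x + d j x) ^ 2) ∂σ :=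
          setLIntegral_mono' (hF.inter (hΓm i)) (hpt i)
      _ ≤ ∫⁻ x in F, c ^ 2 * (S * ∑' j, q i j * (P i j x + d j x) ^ 2) ∂σ :=
          lintegral_mono_set Set.inter_subset_left
      _ = c ^ 2 * S * ∑' j, q i j * ∫⁻ x in F, (P i j x + d j x) ^ 2 ∂σ := by
          have hm' : ∀ j, Measurable fun x => (P i j x + d j x) ^ 2 := fun j =>
            ((hPm i j).add (hdm j)).pow_const 2
          rw [lintegral_const_mul' _ _ (by finiteness), lintegral_const_mul' _ _ (by finiteness),
            lintegral_tsum fun j => ((hm' j).const_mul _).aemeasurable, mul_assoc]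
          congr 3
          ext j
          rw [lintegral_const_mul' _ _ ENNReal.ofReal_ne_top]
      _ ≤ _ := by
          gcongr with j
          exact hint i j
  -- Exchange the sums: the weights are also summable in `i`, uniformly in `j`. What remains is
  -- controlled by Bessel's inequality.
  calc _ ≤ ∑' i, c ^ 2 * S * ∑' j, q i j * (B * ∫⁻ x, d j x ^ 2 ∂σ) :=
        ENNReal.tsum_le_tsum hterm
    _ = c ^ 2 * S * ∑' j, (∑' i, q i j) * (B * ∫⁻ x, d j x ^ 2 ∂σ) := by
        rw [ENNReal.tsum_mul_left, ENNReal.tsum_comm]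
        simp only [ENNReal.tsum_mul_right]
    _ ≤ c ^ 2 * S * ∑' j, S * (B * ∫⁻ x, d j x ^ 2 ∂σ) := by
        gcongr with j
        have := tsum_pow_dist_le hr0 hr1 j
        simpa only [hq, add_comm] using this
    _ = c ^ 2 * S * (S * (B * ∑' j, ∫⁻ x, d j x ^ 2 ∂σ)) := by
        rw [ENNReal.tsum_mul_left, ENNReal.tsum_mul_left]
    _ ≤ c ^ 2 * S * (S * (B * ∫⁻ x, ‖f x‖ₑ ^ 2 ∂σ)) := by
        gcongr
        exact tsum_lintegral_fiberDiff_le hπ.measurable hπ.refines hf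
    _ = _ := by
        rw [errorConst, ENNReal.ofReal_mul (by positivity), ENNReal.ofReal_mul (by positivity),
          ENNReal.ofReal_pow hdc, ENNReal.ofReal_pow (by positivity)]
        ring

end ErrorBound

/-! ### Passing between `θ_t f` and `θ_t 1`, one generation at a time. -/

section Pieces

variable {n : ℕ} {ι : Type*} {m α K L D A η : ℝ}
  {k : ℝ → EuclideanSpace ℝ (Fin n) → EuclideanSpace ℝ (Fin n) → ℂ}
  {σ : Measure (EuclideanSpace ℝ (Fin n))}
  {f : EuclideanSpace ℝ (Fin n) → ℂ}

/-- The part of the square function with times attached to generation `i`, squared. -/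
noncomputable def timePiece
    (k : ℝ → EuclideanSpace ℝ (Fin n) → EuclideanSpace ℝ (Fin n) → ℂ)
    (σ : Measure (EuclideanSpace ℝ (Fin n))) (L l : ℝ) (f : EuclideanSpace ℝ (Fin n) → ℂ)
    (i : ℕ) (x : EuclideanSpace ℝ (Fin n)) : ℝ≥0∞ :=
  ∫⁻ t in timeSet L l i, ‖theta k σ f t x‖ₑ ^ 2 / ENNReal.ofReal t

theorem squareFn_sq_eq_tsum {l : ℝ} (hL : 0 < L) (hl : l ≤ L) (x : EuclideanSpace ℝ (Fin n)) :
    squareFn k σ l f x ^ 2 = ∑' i, timePiece k σ L l f i x := by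
  unfold squareFn timePiece
  rw [← lintegral_Ioo_eq_tsum_timeSet hL hl, ← ENNReal.rpow_two, ← ENNReal.rpow_mul]
  norm_num

/-- Joint measurability is given only over `t > 0`; extension by zero gives a function on a full
product space, as the Fubini-type lemmas require. -/
theorem IsKernel.exists_measurable_extension (hk : IsKernel m α K k) :
    ∃ k' : ℝ × EuclideanSpace ℝ (Fin n) × EuclideanSpace ℝ (Fin n) → ℂ, Measurable k' ∧
      ∀ t, 0 < t → ∀ x y, k' (t, x, y) = k t x y := by
  classical
  set S : Set (ℝ × EuclideanSpace ℝ (Fin n) × EuclideanSpace ℝ (Fin n)) := {p | 0 < p.1} with hS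
  have hs : MeasurableSet S := measurableSet_lt measurable_const measurable_fst
  refine ⟨fun p => if h : 0 < p.1 then k p.1 p.2.1 p.2.2 else 0, ?_, fun t ht x y => by simp [ht]⟩
  refine Measurable.dite (s := S) (f := fun p : S => k p.1.1 p.1.2.1 p.1.2.2)
    (g := fun _ => 0) ?_ measurable_const hs
  exact hk.measurable.comp
    (f := fun p : S => ((⟨p.1.1, p.2⟩ : Set.Ioi (0 : ℝ)), p.1.2.1, p.1.2.2)) (by fun_prop)

theorem IsKernel.exists_measurable_theta [SFinite σ] (hk : IsKernel m α K k)
    (hf : AEStronglyMeasurable f σ) :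
    ∃ Θ : ℝ × EuclideanSpace ℝ (Fin n) → ℂ, Measurable Θ ∧
      ∀ t, 0 < t → ∀ x, Θ (t, x) = theta k σ f t x := by
  obtain ⟨k', hk'm, hk'⟩ := hk.exists_measurable_extension
  refine ⟨fun p => ∫ y, k' (p.1, p.2, y) * hf.mk f y ∂σ, ?_, fun t ht x => ?_⟩
  · refine (StronglyMeasurable.integral_prod_right' (f := fun q : (ℝ × EuclideanSpace ℝ (Fin n)) ×
      EuclideanSpace ℝ (Fin n) => k' (q.1.1, q.1.2, q.2) * hf.mk f q.2) ?_).measurable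
    exact ((hk'm.comp (by fun_prop)).mul
      (hf.stronglyMeasurable_mk.measurable.comp measurable_snd)).stronglyMeasurable
  · rw [theta_congr_ae hf.ae_eq_mk, theta]
    simp only [hk' t ht]

theorem IsKernel.measurable_timePiece [SFinite σ] (hk : IsKernel m α K k)
    (hf : AEStronglyMeasurable f σ) (l : ℝ) (i : ℕ) : Measurable (timePiece k σ L l f i) := by
  obtain ⟨Θ, hΘm, hΘ⟩ := hk.exists_measurable_theta hf
  have e : timePiece k σ L l f i = fun x => ∫⁻ t in timeSet L l i,
      ‖Θ (t, x)‖ₑ ^ 2 / ENNReal.ofReal t := by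
    ext x
    refine setLIntegral_congr_fun (measurableSet_timeSet L l i) fun t ht => ?_
    simp only [hΘ t ht.2.1]
  rw [e]
  refine Measurable.lintegral_prod_right' (f := fun p : EuclideanSpace ℝ (Fin n) × ℝ =>
    ‖Θ (p.2, p.1)‖ₑ ^ 2 / ENNReal.ofReal p.2) ?_
  have : Measurable fun p : EuclideanSpace ℝ (Fin n) × ℝ => Θ (p.2, p.1) :=
    hΘm.comp measurable_swap
  fun_prop

theorem IsKernel.aemeasurable_theta_sq [SFinite σ] (hk : IsKernel m α K k)
    (hf : AEStronglyMeasurable f σ) (l : ℝ) (i : ℕ) (x : EuclideanSpace ℝ (Fin n)) :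
    AEMeasurable (fun t => ‖theta k σ f t x‖ₑ ^ 2 / ENNReal.ofReal t)
      (volume.restrict (timeSet L l i)) := by
  obtain ⟨Θ, hΘm, hΘ⟩ := hk.exists_measurable_theta hf
  refine ⟨fun t => ‖Θ (t, x)‖ₑ ^ 2 / ENNReal.ofReal t, ?_, ?_⟩
  · have : Measurable fun t : ℝ => Θ (t, x) := hΘm.comp (by fun_prop)
    fun_prop
  · refine (ae_restrict_iff' (measurableSet_timeSet L l i)).2 (Filter.Eventually.of_forall ?_)
    intro t ht
    simp only [hΘ t ht.2.1]

/-- The square of the square function of `avgError` at generation `i`. -/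
noncomputable def errorPiece
    (k : ℝ → EuclideanSpace ℝ (Fin n) → EuclideanSpace ℝ (Fin n) → ℂ)
    (σ : Measure (EuclideanSpace ℝ (Fin n))) (π : ℕ → EuclideanSpace ℝ (Fin n) → ι) (L l : ℝ)
    (f : EuclideanSpace ℝ (Fin n) → ℂ) (i : ℕ) (x : EuclideanSpace ℝ (Fin n)) : ℝ≥0∞ :=
  ∫⁻ t in timeSet L l i, ‖avgError k σ (π i) f t x‖ₑ ^ 2 / ENNReal.ofReal t

variable {π : ℕ → EuclideanSpace ℝ (Fin n) → ι}

/-- Only the `θ_t g` term has to be measurable for the integral of the sum to split, so `u` and `v`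
need no measurability. -/
theorem lintegral_timeSet_le_add [SFinite σ] (hk : IsKernel m α K k)
    {g : EuclideanSpace ℝ (Fin n) → ℂ} (hg : AEStronglyMeasurable g σ) (l : ℝ) (i : ℕ)
    (x : EuclideanSpace ℝ (Fin n)) {a : ℝ≥0∞} (ha : a ≠ ∞) {u v : ℝ → ℂ}
    (h : ∀ t, ‖u t‖ₑ ^ 2 ≤ a * ‖theta k σ g t x‖ₑ ^ 2 + 2 * ‖v t‖ₑ ^ 2) :
    ∫⁻ t in timeSet L l i, ‖u t‖ₑ ^ 2 / ENNReal.ofReal t ≤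
      a * timePiece k σ L l g i x + 2 * ∫⁻ t in timeSet L l i, ‖v t‖ₑ ^ 2 / ENNReal.ofReal t := by
  unfold timePiece
  rw [← lintegral_const_mul' _ _ ha, ← lintegral_const_mul' _ _ ENNReal.ofNat_ne_top,
    ← lintegral_add_left' ((hk.aemeasurable_theta_sq hg l i x).const_mul _)]
  refine lintegral_mono fun t => ?_
  rw [← mul_div_assoc, ← mul_div_assoc, ← ENNReal.add_div]
  exact ENNReal.div_le_div_right (h t) _

theorem timePiece_le [IsFiniteMeasure σ] (hk : IsKernel m α K k) (l : ℝ) (i : ℕ)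
    (x : EuclideanSpace ℝ (Fin n)) :
    timePiece k σ L l f i x ≤ 2 * ‖fiberAvg σ (π i) f x‖ₑ ^ 2 *
      timePiece k σ L l (fun _ => 1) i x + 2 * errorPiece k σ π L l f i x := by
  refine lintegral_timeSet_le_add hk (g := fun _ => 1) aestronglyMeasurable_const l i x
    (by finiteness) fun t => ?_
  have e : theta k σ f t x = theta k σ (fun _ => 1) t x * fiberAvg σ (π i) f x +
    avgError k σ (π i) f t x := by simp [avgError]
  rw [e]
  refine (enorm_add_sq_le _ _).trans_eq ?_
  rw [enorm_mul]
  ring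

/-- The converse of `timePiece_le`: where the average of `f` is bounded below, `θ_t 1` can be solved
for. This is how accretivity of `b` enters. -/
theorem timePiece_one_le [IsFiniteMeasure σ] (hk : IsKernel m α K k)
    (hf : AEStronglyMeasurable f σ) (l : ℝ) (i : ℕ) (x : EuclideanSpace ℝ (Fin n)) {c : ℝ}
    (hc : 0 < c) (hx : c ≤ ‖fiberAvg σ (π i) f x‖) :
    timePiece k σ L l (fun _ => 1) i x ≤ ENNReal.ofReal (c⁻¹ ^ 2) *
      (2 * timePiece k σ L l f i x + 2 * errorPiece k σ π L l f i x) := by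
  have hcc : ENNReal.ofReal (c⁻¹ ^ 2) * ENNReal.ofReal (c ^ 2) = 1 := by
    rw [← ENNReal.ofReal_mul (by positivity), ← mul_pow, inv_mul_cancel₀ hc.ne']
    simp
  have key := lintegral_timeSet_le_add (L := L) hk hf l i x (a := 2) (by simp)
    (u := fun t => theta k σ (fun _ => 1) t x * fiberAvg σ (π i) f x)
    (v := fun t => avgError k σ (π i) f t x) (fun t => by
      have e : theta k σ (fun _ => 1) t x * fiberAvg σ (π i) f x =
        theta k σ f t x + -avgError k σ (π i) f t x := by simp [avgError]
      rw [e]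
      simpa using enorm_add_sq_le (theta k σ f t x) (-avgError k σ (π i) f t x))
  refine le_trans ?_ (mul_le_mul_right key _)
  calc timePiece k σ L l (fun _ => 1) i x
      = ENNReal.ofReal (c⁻¹ ^ 2) * (ENNReal.ofReal (c ^ 2) *
          timePiece k σ L l (fun _ => 1) i x) := by rw [← mul_assoc, hcc, one_mul]
    _ ≤ _ := by
        gcongr
        rw [timePiece, ← lintegral_const_mul' _ _ ENNReal.ofReal_ne_top]
        refine lintegral_mono fun t => ?_
        rw [← mul_div_assoc, enorm_mul, mul_pow, mul_comm (‖theta k σ (fun _ => 1) t x‖ₑ ^ 2)]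
        gcongr
        rw [← ofReal_norm, ← ENNReal.ofReal_pow (norm_nonneg _)]
        exact ENNReal.ofReal_le_ofReal (by gcongr)

variable [IsFiniteMeasure σ] [MeasurableSpace ι] [MeasurableSingletonClass ι] [Countable ι]
  {F : Set (EuclideanSpace ℝ (Fin n))}

/-- The square function estimate at the good points of a set on which `θ_t 1` has a bounded
square function. -/
theorem tsum_lintegral_timePiece_le (hk : IsKernel m α K k) (hm : 0 < m) (hα : 0 < α) (hL : 0 < L)
    (hD : 0 ≤ D) (hη : 0 < η) (hA : 0 ≤ A) (hπ : IsGrid σ π L D F) (hf : MemLp f 2 σ)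
    (hF : MeasurableSet F)
    (hx : ∀ x ∈ F, ∀ r, 0 < r → σ (Metric.ball x r) ≤ ENNReal.ofReal (A * r ^ m))
    {Γ : ℕ → Set (EuclideanSpace ℝ (Fin n))} (hΓm : ∀ i, MeasurableSet (Γ i))
    (hΓ : ∀ i, ∀ x ∈ Γ i, IsGood π L η i x) (l : ℝ)
    {F' : Set (EuclideanSpace ℝ (Fin n))} (hF' : MeasurableSet F') (hFF : F' ⊆ F) {B : ℝ≥0∞}
    (hB : ∀ x ∈ F', ∑' i, (Γ i).indicator (timePiece k σ L l (fun _ => 1) i) x ≤ B) :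
    ∑' i, ∫⁻ x in F' ∩ Γ i, timePiece k σ L l f i x ∂σ ≤
      (8 * B + 2 * ENNReal.ofReal (errorConst m α K D A η)) * ∫⁻ x, ‖f x‖ₑ ^ 2 ∂σ := by
  have hmA : ∀ i, Measurable fun x => 2 * ‖fiberAvg σ (π i) f x‖ₑ ^ 2 *
      timePiece k σ L l (fun _ => 1) i x := fun i =>
    (((measurable_fiberAvg (hπ.measurable i)).enorm.pow_const 2).const_mul 2).mul
      (hk.measurable_timePiece aestronglyMeasurable_const l i)
  have hterm : ∀ i, ∫⁻ x in F' ∩ Γ i, timePiece k σ L l f i x ∂σ ≤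
      ∫⁻ x in F', (Γ i).indicator (fun x => 2 * ‖fiberAvg σ (π i) f x‖ₑ ^ 2 *
        timePiece k σ L l (fun _ => 1) i x) x ∂σ +
      2 * ∫⁻ x in F ∩ Γ i, errorPiece k σ π L l f i x ∂σ := by
    intro i
    calc _ ≤ ∫⁻ x in F' ∩ Γ i, (2 * ‖fiberAvg σ (π i) f x‖ₑ ^ 2 *
          timePiece k σ L l (fun _ => 1) i x + 2 * errorPiece k σ π L l f i x) ∂σ :=
          lintegral_mono fun x => timePiece_le hk l i x
      _ = ∫⁻ x in F' ∩ Γ i, 2 * ‖fiberAvg σ (π i) f x‖ₑ ^ 2 *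
          timePiece k σ L l (fun _ => 1) i x ∂σ +
          2 * ∫⁻ x in F' ∩ Γ i, errorPiece k σ π L l f i x ∂σ := by
          rw [lintegral_add_left (hmA i), lintegral_const_mul' _ _ ENNReal.ofNat_ne_top]
      _ ≤ _ := by
          rw [lintegral_indicator (hΓm i), Measure.restrict_restrict (hΓm i), Set.inter_comm (Γ i) F']
          gcongr
  have herr := tsum_lintegral_avgError_le hk hm hα hL hD hη hA hπ hf hF hx hΓm hΓ l
  calc _ ≤ ∑' i, (∫⁻ x in F', (Γ i).indicator (fun x => 2 * ‖fiberAvg σ (π i) f x‖ₑ ^ 2 *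
        timePiece k σ L l (fun _ => 1) i x) x ∂σ +
      2 * ∫⁻ x in F ∩ Γ i, errorPiece k σ π L l f i x ∂σ) := ENNReal.tsum_le_tsum hterm
    _ = ∫⁻ x in F', ∑' i, (Γ i).indicator (fun x => 2 * ‖fiberAvg σ (π i) f x‖ₑ ^ 2 *
        timePiece k σ L l (fun _ => 1) i x) x ∂σ +
        2 * ∑' i, ∫⁻ x in F ∩ Γ i, errorPiece k σ π L l f i x ∂σ := by
        rw [ENNReal.tsum_add, ENNReal.tsum_mul_left,
          lintegral_tsum fun i => ((hmA i).indicator (hΓm i)).aemeasurable]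
    _ ≤ 2 * B * (4 * ∫⁻ x, ‖f x‖ₑ ^ 2 ∂σ) +
        2 * (ENNReal.ofReal (errorConst m α K D A η) * ∫⁻ x, ‖f x‖ₑ ^ 2 ∂σ) := by
        refine add_le_add ?_ (mul_le_mul_right herr _)
        -- The averages are pulled out as their supremum over `i`; the remaining sum of pieces of
        -- `θ_t 1` is at most `B` pointwise. The factor `8` is `2` from squaring a sum times Doob's
        -- `4`.
        have hmax := lintegral_iSup_fiberAvg_sq_le hπ.measurable hπ.refines hf
        have hmeas : Measurable fun x => ⨆ i, ‖fiberAvg σ (π i) f x‖ₑ ^ 2 :=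
          Measurable.iSup fun i => (measurable_fiberAvg (hπ.measurable i)).enorm.pow_const 2
        calc _ ≤ ∫⁻ x in F', 2 * B * ⨆ i, ‖fiberAvg σ (π i) f x‖ₑ ^ 2 ∂σ := by
              refine setLIntegral_mono' hF' fun x hxF => ?_
              calc _ ≤ ∑' i, (2 * ⨆ i, ‖fiberAvg σ (π i) f x‖ₑ ^ 2) *
                    (Γ i).indicator (timePiece k σ L l (fun _ => 1) i) x := by
                    refine ENNReal.tsum_le_tsum fun i => ?_
                    by_cases hxi : x ∈ Γ i
                    · rw [Set.indicator_of_mem hxi, Set.indicator_of_mem hxi]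
                      gcongr
                      exact le_iSup (fun i => ‖fiberAvg σ (π i) f x‖ₑ ^ 2) i
                    · simp [Set.indicator_of_notMem hxi]
                _ ≤ (2 * ⨆ i, ‖fiberAvg σ (π i) f x‖ₑ ^ 2) * B := by
                    rw [ENNReal.tsum_mul_left]
                    gcongr
                    exact hB x hxF
                _ = _ := by ring
          _ ≤ ∫⁻ x, 2 * B * ⨆ i, ‖fiberAvg σ (π i) f x‖ₑ ^ 2 ∂σ := setLIntegral_le_lintegral _ _
          _ = 2 * B * ∫⁻ x, ⨆ i, ‖fiberAvg σ (π i) f x‖ₑ ^ 2 ∂σ := lintegral_const_mul _ hmeas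
          _ ≤ _ := by gcongr
    _ = _ := by ring

end Pieces

/-! ### Dyadic grids of cubes as fibres of floor maps. -/

section Grid

variable {n : ℕ} {a : Fin n → ℝ} {L : ℝ}

/-- The index of the cube of generation `j` containing `x` in the dyadic grid of `∏ [a_i, a_i+L)`,
extended periodically to the whole space. -/
noncomputable def gridIndex (a : Fin n → ℝ) (L : ℝ) (j : ℕ) (x : EuclideanSpace ℝ (Fin n)) :
    Fin n → ℤ := fun c => ⌊(x c - a c) / (L / 2 ^ j)⌋

theorem measurable_gridIndex (a : Fin n → ℝ) (L : ℝ) (j : ℕ) : Measurable (gridIndex a L j) := by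
  refine measurable_pi_iff.2 fun c => ?_
  unfold gridIndex
  refine Int.measurable_floor.comp ?_
  fun_prop

theorem gridIndex_preimage (hL : 0 < L) (j : ℕ) (v : Fin n → ℤ) :
    gridIndex a L j ⁻¹' {v} = hoCube (fun c => a c + v c * (L / 2 ^ j)) (L / 2 ^ j) := by
  have hs : 0 < L / 2 ^ j := by positivity
  ext x
  simp only [Set.mem_preimage, Set.mem_singleton_iff, funext_iff, gridIndex, Int.floor_eq_iff,
    hoCube, Set.mem_ofPred_eq]
  refine forall_congr' fun c => ?_
  rw [le_div_iff₀ hs, div_lt_iff₀ hs]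
  constructor <;> rintro ⟨h1, h2⟩ <;> constructor <;> nlinarith

theorem gridIndex_zero_eq (hL : 0 < L) {x : EuclideanSpace ℝ (Fin n)} (hx : x ∈ hoCube a L) :
    gridIndex a L 0 x = 0 := by
  have : x ∈ gridIndex a L 0 ⁻¹' {0} := by
    rw [gridIndex_preimage hL]
    simpa [hoCube] using hx
  exact this

/-- In each coordinate the coarser index is half the finer one, rounded down. -/
theorem gridIndex_refine (hL : 0 < L) (j : ℕ) (x y : EuclideanSpace ℝ (Fin n))
    (h : gridIndex a L (j + 1) x = gridIndex a L (j + 1) y) : gridIndex a L j x = gridIndex a L j y := by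
  have key : ∀ z : EuclideanSpace ℝ (Fin n), ∀ c,
      gridIndex a L j z c = gridIndex a L (j + 1) z c / 2 := by
    intro z c
    have e : (z c - a c) / (L / 2 ^ j) = (z c - a c) / (L / 2 ^ (j + 1)) / 2 := by
      rw [pow_succ]
      field_simp
    simp only [gridIndex]
    rw [e]
    simpa using Int.floor_div_natCast ((z c - a c) / (L / 2 ^ (j + 1))) 2
  ext c
  rw [key, key, h]

theorem dist_le_of_gridIndex_eq (hL : 0 < L) (j : ℕ) (x y : EuclideanSpace ℝ (Fin n))
    (h : gridIndex a L j x = gridIndex a L j y) : dist x y ≤ n * (L / 2 ^ j) := by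
  have hs : 0 < L / 2 ^ j := by positivity
  have hc : ∀ c, (x c - y c) ^ 2 ≤ (L / 2 ^ j) ^ 2 := fun c => by
    have h1 := congrFun h c
    simp only [gridIndex] at h1
    have h2 := Int.abs_sub_lt_one_of_floor_eq_floor h1
    rw [← sub_div, abs_div, abs_of_pos hs, div_lt_one hs] at h2
    have h3 : x c - a c - (y c - a c) = x c - y c := by ring
    rw [h3] at h2
    rw [← sq_abs]
    gcongr
  rw [EuclideanSpace.dist_eq]
  refine Real.sqrt_le_iff.2 ⟨by positivity, ?_⟩
  calc ∑ c, dist (x c) (y c) ^ 2 ≤ ∑ _c : Fin n, (L / 2 ^ j) ^ 2 := by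
        refine Finset.sum_le_sum fun c _ => ?_
        rw [Real.dist_eq, sq_abs]
        exact hc c
    _ = n * (L / 2 ^ j) ^ 2 := by simp
    _ ≤ (n : ℝ) ^ 2 * (L / 2 ^ j) ^ 2 := by
        gcongr
        exact_mod_cast Nat.le_self_pow two_ne_zero n
    _ = _ := by ring

theorem isGrid_gridIndex (hL : 0 < L) {σ : Measure (EuclideanSpace ℝ (Fin n))}
    {F : Set (EuclideanSpace ℝ (Fin n))} (hF : F ⊆ hoCube a L) (hσ : ∀ᵐ y ∂σ, y ∈ hoCube a L) :
    IsGrid σ (gridIndex a L) L n F where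
  measurable := measurable_gridIndex a L
  refines := gridIndex_refine hL
  diam := dist_le_of_gridIndex_eq hL
  top x hx := hσ.mono fun y hy => by rw [gridIndex_zero_eq hL hy, gridIndex_zero_eq hL (hF hx)]

/-- The points of generation `i` that are far, relative to the size, from the boundaries of the
cubes of the generations `1, …, i`. -/
def goodSet (a : Fin n → ℝ) (L η : ℝ) (i : ℕ) : Set (EuclideanSpace ℝ (Fin n)) :=
  {x | ∀ j ∈ Finset.Icc 1 i, ∀ c, η * (3 / 4) ^ (i - j) ≤ Int.fract ((x c - a c) / (L / 2 ^ j)) ∧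
    Int.fract ((x c - a c) / (L / 2 ^ j)) ≤ 1 - η * (3 / 4) ^ (i - j)}

theorem isGood_of_mem_goodSet (hL : 0 < L) {η : ℝ} {i : ℕ} {x : EuclideanSpace ℝ (Fin n)}
    (hx : x ∈ goodSet a L η i) : IsGood (gridIndex a L) L η i x := by
  intro j h1 hj y hy
  have hs : 0 < L / 2 ^ j := by positivity
  ext c
  obtain ⟨hl, hu⟩ := hx j (Finset.mem_Icc.2 ⟨h1, hj⟩) c
  have hc : |x c - y c| < η * (3 / 4) ^ (i - j) * (L / 2 ^ j) := by
    refine lt_of_le_of_lt ?_ hy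
    rw [← Real.dist_eq]
    exact PiLp.dist_apply_le x y c
  have hd : |(x c - a c) / (L / 2 ^ j) - (y c - a c) / (L / 2 ^ j)| < η * (3 / 4) ^ (i - j) := by
    rw [← sub_div, abs_div, abs_of_pos hs, div_lt_iff₀ hs]
    have h3 : x c - a c - (y c - a c) = x c - y c := by ring
    rwa [h3]
  simp only [gridIndex]
  rw [Int.floor_eq_iff]
  rw [abs_lt] at hd
  have := Int.floor_add_fract ((x c - a c) / (L / 2 ^ j))
  constructor <;> linarith [hd.1, hd.2]

theorem gridIndex_fiber_mem_dyadicGrid (hL : 0 < L) {x : EuclideanSpace ℝ (Fin n)}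
    (hx : x ∈ hoCube a L) (j : ℕ) : gridIndex a L j ⁻¹' {gridIndex a L j x} ∈ dyadicGrid a L := by
  have hs : 0 < L / 2 ^ j := by positivity
  have h0 : ∀ c, 0 ≤ gridIndex a L j x c := fun c =>
    Int.floor_nonneg.2 (div_nonneg (by linarith [(hx c).1]) hs.le)
  have h1 : ∀ c, gridIndex a L j x c < 2 ^ j := fun c => by
    refine Int.floor_lt.2 ?_
    rw [div_lt_iff₀ hs]
    push_cast
    rw [mul_div_cancel₀ _ (by positivity)]
    linarith [(hx c).2]
  refine ⟨j, fun c => (gridIndex a L j x c).toNat, fun c => ?_, ?_⟩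
  · have := h1 c
    zify
    rwa [Int.toNat_of_nonneg (h0 c)]
  · rw [gridIndex_preimage hL]
    congr 1
    ext c
    congr 2
    exact_mod_cast (Int.toNat_of_nonneg (h0 c)).symm

theorem exists_eq_fiber_of_mem_dyadicGrid (hL : 0 < L) {R : Set (EuclideanSpace ℝ (Fin n))}
    (hR : R ∈ dyadicGrid a L) {x : EuclideanSpace ℝ (Fin n)} (hx : x ∈ R) :
    ∃ j, R = gridIndex a L j ⁻¹' {gridIndex a L j x} := by
  obtain ⟨j, v, -, rfl⟩ := hR
  have e := gridIndex_preimage (a := a) hL j (fun c => (v c : ℤ))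
  simp only [Int.cast_natCast] at e
  rw [← e] at hx ⊢
  have hx' : gridIndex a L j x = fun c => (v c : ℤ) := hx
  exact ⟨j, by rw [hx']⟩

/-- A point whose cube of some generation satisfies `P` is in a maximal such cube. -/
theorem mem_sUnion_maximal_of_fiber (hL : 0 < L) {P : Set (EuclideanSpace ℝ (Fin n)) → Prop}
    {x : EuclideanSpace ℝ (Fin n)} (hx : x ∈ hoCube a L) {i : ℕ}
    (hi : P (gridIndex a L i ⁻¹' {gridIndex a L i x})) :
    x ∈ ⋃₀ {R | Maximal (fun R' => R' ∈ dyadicGrid a L ∧ P R') R} := by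
  classical
  have hex : ∃ i, P (gridIndex a L i ⁻¹' {gridIndex a L i x}) := ⟨i, hi⟩
  -- The cube at the least generation is maximal: any grid cube containing it and satisfying `P`
  -- also contains `x`, so it is a fibre through `x` of no smaller generation.
  refine ⟨gridIndex a L (Nat.find hex) ⁻¹' {gridIndex a L (Nat.find hex) x},
    ⟨⟨gridIndex_fiber_mem_dyadicGrid hL hx _, Nat.find_spec hex⟩, ?_⟩, rfl⟩
  rintro R ⟨hR, hPR⟩ hle
  obtain ⟨j, rfl⟩ := exists_eq_fiber_of_mem_dyadicGrid hL hR (hle rfl)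
  have hj : Nat.find hex ≤ j := Nat.find_le hPR
  intro y hy
  exact eq_of_refine (gridIndex_refine hL) hj hy

end Grid

/-! ### The probability that a point is not good. -/

section Probability

/-- An exceptional shift puts `(y - u) / s` within `ε` of an integer. At most `Λ / s + 3` integers
occur, each excluding an interval of length `2 ε s`; the total is at most `8 ε Λ` because `s ≤ Λ`.
-/
theorem volume_near_lattice_le {Λ s y ε : ℝ} (hs : 0 < s) (hsΛ : s ≤ Λ) (hε : 0 ≤ ε)
    (hε1 : ε ≤ 1) :
    volume {u ∈ Set.Ico (-(Λ / 2)) (Λ / 2) |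
      ¬ (ε ≤ Int.fract ((y - u) / s) ∧ Int.fract ((y - u) / s) ≤ 1 - ε)} ≤
      ENNReal.ofReal (8 * ε * Λ) := by
  set k₀ : ℤ := ⌈(y - Λ / 2) / s - 1⌉ with hk₀
  set k₁ : ℤ := ⌊(y + Λ / 2) / s + 1⌋ with hk₁
  have hsub : {u ∈ Set.Ico (-(Λ / 2)) (Λ / 2) |
      ¬ (ε ≤ Int.fract ((y - u) / s) ∧ Int.fract ((y - u) / s) ≤ 1 - ε)} ⊆
      ⋃ p ∈ Finset.Icc k₀ k₁, Set.Icc (y - p * s - ε * s) (y - p * s + ε * s) := by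
    rintro u ⟨⟨hu1, hu2⟩, hu⟩
    obtain ⟨p, hp1, hp2⟩ : ∃ p : ℤ, (y - u) / s - p ≤ ε ∧ -ε ≤ (y - u) / s - p := by
      have h1 := Int.floor_add_fract ((y - u) / s)
      have h2 := Int.fract_nonneg ((y - u) / s)
      have h3 := Int.fract_lt_one ((y - u) / s)
      by_cases h : ε ≤ Int.fract ((y - u) / s)
      · refine ⟨⌊(y - u) / s⌋ + 1, ?_, ?_⟩
        · push_cast; linarith
        · have : ¬ (Int.fract ((y - u) / s) ≤ 1 - ε) := fun h' => hu ⟨h, h'⟩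
          push_cast; linarith
      · exact ⟨⌊(y - u) / s⌋, by linarith, by linarith⟩
    have e1 : (y - Λ / 2) / s ≤ (y - u) / s := by gcongr
    have e2 : (y - u) / s ≤ (y + Λ / 2) / s := by gcongr; linarith
    simp only [Set.mem_iUnion, Finset.mem_Icc]
    refine ⟨p, ⟨Int.ceil_le.2 (by linarith), Int.le_floor.2 (by linarith)⟩, ?_⟩
    have e3 : (y - u) / s * s = y - u := div_mul_cancel₀ _ hs.ne'
    constructor <;> nlinarith
  refine (measure_mono hsub).trans ((measure_biUnion_finset_le _ _).trans ?_)
  have hvol : ∀ p : ℤ, volume (Set.Icc (y - p * s - ε * s) (y - p * s + ε * s)) =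
      ENNReal.ofReal (2 * ε * s) := fun p => by
    rw [Real.volume_Icc]; congr 1; ring
  simp only [hvol, Finset.sum_const, nsmul_eq_mul, Int.card_Icc]
  have hcard : (((k₁ + 1 - k₀).toNat : ℕ) : ℝ) ≤ Λ / s + 3 := by
    have h1 : (k₁ : ℝ) ≤ (y + Λ / 2) / s + 1 := Int.floor_le _
    have h2 : (y - Λ / 2) / s - 1 ≤ k₀ := Int.le_ceil _
    have h3 : (y + Λ / 2) / s - (y - Λ / 2) / s = Λ / s := by rw [← sub_div]; ring
    have h4 : 0 ≤ Λ / s := div_nonneg (hs.le.trans hsΛ) hs.le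
    rcases le_total 0 (k₁ + 1 - k₀) with h | h
    · have : (((k₁ + 1 - k₀).toNat : ℕ) : ℝ) = ((k₁ + 1 - k₀ : ℤ) : ℝ) := by
        exact_mod_cast Int.toNat_of_nonneg h
      rw [this]; push_cast; linarith
    · rw [Int.toNat_of_nonpos h]; push_cast; linarith
  rw [← ENNReal.ofReal_natCast, ← ENNReal.ofReal_mul (by positivity)]
  refine ENNReal.ofReal_le_ofReal ?_
  calc (((k₁ + 1 - k₀).toNat : ℕ) : ℝ) * (2 * ε * s) ≤ (Λ / s + 3) * (2 * ε * s) := by gcongr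
    _ = 2 * ε * (Λ + 3 * s) := by field_simp
    _ ≤ 2 * ε * (Λ + 3 * Λ) := by gcongr
    _ = _ := by ring

/-- The shifts for which a given point is not good at generation `i` are few. -/
theorem volume_not_mem_goodSet_le {n : ℕ} {Λ η : ℝ} (hΛ : 0 < Λ) (hη : 0 ≤ η) (hη1 : η ≤ 1)
    (z x : EuclideanSpace ℝ (Fin n)) (i : ℕ) :
    volume {u ∈ Set.Ico (-(Λ / 2)) (Λ / 2) |
      x ∉ goodSet (fun c => z c + u - Λ) (2 * Λ) η i} ≤ ENNReal.ofReal (32 * n * η * Λ) := by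
  have hsub : {u ∈ Set.Ico (-(Λ / 2)) (Λ / 2) |
      x ∉ goodSet (fun c => z c + u - Λ) (2 * Λ) η i} ⊆
      ⋃ j ∈ Finset.Icc 1 i, ⋃ c ∈ (Finset.univ : Finset (Fin n)),
        {u ∈ Set.Ico (-(Λ / 2)) (Λ / 2) |
          ¬ (η * (3 / 4) ^ (i - j) ≤ Int.fract (((x c - z c + Λ) - u) / (2 * Λ / 2 ^ j)) ∧
            Int.fract (((x c - z c + Λ) - u) / (2 * Λ / 2 ^ j)) ≤ 1 - η * (3 / 4) ^ (i - j))} := by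
    rintro u ⟨hu, hx⟩
    simp only [goodSet, Set.mem_ofPred_eq, not_forall] at hx
    obtain ⟨j, hj, c, hc⟩ := hx
    simp only [Set.mem_iUnion]
    refine ⟨j, hj, c, Finset.mem_univ c, hu, ?_⟩
    have e : x c - z c + Λ - u = x c - (z c + u - Λ) := by ring
    rwa [e]
  have h34 : ∀ s : ℕ, (3 / 4 : ℝ) ^ s ≤ 1 := fun s => pow_le_one₀ (by norm_num) (by norm_num)
  refine (measure_mono hsub).trans ((measure_biUnion_finset_le _ _).trans ?_)
  calc _ ≤ ∑ j ∈ Finset.Icc 1 i, ENNReal.ofReal (n * (8 * (η * (3 / 4) ^ (i - j)) * Λ)) := by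
        refine Finset.sum_le_sum fun j hj => (measure_biUnion_finset_le _ _).trans ?_
        -- Gives `2 Λ / 2 ^ j ≤ Λ`: the period must not exceed the range of the shifts, which is why
        -- generation `0` is exempt from goodness.
        have hj1 : 1 ≤ j := (Finset.mem_Icc.1 hj).1
        calc _ ≤ ∑ _c : Fin n, ENNReal.ofReal (8 * (η * (3 / 4) ^ (i - j)) * Λ) := by
              refine Finset.sum_le_sum fun c _ => ?_
              refine volume_near_lattice_le (by positivity) ?_ (by positivity)
                (mul_le_one₀ hη1 (by positivity) (h34 _))
              rw [div_le_iff₀ (by positivity), mul_comm]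
              gcongr
              exact le_self_pow₀ (by norm_num) (by omega)
          _ = _ := by
              rw [Finset.sum_const, nsmul_eq_mul, Finset.card_univ, Fintype.card_fin,
                ENNReal.ofReal_mul (p := n) (by positivity), ENNReal.ofReal_natCast]
    _ = ENNReal.ofReal (8 * n * η * Λ * ∑ j ∈ Finset.Icc 1 i, (3 / 4) ^ (i - j)) := by
        rw [← ENNReal.ofReal_sum_of_nonneg fun j _ => by positivity, Finset.mul_sum]
        congr 1
        exact Finset.sum_congr rfl fun j _ => by ring
    _ ≤ _ := by
        refine ENNReal.ofReal_le_ofReal ?_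
        have hsum : ∑ j ∈ Finset.Icc 1 i, (3 / 4 : ℝ) ^ (i - j) ≤ 4 := by
          calc ∑ j ∈ Finset.Icc 1 i, (3 / 4 : ℝ) ^ (i - j)
              ≤ ∑ j ∈ Finset.range (i + 1), (3 / 4 : ℝ) ^ (i - j) := by
                refine Finset.sum_le_sum_of_subset_of_nonneg (fun j hj => ?_)
                  fun j _ _ => by positivity
                rw [Finset.mem_Icc] at hj
                rw [Finset.mem_range]; omega
            _ = ∑ j ∈ Finset.range (i + 1), (3 / 4 : ℝ) ^ j := by
                rw [← Finset.sum_range_reflect]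
                refine Finset.sum_congr rfl fun j hj => ?_
                rw [Finset.mem_range] at hj
                congr 1; omega
            _ ≤ ∑' j : ℕ, (3 / 4 : ℝ) ^ j :=
                (summable_geometric_of_lt_one (by norm_num) (by norm_num)).sum_le_tsum _
                  fun j _ => by positivity
            _ = 4 := by rw [tsum_geometric_of_lt_one (by norm_num) (by norm_num)]; norm_num
        calc 8 * n * η * Λ * ∑ j ∈ Finset.Icc 1 i, (3 / 4 : ℝ) ^ (i - j)
            ≤ 8 * n * η * Λ * 4 := by gcongr
          _ = _ := by ring

end Probability

/-! ### Joint measurability in the shift and the point, for Fubini. -/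

section Measurability

variable {X Y ι : Type*} [MeasurableSpace X] [MeasurableSpace Y] [MeasurableSpace ι]
  [MeasurableSingletonClass ι] [Countable ι] {σ : Measure X} [SFinite σ] {π : Y → X → ι}

theorem measurableSet_fiber_prod (hπ : Measurable fun p : Y × X => π p.1 p.2) :
    MeasurableSet {q : (Y × X) × X | π q.1.1 q.2 = π q.1.1 q.1.2} :=
  measurableSet_eq_fun (hπ.comp (f := fun q : (Y × X) × X => (q.1.1, q.2)) (by fun_prop))
    (hπ.comp (f := fun q : (Y × X) × X => q.1) (by fun_prop))

theorem measurable_fiberAvg_prod (hπ : Measurable fun p : Y × X => π p.1 p.2)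
    {f : X → ℂ} (hf : AEStronglyMeasurable f σ) :
    Measurable fun p : Y × X => fiberAvg σ (π p.1) f p.2 := by
  have hS := measurableSet_fiber_prod hπ
  have hfib : ∀ p : Y × X, MeasurableSet (π p.1 ⁻¹' {π p.1 p.2}) := fun p =>
    (hπ.comp (f := fun x => (p.1, x)) (by fun_prop)) (measurableSet_singleton _)
  have h1 : Measurable fun p : Y × X => ∫ y in π p.1 ⁻¹' {π p.1 p.2}, hf.mk f y ∂σ := by
    have := (StronglyMeasurable.integral_prod_right' (ν := σ)
      ((hf.stronglyMeasurable_mk.measurable.comp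
        (measurable_snd (α := Y × X) (β := X))).indicator hS).stronglyMeasurable).measurable
    convert! this using 2 with p
    rw [← integral_indicator (hfib p)]
    rfl
  have h2 : Measurable fun p : Y × X => σ (π p.1 ⁻¹' {π p.1 p.2}) :=
    measurable_measure_prodMk_left hS
  have e : (fun p : Y × X => fiberAvg σ (π p.1) f p.2) = fun p =>
      (σ (π p.1 ⁻¹' {π p.1 p.2})).toReal⁻¹ • ∫ y in π p.1 ⁻¹' {π p.1 p.2}, hf.mk f y ∂σ := by
    ext p
    rw [fiberAvg_congr_ae hf.ae_eq_mk, fiberAvg, setAverage_eq]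
    rfl
  rw [e]
  exact h2.ennreal_toReal.inv.smul h1

end Measurability

/-! ### Stable sets, on which `θ_t 1` has a bounded square function. -/

section Stable

variable {n : ℕ} {m α K L D A η : ℝ}
  {k : ℝ → EuclideanSpace ℝ (Fin n) → EuclideanSpace ℝ (Fin n) → ℂ}
  {σ : Measure (EuclideanSpace ℝ (Fin n))} {F : Set (EuclideanSpace ℝ (Fin n))}
  {b f : EuclideanSpace ℝ (Fin n) → ℂ} {Y : Type*} [MeasurableSpace Y] {a : Y → Fin n → ℝ}

theorem measurable_gridIndex_prod (ha : Measurable a) (L : ℝ) (i : ℕ) :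
    Measurable fun p : Y × EuclideanSpace ℝ (Fin n) => gridIndex (a p.1) L i p.2 := by
  refine measurable_pi_iff.2 fun c => ?_
  unfold gridIndex
  refine Int.measurable_floor.comp ?_
  fun_prop

theorem measurableSet_goodSet_prod (ha : Measurable a) (L η : ℝ) (i : ℕ) :
    MeasurableSet {p : Y × EuclideanSpace ℝ (Fin n) | p.2 ∈ goodSet (a p.1) L η i} := by
  have hm : ∀ (j : ℕ) (c : Fin n), Measurable fun p : Y × EuclideanSpace ℝ (Fin n) =>
      Int.fract ((p.2 c - a p.1 c) / (L / 2 ^ j)) := fun j c =>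
    measurable_fract.comp (by fun_prop)
  have e : {p : Y × EuclideanSpace ℝ (Fin n) | p.2 ∈ goodSet (a p.1) L η i} =
      ⋂ j ∈ Finset.Icc 1 i, ⋂ c, {p : Y × EuclideanSpace ℝ (Fin n) |
        η * (3 / 4) ^ (i - j) ≤ Int.fract ((p.2 c - a p.1 c) / (L / 2 ^ j)) ∧
          Int.fract ((p.2 c - a p.1 c) / (L / 2 ^ j)) ≤ 1 - η * (3 / 4) ^ (i - j)} := by
    ext p
    simp only [goodSet, Set.mem_iInter, Set.mem_ofPred_eq]
  rw [e]
  refine Finset.measurableSet_biInter _ fun j _ => MeasurableSet.iInter fun c => ?_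
  exact (measurableSet_le measurable_const (hm j c)).inter
    (measurableSet_le (hm j c) measurable_const)

theorem measurableSet_goodSet (a : Fin n → ℝ) (L η : ℝ) (i : ℕ) :
    MeasurableSet (goodSet a L η i) :=
  measurableSet_goodSet_prod (Y := Unit) (a := fun _ => a) measurable_const L η i |>.preimage
    (f := fun x => ((), x)) (by fun_prop)

theorem measurable_errorPiece_prod [SFinite σ] (hk : IsKernel m α K k) (ha : Measurable a)
    (hb : AEStronglyMeasurable b σ) (l : ℝ) (i : ℕ) :
    Measurable fun p : Y × EuclideanSpace ℝ (Fin n) =>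
      errorPiece k σ (gridIndex (a p.1) L) L l b i p.2 := by
  obtain ⟨Θ, hΘm, hΘ⟩ := hk.exists_measurable_theta hb
  obtain ⟨Θ₁, hΘ₁m, hΘ₁⟩ := hk.exists_measurable_theta (σ := σ) (f := fun _ => 1)
    aestronglyMeasurable_const
  have hav := measurable_fiberAvg_prod (σ := σ) (π := fun u => gridIndex (a u) L i)
    (measurable_gridIndex_prod ha L i) hb
  have e : (fun p : Y × EuclideanSpace ℝ (Fin n) =>
      errorPiece k σ (gridIndex (a p.1) L) L l b i p.2) = fun p => ∫⁻ t in timeSet L l i,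
        ‖Θ (t, p.2) - Θ₁ (t, p.2) * fiberAvg σ (gridIndex (a p.1) L i) b p.2‖ₑ ^ 2 /
          ENNReal.ofReal t := by
    ext p
    refine setLIntegral_congr_fun (measurableSet_timeSet L l i) fun t ht => ?_
    simp only [avgError, hΘ t ht.2.1, hΘ₁ t ht.2.1]
  rw [e]
  refine Measurable.lintegral_prod_right' (f := fun q : (Y × EuclideanSpace ℝ (Fin n)) × ℝ =>
    ‖Θ (q.2, q.1.2) - Θ₁ (q.2, q.1.2) * fiberAvg σ (gridIndex (a q.1.1) L i) b q.1.2‖ₑ ^ 2 /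
      ENNReal.ofReal q.2) ?_
  have h1 : Measurable fun q : (Y × EuclideanSpace ℝ (Fin n)) × ℝ => Θ (q.2, q.1.2) :=
    hΘm.comp (by fun_prop)
  have h2 : Measurable fun q : (Y × EuclideanSpace ℝ (Fin n)) × ℝ => Θ₁ (q.2, q.1.2) :=
    hΘ₁m.comp (by fun_prop)
  have h3 : Measurable fun q : (Y × EuclideanSpace ℝ (Fin n)) × ℝ =>
      fiberAvg σ (gridIndex (a q.1.1) L i) b q.1.2 := hav.comp measurable_fst
  fun_prop

/-- The total error of `b` over the generations at which a point is good. -/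
noncomputable def totalError
    (k : ℝ → EuclideanSpace ℝ (Fin n) → EuclideanSpace ℝ (Fin n) → ℂ)
    (σ : Measure (EuclideanSpace ℝ (Fin n))) (a : Fin n → ℝ) (L l η : ℝ)
    (b : EuclideanSpace ℝ (Fin n) → ℂ) (x : EuclideanSpace ℝ (Fin n)) : ℝ≥0∞ :=
  ∑' i, (goodSet a L η i).indicator (errorPiece k σ (gridIndex a L) L l b i) x

/-- The points of `F` at which all dyadic averages of `b` are at least `c` in modulus and the
total error of `b` is at most `lam`. -/
def stableSet (k : ℝ → EuclideanSpace ℝ (Fin n) → EuclideanSpace ℝ (Fin n) → ℂ)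
    (σ : Measure (EuclideanSpace ℝ (Fin n))) (F : Set (EuclideanSpace ℝ (Fin n)))
    (b : EuclideanSpace ℝ (Fin n) → ℂ) (L l η c lam : ℝ) (a : Fin n → ℝ) :
    Set (EuclideanSpace ℝ (Fin n)) :=
  {x | x ∈ F ∧ (∀ i, c ≤ ‖fiberAvg σ (gridIndex a L i) b x‖) ∧
    totalError k σ a L l η b x ≤ ENNReal.ofReal lam}

theorem measurable_totalError_prod [SFinite σ] (hk : IsKernel m α K k) (ha : Measurable a)
    (hb : AEStronglyMeasurable b σ) (l : ℝ) :
    Measurable fun p : Y × EuclideanSpace ℝ (Fin n) => totalError k σ (a p.1) L l η b p.2 := by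
  unfold totalError
  refine Measurable.tsum fun i => ?_
  exact (measurable_errorPiece_prod hk ha hb l i).indicator (measurableSet_goodSet_prod ha L η i)

theorem measurable_totalError [SFinite σ] (hk : IsKernel m α K k)
    (hb : AEStronglyMeasurable b σ) (a : Fin n → ℝ) (l : ℝ) :
    Measurable (totalError k σ a L l η b) :=
  (measurable_totalError_prod (Y := Unit) (a := fun _ => a) hk measurable_const hb l).comp
    (f := fun x => ((), x)) (by fun_prop)

theorem measurableSet_stableSet_prod [SFinite σ] (hk : IsKernel m α K k) (ha : Measurable a)
    (hb : AEStronglyMeasurable b σ) (hF : MeasurableSet F) (l c lam : ℝ) :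
    MeasurableSet {p : Y × EuclideanSpace ℝ (Fin n) |
      p.2 ∈ stableSet k σ F b L l η c lam (a p.1)} := by
  have h1 : MeasurableSet {p : Y × EuclideanSpace ℝ (Fin n) |
      ∀ i, c ≤ ‖fiberAvg σ (gridIndex (a p.1) L i) b p.2‖} := by
    rw [Set.ofPred_forall]
    exact MeasurableSet.iInter fun i => measurableSet_le measurable_const
      (measurable_fiberAvg_prod (σ := σ) (π := fun u => gridIndex (a u) L i)
        (measurable_gridIndex_prod ha L i) hb).norm
  exact (measurable_snd hF).inter (h1.inter
    (measurableSet_le (measurable_totalError_prod hk ha hb l) measurable_const))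

theorem measurableSet_stableSet [SFinite σ] (hk : IsKernel m α K k)
    (hb : AEStronglyMeasurable b σ) (hF : MeasurableSet F) (l c lam : ℝ) (a : Fin n → ℝ) :
    MeasurableSet (stableSet k σ F b L l η c lam a) :=
  measurableSet_stableSet_prod (Y := Unit) (a := fun _ => a) hk measurable_const hb hF l c lam
    |>.preimage (f := fun x => ((), x)) (by fun_prop)

/-- Dividing by the average of `b`, at least `c` in modulus, bounds `θ_t 1` by `θ_t b` and the error
of `b`; both have controlled square functions at points of the stable set. -/
theorem tsum_timePiece_one_le_of_mem_stableSet [IsFiniteMeasure σ] (hk : IsKernel m α K k)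
    (hL : 0 < L) {l c lam lam₀ : ℝ} (hl : l ≤ L) (hc : 0 < c)
    (hlam : 0 ≤ lam) (hb : AEStronglyMeasurable b σ)
    {a : Fin n → ℝ} {x : EuclideanSpace ℝ (Fin n)}
    (hx : x ∈ stableSet k σ F b L l η c lam a) (hV : squareFn k σ l b x ≤ ENNReal.ofReal lam₀) :
    ∑' i, (goodSet a L η i).indicator (timePiece k σ L l (fun _ => 1) i) x ≤
      ENNReal.ofReal (c⁻¹ ^ 2 * (2 * lam₀ ^ 2 + 2 * lam)) := by
  obtain ⟨-, hacc, herr⟩ := hx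
  have hV2 : ∑' i, timePiece k σ L l b i x ≤ ENNReal.ofReal (lam₀ ^ 2) := by
    rw [← squareFn_sq_eq_tsum hL hl]
    refine (pow_le_pow_left' hV 2).trans ?_
    rcases le_total 0 lam₀ with h | h
    · rw [ENNReal.ofReal_pow h]
    · simp [ENNReal.ofReal_of_nonpos h]
  calc _ ≤ ∑' i, ENNReal.ofReal (c⁻¹ ^ 2) * (2 * timePiece k σ L l b i x +
        2 * (goodSet a L η i).indicator (errorPiece k σ (gridIndex a L) L l b i) x) := by
        refine ENNReal.tsum_le_tsum fun i => ?_
        by_cases hxi : x ∈ goodSet a L η i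
        · rw [Set.indicator_of_mem hxi, Set.indicator_of_mem hxi]
          exact timePiece_one_le hk hb l i x hc (hacc i)
        · rw [Set.indicator_of_notMem hxi]
          exact zero_le
    _ = ENNReal.ofReal (c⁻¹ ^ 2) * (2 * ∑' i, timePiece k σ L l b i x +
        2 * totalError k σ a L l η b x) := by
        rw [ENNReal.tsum_mul_left, ENNReal.tsum_add, ENNReal.tsum_mul_left, ENNReal.tsum_mul_left,
          totalError]
    _ ≤ ENNReal.ofReal (c⁻¹ ^ 2) * (2 * ENNReal.ofReal (lam₀ ^ 2) + 2 * ENNReal.ofReal lam) := by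
        gcongr
    _ = _ := by
        rw [ENNReal.ofReal_mul (by positivity), ENNReal.ofReal_add (by positivity) (by positivity),
          ENNReal.ofReal_mul (p := 2) (by norm_num), ENNReal.ofReal_mul (p := 2) (by norm_num)]
        simp

/-- Chebyshev's inequality for the total error. -/
theorem mul_measure_totalError_le [IsFiniteMeasure σ] (hk : IsKernel m α K k) (hm : 0 < m)
    (hα : 0 < α) (hL : 0 < L) (hη : 0 < η) (hA : 0 ≤ A) {a : Fin n → ℝ}
    (hFa : F ⊆ hoCube a L) (hσ : ∀ᵐ y ∂σ, y ∈ hoCube a L) (hb : MemLp b 2 σ)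
    (hF : MeasurableSet F)
    (hx : ∀ x ∈ F, ∀ r, 0 < r → σ (Metric.ball x r) ≤ ENNReal.ofReal (A * r ^ m)) (l lam : ℝ) :
    ENNReal.ofReal lam * σ {x ∈ F | ENNReal.ofReal lam < totalError k σ a L l η b x} ≤
      ENNReal.ofReal (errorConst m α K n A η) * ∫⁻ x, ‖b x‖ₑ ^ 2 ∂σ := by
  have hmE : ∀ i, Measurable (errorPiece k σ (gridIndex a L) L l b i) := fun i =>
    (measurable_errorPiece_prod (Y := Unit) (a := fun _ => a) hk measurable_const hb.1 l i).comp
      (f := fun x => ((), x)) (by fun_prop)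
  have hint : ∫⁻ x in F, totalError k σ a L l η b x ∂σ ≤
      ENNReal.ofReal (errorConst m α K n A η) * ∫⁻ x, ‖b x‖ₑ ^ 2 ∂σ := by
    refine le_trans (le_of_eq ?_) (tsum_lintegral_avgError_le hk hm hα hL (Nat.cast_nonneg n) hη hA
      (isGrid_gridIndex hL hFa hσ) hb hF hx (measurableSet_goodSet a L η)
      (fun i x => isGood_of_mem_goodSet hL) l)
    unfold totalError
    rw [lintegral_tsum fun i =>
      ((hmE i).indicator (measurableSet_goodSet a L η i)).aemeasurable]
    refine tsum_congr fun i => ?_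
    rw [lintegral_indicator (measurableSet_goodSet a L η i),
      Measure.restrict_restrict (measurableSet_goodSet a L η i), Set.inter_comm]
    rfl
  refine le_trans ?_ ((mul_meas_ge_le_lintegral (measurable_totalError hk hb.1 a l)
    (ENNReal.ofReal lam)).trans hint)
  refine mul_le_mul_right ?_ _
  rw [Measure.restrict_apply' hF]
  exact measure_mono fun x hx => ⟨hx.2.le, hx.1⟩

theorem tsum_lintegral_stableSet_le [IsFiniteMeasure σ] (hk : IsKernel m α K k) (hm : 0 < m)
    (hα : 0 < α) (hL : 0 < L) (hη : 0 < η) (hA : 0 ≤ A) {a : Fin n → ℝ}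
    (hFa : F ⊆ hoCube a L) (hσ : ∀ᵐ y ∂σ, y ∈ hoCube a L) (hb : AEStronglyMeasurable b σ)
    (hf : MemLp f 2 σ) (hF : MeasurableSet F)
    (hx : ∀ x ∈ F, ∀ r, 0 < r → σ (Metric.ball x r) ≤ ENNReal.ofReal (A * r ^ m))
    {l c lam lam₀ : ℝ} (hl : l ≤ L) (hc : 0 < c) (hlam : 0 ≤ lam)
    (hV : ∀ x ∈ F, squareFn k σ l b x ≤ ENNReal.ofReal lam₀) :
    ∑' i, ∫⁻ x in stableSet k σ F b L l η c lam a ∩ goodSet a L η i, timePiece k σ L l f i x ∂σ ≤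
      ENNReal.ofReal (8 * (c⁻¹ ^ 2 * (2 * lam₀ ^ 2 + 2 * lam)) + 2 * errorConst m α K n A η) *
        ∫⁻ x, ‖f x‖ₑ ^ 2 ∂σ := by
  have hC := decayConst_pos (m := m) (half_pos hα)
  have hE : 0 ≤ errorConst m α K n A η := by unfold errorConst; positivity
  refine (tsum_lintegral_timePiece_le hk hm hα hL (Nat.cast_nonneg n) hη hA
    (isGrid_gridIndex hL hFa hσ) hf hF hx (measurableSet_goodSet a L η)
    (fun i x => isGood_of_mem_goodSet hL) l (measurableSet_stableSet hk hb hF l c lam a)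
    (fun x hx => hx.1) (fun x hx => tsum_timePiece_one_le_of_mem_stableSet hk hL hl hc hlam hb hx
      (hV x hx.1))).trans_eq ?_
  rw [ENNReal.ofReal_add (by positivity) (by positivity),
    ENNReal.ofReal_mul (p := 8) (by norm_num), ENNReal.ofReal_mul (p := 2)
    (q := errorConst m α K n A η) (by norm_num)]
  simp

end Stable

/-! ### Averaging over the random grids. -/

section Averaging

/-- The points which are in `S u` with probability at least `2 τ`. -/
def frequentSet {X Y : Type*} [MeasurableSpace Y] (μ : Measure Y) (S : Y → Set X) (τ : ℝ) : Set X :=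
  {x | ENNReal.ofReal (2 * τ) ≤ μ {u | x ∈ S u}}

theorem frequentSet_subset {X Y : Type*} [MeasurableSpace Y] {μ : Measure Y} {S : Y → Set X} {τ : ℝ}
    {F : Set X} (hτ : 0 < τ) (hF : ∀ u, S u ⊆ F) :
    frequentSet μ S τ ⊆ F := by
  intro x hx
  by_contra hxF
  have : {u | x ∈ S u} = ∅ := Set.eq_empty_of_forall_notMem fun u hu => hxF (hF u hu)
  have hx' : ENNReal.ofReal (2 * τ) ≤ μ {u | x ∈ S u} := hx
  rw [this, measure_empty, nonpos_iff_eq_zero, ENNReal.ofReal_eq_zero] at hx'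
  linarith

variable {X Y : Type*} [MeasurableSpace X] [MeasurableSpace Y] {σ : Measure X} [IsFiniteMeasure σ]
  {μ : Measure Y} [IsProbabilityMeasure μ] {S : Y → Set X} {τ : ℝ}

theorem measurable_measure_section (hS : MeasurableSet {p : Y × X | p.2 ∈ S p.1}) :
    Measurable fun x => μ {u | x ∈ S u} :=
  measurable_measure_prodMk_right hS

theorem measurableSet_frequentSet (hS : MeasurableSet {p : Y × X | p.2 ∈ S p.1}) :
    MeasurableSet (frequentSet μ S τ) :=
  measurableSet_le measurable_const (measurable_measure_section hS)

/-- Fubini: `4τ σ(X) ≤ ∫ μ{u | x ∈ S u} dσ ≤ σ(G) + 2τ σ(X)`, bounding the probability by `1` on the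
frequent set `G` and by `2τ` off it. -/
theorem le_measureReal_frequentSet (hS : MeasurableSet {p : Y × X | p.2 ∈ S p.1}) (hτ : 0 < τ)
    (h : ∀ᵐ u ∂μ, 4 * τ * σ.real Set.univ ≤ σ.real (S u)) :
    2 * τ * σ.real Set.univ ≤ σ.real (frequentSet μ S τ) := by
  have hG := measurableSet_frequentSet (μ := μ) (τ := τ) hS
  set G := frequentSet μ S τ with hGdef
  have hswap : ∫⁻ u, σ (S u) ∂μ = ∫⁻ x, μ {u | x ∈ S u} ∂σ :=
    (Measure.prod_apply hS).symm.trans (Measure.prod_apply_symm hS)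
  have hlow : ENNReal.ofReal (4 * τ * σ.real Set.univ) ≤ ∫⁻ u, σ (S u) ∂μ := by
    calc ENNReal.ofReal (4 * τ * σ.real Set.univ)
        = ∫⁻ _, ENNReal.ofReal (4 * τ * σ.real Set.univ) ∂μ := by simp
      _ ≤ _ := lintegral_mono_ae (h.mono fun u hu => by
          rw [← ENNReal.ofReal_toReal (measure_ne_top σ (S u))]
          exact ENNReal.ofReal_le_ofReal hu)
  have hup : ∫⁻ x, μ {u | x ∈ S u} ∂σ ≤
      ENNReal.ofReal (σ.real G + 2 * τ * σ.real Set.univ) := by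
    calc ∫⁻ x, μ {u | x ∈ S u} ∂σ
        ≤ ∫⁻ x, (G.indicator (fun _ => 1) x + ENNReal.ofReal (2 * τ)) ∂σ := by
          refine lintegral_mono fun x => ?_
          by_cases hx : x ∈ G
          · rw [Set.indicator_of_mem hx]
            exact prob_le_one.trans le_self_add
          · rw [Set.indicator_of_notMem hx, zero_add]
            exact (not_le.1 hx).le
      _ = σ G + ENNReal.ofReal (2 * τ) * σ Set.univ := by
          rw [lintegral_add_right _ measurable_const, lintegral_indicator_const hG,
            lintegral_const, one_mul]
      _ = _ := by
          rw [ENNReal.ofReal_add (by positivity) (by positivity),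
            ENNReal.ofReal_mul (p := 2 * τ) (by positivity), Measure.real, Measure.real,
            ENNReal.ofReal_toReal (measure_ne_top _ _), ENNReal.ofReal_toReal (measure_ne_top _ _)]
  have hfin := (ENNReal.ofReal_le_ofReal_iff (by positivity)).1 (hlow.trans (hswap.trans_le hup))
  linarith

theorem mul_lintegral_frequentSet_le (hS : MeasurableSet {p : Y × X | p.2 ∈ S p.1}) (hτ : 0 < τ)
    {Γ : Y → ℕ → Set X} (hΓ : ∀ i, MeasurableSet {p : Y × X | p.2 ∈ Γ p.1 i})
    (hbad : ∀ x i, μ {u | x ∉ Γ u i} ≤ ENNReal.ofReal τ) {g : ℕ → X → ℝ≥0∞}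
    (hg : ∀ i, Measurable (g i)) {B : ℝ≥0∞}
    (hB : ∀ᵐ u ∂μ, ∑' i, ∫⁻ x in S u ∩ Γ u i, g i x ∂σ ≤ B) :
    ENNReal.ofReal τ * ∫⁻ x in frequentSet μ S τ, ∑' i, g i x ∂σ ≤ B := by
  have hG := measurableSet_frequentSet (μ := μ) (τ := τ) hS
  have hSΓ : ∀ i, MeasurableSet {p : Y × X | p.2 ∈ S p.1 ∩ Γ p.1 i} := fun i => hS.inter (hΓ i)
  have hind : ∀ i, Measurable ({p : Y × X | p.2 ∈ S p.1 ∩ Γ p.1 i}.indicator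
      fun p => g i p.2) := fun i => ((hg i).comp measurable_snd).indicator (hSΓ i)
  -- Probability at least `2τ` of lying in `S u`, minus at most `τ` for failing `Γ u i`. No
  -- independence of the two events is used.
  have hprob : ∀ i, ∀ x ∈ frequentSet μ S τ, ENNReal.ofReal τ ≤ μ {u | x ∈ S u ∩ Γ u i} := by
    intro i x hx
    have h1 : ENNReal.ofReal τ + ENNReal.ofReal τ ≤
        μ {u | x ∈ S u ∩ Γ u i} + ENNReal.ofReal τ := by
      rw [← ENNReal.ofReal_add hτ.le hτ.le, ← two_mul]
      refine le_trans (show _ ≤ μ {u | x ∈ S u} from hx) ?_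
      refine le_trans ?_ (add_le_add_right (hbad x i) _)
      refine le_trans (measure_mono fun u hu => ?_) (measure_union_le _ _)
      by_cases h : x ∈ Γ u i
      · exact Or.inl ⟨hu, h⟩
      · exact Or.inr h
    exact (ENNReal.add_le_add_iff_right ENNReal.ofReal_ne_top).1 h1
  have hterm : ∀ i, ENNReal.ofReal τ * ∫⁻ x in frequentSet μ S τ, g i x ∂σ ≤
      ∫⁻ u, ∫⁻ x in S u ∩ Γ u i, g i x ∂σ ∂μ := by
    intro i
    calc ENNReal.ofReal τ * ∫⁻ x in frequentSet μ S τ, g i x ∂σ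
        = ∫⁻ x in frequentSet μ S τ, ENNReal.ofReal τ * g i x ∂σ :=
          (lintegral_const_mul _ (hg i)).symm
      _ ≤ ∫⁻ x in frequentSet μ S τ, μ {u | x ∈ S u ∩ Γ u i} * g i x ∂σ :=
          setLIntegral_mono' hG fun x hx => mul_le_mul_left (hprob i x hx) _
      _ ≤ ∫⁻ x, μ {u | x ∈ S u ∩ Γ u i} * g i x ∂σ := setLIntegral_le_lintegral _ _
      _ = ∫⁻ x, ∫⁻ u, {p : Y × X | p.2 ∈ S p.1 ∩ Γ p.1 i}.indicator
            (fun p => g i p.2) (u, x) ∂μ ∂σ := by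
          refine lintegral_congr fun x => ?_
          have hm : MeasurableSet {u | x ∈ S u ∩ Γ u i} :=
            (measurable_id.prodMk measurable_const) (hSΓ i)
          rw [mul_comm, ← lintegral_indicator_const hm]
          rfl
      _ = ∫⁻ u, ∫⁻ x, {p : Y × X | p.2 ∈ S p.1 ∩ Γ p.1 i}.indicator
            (fun p => g i p.2) (u, x) ∂σ ∂μ :=
          (lintegral_lintegral_swap (f := fun u x => {p : Y × X | p.2 ∈ S p.1 ∩ Γ p.1 i}.indicator
            (fun p => g i p.2) (u, x)) (hind i).aemeasurable).symm
      _ = _ := by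
          refine lintegral_congr fun u => ?_
          have hm : MeasurableSet (S u ∩ Γ u i) :=
            (measurable_const.prodMk measurable_id) (hSΓ i)
          rw [← lintegral_indicator hm]
          rfl
  have hmeas : ∀ i, Measurable fun u => ∫⁻ x in S u ∩ Γ u i, g i x ∂σ := fun i => by
    have := (hind i).lintegral_prod_right' (ν := σ)
    convert! this using 2 with u
    have hm : MeasurableSet (S u ∩ Γ u i) :=
      (measurable_const.prodMk measurable_id) (hSΓ i)
    rw [← lintegral_indicator hm]
    rfl
  calc _ = ∑' i, ENNReal.ofReal τ * ∫⁻ x in frequentSet μ S τ, g i x ∂σ := by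
        rw [lintegral_tsum fun i => (hg i).aemeasurable, ENNReal.tsum_mul_left]
    _ ≤ ∑' i, ∫⁻ u, ∫⁻ x in S u ∩ Γ u i, g i x ∂σ ∂μ := ENNReal.tsum_le_tsum hterm
    _ = ∫⁻ u, ∑' i, ∫⁻ x in S u ∩ Γ u i, g i x ∂σ ∂μ :=
        (lintegral_tsum fun i => (hmeas i).aemeasurable).symm
    _ ≤ ∫⁻ _, B ∂μ := lintegral_mono_ae hB
    _ = B := by simp

end Averaging

/-! ### Lower bound for the measure of a stable set. -/

section StableMeasure

variable {n : ℕ} {L η : ℝ}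
  {k : ℝ → EuclideanSpace ℝ (Fin n) → EuclideanSpace ℝ (Fin n) → ℂ}
  {σ : Measure (EuclideanSpace ℝ (Fin n))} [IsFiniteMeasure σ]
  {b : EuclideanSpace ℝ (Fin n) → ℂ} {a : Fin n → ℝ}

/-- On a null cube the average is `0` by convention, yet the strict stopping inequality reads `0 <
0`. Such cubes are countably many and can be discarded. -/
theorem ae_measure_fiber_ne_zero {X ι : Type*} [MeasurableSpace X] [Countable ι] (σ : Measure X)
    (π : X → ι) : ∀ᵐ x ∂σ, σ (π ⁻¹' {π x}) ≠ 0 := by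
  have : {x | ¬ σ (π ⁻¹' {π x}) ≠ 0} ⊆ ⋃ v : {v : ι // σ (π ⁻¹' {v}) = 0}, π ⁻¹' {v.1} := by
    intro x hx
    exact Set.mem_iUnion.2 ⟨⟨π x, not_not.1 hx⟩, rfl⟩
  exact measure_mono_null this (measure_iUnion_null fun v => v.2)

/-- The stable set is large if the exceptional sets are small. -/
theorem le_measureReal_stableSet (hL : 0 < L) {Q H F : Set (EuclideanSpace ℝ (Fin n))}
    {l c lam lam₀ δ ε : ℝ} (hQ : Q ⊆ hoCube a L)
    (hF : F = {x | x ∈ Q \ H ∧ squareFn k σ l b x ≤ ENNReal.ofReal lam₀})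
    (hT : σ.real (H ∪ ⋃₀ {R | Maximal (fun R' => R' ∈ dyadicGrid a L ∧
      ‖∫ x in R', b x ∂σ‖ < c * σ.real R') R}) ≤ δ * σ.real Q)
    (hV : σ.real {x | x ∈ Q \ H ∧ ENNReal.ofReal lam₀ < squareFn k σ l b x} ≤ ε * σ.real Q)
    (hE : σ.real {x ∈ F | ENNReal.ofReal lam < totalError k σ a L l η b x} ≤ ε * σ.real Q) :
    (1 - δ - 2 * ε) * σ.real Q ≤ σ.real (stableSet k σ F b L l η c lam a) := by
  set T := ⋃₀ {R | Maximal (fun R' => R' ∈ dyadicGrid a L ∧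
      ‖∫ x in R', b x ∂σ‖ < c * σ.real R') R} with hTdef
  set W := {x | x ∈ Q \ H ∧ ENNReal.ofReal lam₀ < squareFn k σ l b x} with hW
  set E := {x ∈ F | ENNReal.ofReal lam < totalError k σ a L l η b x} with hEdef
  have hae : ∀ᵐ x ∂σ, x ∈ Q → x ∈ ((H ∪ T) ∪ W) ∪ (E ∪ stableSet k σ F b L l η c lam a) := by
    have hnull : ∀ᵐ x ∂σ, ∀ i, σ (gridIndex a L i ⁻¹' {gridIndex a L i x}) ≠ 0 :=
      ae_all_iff.2 fun i => ae_measure_fiber_ne_zero σ _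
    filter_upwards [hnull] with x hx hxQ
    by_cases hxH : x ∈ H
    · exact Or.inl (Or.inl (Or.inl hxH))
    by_cases hxW : ENNReal.ofReal lam₀ < squareFn k σ l b x
    · exact Or.inl (Or.inr ⟨⟨hxQ, hxH⟩, hxW⟩)
    have hxF : x ∈ F := by
      rw [hF]
      exact ⟨⟨hxQ, hxH⟩, not_lt.1 hxW⟩
    by_cases hxE : ENNReal.ofReal lam < totalError k σ a L l η b x
    · exact Or.inr (Or.inl ⟨hxF, hxE⟩)
    by_cases hacc : ∀ i, c ≤ ‖fiberAvg σ (gridIndex a L i) b x‖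
    · exact Or.inr (Or.inr ⟨hxF, hacc, not_lt.1 hxE⟩)
    · obtain ⟨i, hi⟩ := not_forall.1 hacc
      refine Or.inl (Or.inl (Or.inr ?_))
      refine mem_sUnion_maximal_of_fiber
        (P := fun R' => ‖∫ x in R', b x ∂σ‖ < c * σ.real R') hL (hQ hxQ) (i := i) ?_
      have hpos : 0 < σ.real (gridIndex a L i ⁻¹' {gridIndex a L i x}) :=
        ENNReal.toReal_pos (hx i) (measure_ne_top _ _)
      rw [not_le, fiberAvg, setAverage_eq, norm_smul, norm_inv, Real.norm_of_nonneg hpos.le,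
        inv_mul_lt_iff₀ hpos, mul_comm] at hi
      exact hi
  have hle : σ.real Q ≤ σ.real (((H ∪ T) ∪ W) ∪ (E ∪ stableSet k σ F b L l η c lam a)) :=
    ENNReal.toReal_mono (measure_ne_top _ _) (measure_mono_ae hae)
  have h1 := measureReal_union_le (μ := σ) ((H ∪ T) ∪ W) (E ∪ stableSet k σ F b L l η c lam a)
  have h2 := measureReal_union_le (μ := σ) (H ∪ T) W
  have h3 := measureReal_union_le (μ := σ) E (stableSet k σ F b L l η c lam a)
  linarith

end StableMeasure

/-! ### The cube, norm conversions, and normalised probabilities. -/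

section BigPieces

variable {n : ℕ} {m α K : ℝ}
  {k : ℝ → EuclideanSpace ℝ (Fin n) → EuclideanSpace ℝ (Fin n) → ℂ}
  {σ : Measure (EuclideanSpace ℝ (Fin n))}
  {f : EuclideanSpace ℝ (Fin n) → ℂ}

theorem IsKernel.measurable_squareFn [SFinite σ] (hk : IsKernel m α K k)
    (hf : AEStronglyMeasurable f σ) {l : ℝ} (hl : 0 < l) : Measurable (squareFn k σ l f) := by
  have e : squareFn k σ l f = fun x => (∑' i, timePiece k σ l l f i x) ^ (1 / 2 : ℝ) := by
    ext x
    rw [squareFn, lintegral_Ioo_eq_tsum_timeSet hl le_rfl]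
    rfl
  rw [e]
  exact (Measurable.tsum fun i => hk.measurable_timePiece hf l i).pow_const _

theorem measurableSet_cube (z : EuclideanSpace ℝ (Fin n)) (l : ℝ) : MeasurableSet (cube z l) := by
  have e : cube z l = ⋂ i, {x : EuclideanSpace ℝ (Fin n) | |x i - z i| ≤ l / 2} := by
    ext x
    simp only [cube, Set.mem_iInter, Set.mem_ofPred_eq]
  rw [e]
  exact MeasurableSet.iInter fun i => measurableSet_le (by fun_prop) measurable_const

theorem cube_subset_hoCube {z : EuclideanSpace ℝ (Fin n)} {l Λ u : ℝ} (hΛ : 0 < Λ)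
    (hl : l ≤ Λ / 2) (hu : u ∈ Set.Ico (-(Λ / 2)) (Λ / 2)) :
    cube z l ⊆ hoCube (fun c => z c + u - Λ) (2 * Λ) := by
  intro x hx c
  have h := abs_le.1 (hx c)
  exact ⟨by linarith [h.1, hu.2], by linarith [h.2, hu.1]⟩

theorem lintegral_enorm_sq_le_of_bound {C : ℝ} (hC : eLpNorm f ∞ σ ≤ ENNReal.ofReal C) :
    ∫⁻ x, ‖f x‖ₑ ^ 2 ∂σ ≤ ENNReal.ofReal (C ^ 2) * σ Set.univ := by
  rw [eLpNorm_exponent_top] at hC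
  calc ∫⁻ x, ‖f x‖ₑ ^ 2 ∂σ ≤ ∫⁻ _, ENNReal.ofReal (C ^ 2) ∂σ := by
        refine lintegral_mono_ae ((enorm_ae_le_eLpNormEssSup f σ).mono fun x hx => ?_)
        refine (pow_le_pow_left' (hx.trans hC) 2).trans ?_
        rcases le_total 0 C with h | h
        · rw [ENNReal.ofReal_pow h]
        · simp [ENNReal.ofReal_of_nonpos h]
    _ = _ := by rw [lintegral_const]

/-- If `(4 M / d + 1) y ≤ M S` then `y ≤ (d / 4) S`. -/
theorem le_mul_of_quotient_mul_le {M d y S : ℝ} (hM : 0 ≤ M) (hd : 0 < d) (hS : 0 ≤ S)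
    (h : (4 * M / d + 1) * y ≤ M * S) : y ≤ d / 4 * S := by
  have hp : 0 < 4 * M / d + 1 := by positivity
  refine le_of_mul_le_mul_left (h.trans ?_) hp
  have e : (4 * M / d + 1) * (d / 4 * S) = M * S + d / 4 * S := by field_simp
  rw [e]
  have : 0 ≤ d / 4 * S := by positivity
  linarith

theorem eLpNorm_indicator_squareFn_le {G : Set (EuclideanSpace ℝ (Fin n))} (hG : MeasurableSet G)
    {l B τ : ℝ} (hτ : 0 < τ) (hB : 0 ≤ B)
    (h : ENNReal.ofReal τ * ∫⁻ x in G, squareFn k σ l f x ^ 2 ∂σ ≤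
      ENNReal.ofReal B * ∫⁻ x, ‖f x‖ₑ ^ 2 ∂σ) :
    eLpNorm (G.indicator (squareFn k σ l f)) 2 σ ≤
      ENNReal.ofReal √(B / τ + 1) * eLpNorm f 2 σ := by
  have hroot : ENNReal.ofReal √(B / τ + 1) = ENNReal.ofReal (B / τ + 1) ^ (1 / 2 : ℝ) := by
    rw [Real.sqrt_eq_rpow, ENNReal.ofReal_rpow_of_nonneg (by positivity) (by norm_num)]
  rw [eLpNorm_eq_lintegral_rpow_enorm_toReal (by simp) (by simp),
    eLpNorm_eq_lintegral_rpow_enorm_toReal (by simp) (by simp), hroot]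
  simp only [ENNReal.toReal_ofNat, ENNReal.rpow_two, enorm_eq_self]
  rw [← ENNReal.mul_rpow_of_nonneg _ _ (by norm_num)]
  refine ENNReal.rpow_le_rpow ?_ (by norm_num)
  have e : ∫⁻ x, G.indicator (squareFn k σ l f) x ^ 2 ∂σ =
      ∫⁻ x in G, squareFn k σ l f x ^ 2 ∂σ := by
    rw [← lintegral_indicator hG]
    refine lintegral_congr fun x => ?_
    by_cases hx : x ∈ G <;> simp [hx]
  rw [e]
  have hτ0 : ENNReal.ofReal τ ≠ 0 := by simpa using hτ
  refine (ENNReal.mul_le_mul_iff_right hτ0 ENNReal.ofReal_ne_top).1 (h.trans ?_)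
  rw [← mul_assoc, ← ENNReal.ofReal_mul hτ.le]
  gcongr
  have : τ * (B / τ + 1) = B + τ := by field_simp
  linarith

theorem cond_not_mem_goodSet_le {Λ η τ : ℝ} (hΛ : 0 < Λ) (hη : 0 ≤ η) (hη1 : η ≤ 1)
    (hτ : 32 * n * η ≤ τ) (z x : EuclideanSpace ℝ (Fin n)) (i : ℕ) :
    ProbabilityTheory.cond volume (Set.Ico (-(Λ / 2)) (Λ / 2))
      {u | x ∉ goodSet (fun c => z c + u - Λ) (2 * Λ) η i} ≤ ENNReal.ofReal τ := by
  rw [ProbabilityTheory.cond_apply measurableSet_Ico, Real.volume_Ico]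
  have e : Λ / 2 - -(Λ / 2) = Λ := by ring
  have hΛ0 : ENNReal.ofReal Λ ≠ 0 := by simpa using hΛ
  rw [e, mul_comm, ← div_eq_mul_inv]
  refine ENNReal.div_le_of_le_mul ?_
  refine (volume_not_mem_goodSet_le hΛ hη hη1 z x i).trans ?_
  rw [← ENNReal.ofReal_mul' hΛ.le]
  exact ENNReal.ofReal_le_ofReal (by gcongr)

end BigPieces

end SquareTb

/-! ### Choice of constants and assembly. -/

open SquareTb in
theorem theorem3p1 (n : ℕ) (m α K C_b c_acc δ₀ C₀ C₁ s : ℝ)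
    (hm : 0 < m) (hα : 0 < α) (hacc : 0 < c_acc) (hδ₀ : δ₀ < 1) (hs : 0 < s) :
    ∃ c C : ℝ, 0 < c ∧ 0 < C ∧
      ∀ (k : ℝ → EuclideanSpace ℝ (Fin n) → EuclideanSpace ℝ (Fin n) → ℂ),
        SquareTb.IsKernel m α K k →
      ∀ (z : EuclideanSpace ℝ (Fin n)) (l : ℝ), 0 < l →
      ∀ (σ : Measure (EuclideanSpace ℝ (Fin n))), IsFiniteMeasure σ →
        σ.support ⊆ SquareTb.cube z l →
      ∀ (b : EuclideanSpace ℝ (Fin n) → ℂ), AEStronglyMeasurable b σ →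
        eLpNorm b ∞ σ ≤ ENNReal.ofReal C_b →
      ∀ (H : Set (EuclideanSpace ℝ (Fin n))), NullMeasurableSet H σ →
        (∀ w ∈ SquareTb.gridParams n l,
          σ.real (H ∪ SquareTb.stoppingSet σ b c_acc z l w) ≤ δ₀ * σ.real (SquareTb.cube z l)) →
        (∀ (x : EuclideanSpace ℝ (Fin n)) (r : ℝ), 0 < r →
          C₀ * r ^ m < σ.real (Metric.ball x r) → Metric.ball x r ⊆ H) →
        (∀ t : ℝ, 0 < t →
          t ^ s * σ.real {x | x ∈ SquareTb.cube z l \ H ∧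
            ENNReal.ofReal t < SquareTb.squareFn k σ l b x} ≤ C₁ * σ.real (SquareTb.cube z l)) →
      ∃ G : Set (EuclideanSpace ℝ (Fin n)), MeasurableSet G ∧ G ⊆ SquareTb.cube z l \ H ∧
        c * σ.real (SquareTb.cube z l) ≤ σ.real G ∧
        ∀ f : EuclideanSpace ℝ (Fin n) → ℂ, MemLp f 2 σ →
          eLpNorm (G.indicator (SquareTb.squareFn k σ l f)) 2 σ
            ≤ ENNReal.ofReal C * eLpNorm f 2 σ := by
  -- the constants
  obtain ⟨δ, hδ0, hδδ, hδ1⟩ : ∃ δ : ℝ, 0 ≤ δ ∧ δ₀ ≤ δ ∧ δ < 1 :=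
    ⟨max δ₀ 0, le_max_right _ _, le_max_left _ _, max_lt hδ₀ one_pos⟩
  obtain ⟨A, hA0, hCA⟩ : ∃ A : ℝ, 0 ≤ A ∧ C₀ ≤ A := ⟨max C₀ 0, le_max_right _ _, le_max_left _ _⟩
  obtain ⟨M, hM0, hCM⟩ : ∃ M : ℝ, 0 ≤ M ∧ C₁ ≤ M := ⟨max C₁ 0, le_max_right _ _, le_max_left _ _⟩
  have hd : 0 < 1 - δ := by linarith
  -- The sets where `V b` or the total error is large will each cost `(1 - δ) / 4`, so a stable set
  -- keeps the proportion `(1 - δ) / 2 = 4 τ`.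
  obtain ⟨τ, hτ⟩ : ∃ τ : ℝ, τ = (1 - δ) / 8 := ⟨_, rfl⟩
  have hτ0 : 0 < τ := by rw [hτ]; linarith
  -- Makes the probability `32 n η` of not being good at most `τ`; `n + 1` covers `n = 0`.
  obtain ⟨η, hη⟩ : ∃ η : ℝ, η = τ / (32 * (n + 1)) := ⟨_, rfl⟩
  have hη0 : 0 < η := by rw [hη]; positivity
  have hητ : 32 * n * η ≤ τ := by
    rw [hη, mul_div_assoc', div_le_iff₀ (by positivity)]
    nlinarith
  have hη1 : η ≤ 1 := by
    rw [hη, div_le_one (by positivity)]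
    have : (0 : ℝ) ≤ n := Nat.cast_nonneg n
    linarith
  obtain ⟨E, hE⟩ : ∃ E : ℝ, E = errorConst m α K n A η := ⟨_, rfl⟩
  have hC := decayConst_pos (m := m) (half_pos hα)
  have hE0 : 0 ≤ E := by rw [hE]; unfold errorConst; positivity
  -- The levels `lam₀` and `lam` make the weak-type hypothesis and Chebyshev's inequality,
  -- respectively, give exceptional sets of proportion at most `(1 - δ) / 4`. The added `1` keeps
  -- them positive.
  obtain ⟨lam₀, hlam₀⟩ : ∃ lam₀ : ℝ, lam₀ = (4 * M / (1 - δ) + 1) ^ s⁻¹ := ⟨_, rfl⟩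
  have hlam₀0 : 0 < lam₀ := by rw [hlam₀]; positivity
  have hlam₀s : lam₀ ^ s = 4 * M / (1 - δ) + 1 := by
    rw [hlam₀, Real.rpow_inv_rpow (by positivity) hs.ne']
  obtain ⟨lam, hlam⟩ : ∃ lam : ℝ, lam = 4 * (E * C_b ^ 2) / (1 - δ) + 1 := ⟨_, rfl⟩
  have hlam0 : 0 < lam := by rw [hlam]; positivity
  obtain ⟨B, hB⟩ : ∃ B : ℝ, B = 8 * (c_acc⁻¹ ^ 2 * (2 * lam₀ ^ 2 + 2 * lam)) + 2 * E := ⟨_, rfl⟩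
  have hB0 : 0 ≤ B := by rw [hB]; positivity
  refine ⟨2 * τ, √(B / τ + 1), by positivity, Real.sqrt_pos.2 (by positivity), ?_⟩
  intro k hk z l hl σ hσ hsupp b hb hbC H hH hsmall hgrow hweak
  -- the grids
  obtain ⟨Λ, hΛ⟩ : ∃ Λ : ℝ, Λ = (2 : ℝ) ^ gridScale l := ⟨_, rfl⟩
  have hΛ0 : 0 < Λ := by rw [hΛ]; positivity
  have hΛ2 : (2 : ℝ) ^ (gridScale l - 1) = Λ / 2 := by
    rw [hΛ, zpow_sub_one₀ two_ne_zero, div_eq_mul_inv]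
  have hlΛ : l ≤ Λ / 2 := by
    refine (gridScale_spec hl).2.le.trans ?_
    rw [← hΛ2]
    exact zpow_le_zpow_right₀ one_le_two (by omega)
  have hL : 0 < 2 * Λ := by positivity
  have hlL : l ≤ 2 * Λ := by linarith
  -- Only diagonal shifts `(u, …, u)` are used: the probability of not being good is estimated by a
  -- union bound over coordinates, so the coordinates need not move independently.
  obtain ⟨a, ha⟩ : ∃ a : ℝ → Fin n → ℝ, a = fun u c => z c + u - Λ := ⟨_, rfl⟩
  have ham : Measurable a := by rw [ha]; fun_prop
  obtain ⟨I, hI⟩ : ∃ I : Set ℝ, I = Set.Ico (-(Λ / 2)) (Λ / 2) := ⟨_, rfl⟩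
  have hvolI : volume I = ENNReal.ofReal Λ := by rw [hI, Real.volume_Ico]; congr 1; ring
  have hprob : IsProbabilityMeasure (ProbabilityTheory.cond volume I) :=
    ProbabilityTheory.cond_isProbabilityMeasure_of_finite (by rw [hvolI]; simpa using hΛ0)
      (by rw [hvolI]; exact ENNReal.ofReal_ne_top)
  have haeI : ∀ᵐ u ∂(ProbabilityTheory.cond volume I), u ∈ I :=
    ProbabilityTheory.ae_cond_mem (by rw [hI]; exact measurableSet_Ico)
  -- the measure lives on the cube
  have hQm := measurableSet_cube z l
  have hσQ : ∀ᵐ y ∂σ, y ∈ cube z l := Filter.mem_of_superset Measure.support_mem_ae hsupp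
  have huniv : σ.real Set.univ = σ.real (cube z l) :=
    measureReal_congr (Filter.EventuallyEq.symm (Filter.eventuallyEq_univ.2 hσQ))
  have hQa : ∀ u ∈ I, cube z l ⊆ hoCube (a u) (2 * Λ) := fun u hu => by
    rw [ha]; exact cube_subset_hoCube hΛ0 hlΛ (by rwa [hI] at hu)
  -- the part of the cube on which the square function of `b` is bounded
  obtain ⟨H', hHH', hH'm, hH'⟩ := hH.exists_measurable_superset_ae_eq
  obtain ⟨F, hF⟩ : ∃ F : Set (EuclideanSpace ℝ (Fin n)),
      F = {x | x ∈ cube z l \ H' ∧ squareFn k σ l b x ≤ ENNReal.ofReal lam₀} := ⟨_, rfl⟩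
  -- `F` is Borel because `H` was replaced by a Borel set `H'`. As `H'` contains `H` everywhere, and
  -- not just almost everywhere, `F` still avoids `H` exactly.
  have hFm : MeasurableSet F := by
    rw [hF]
    exact (hQm.diff hH'm).inter (measurableSet_le (hk.measurable_squareFn hb hl) measurable_const)
  have hFQ : F ⊆ cube z l \ H := by
    rw [hF]
    exact fun x hx => ⟨hx.1.1, fun h => hx.1.2 (hHH' h)⟩
  have hFV : ∀ x ∈ F, squareFn k σ l b x ≤ ENNReal.ofReal lam₀ := by
    rw [hF]; exact fun x hx => hx.2
  -- A ball of excessive measure would lie in `H`, together with its centre `x`.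
  have hFg : ∀ x ∈ F, ∀ r, 0 < r → σ (Metric.ball x r) ≤ ENNReal.ofReal (A * r ^ m) := by
    intro x hx r hr
    by_contra hlt
    rw [not_le, ENNReal.ofReal_lt_iff_lt_toReal (by positivity) (measure_ne_top _ _)] at hlt
    refine (hFQ hx).2 (hgrow x r hr (lt_of_le_of_lt ?_ hlt) (Metric.mem_ball_self hr))
    gcongr
  -- the stable sets are large
  have hbL : MemLp b 2 σ :=
    (show MemLp b ∞ σ from ⟨hb, hbC.trans_lt ENNReal.ofReal_lt_top⟩).mono_exponent le_top
  have hSm := measurableSet_stableSet_prod (L := 2 * Λ) (η := η) hk ham hb hFm l c_acc lam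
  have hbig : ∀ u ∈ I, 4 * τ * σ.real Set.univ ≤
      σ.real (stableSet k σ F b (2 * Λ) l η c_acc lam (a u)) := by
    intro u hu
    have hT : σ.real (H' ∪ ⋃₀ {R | Maximal (fun R' => R' ∈ dyadicGrid (a u) (2 * Λ) ∧
        ‖∫ x in R', b x ∂σ‖ < c_acc * σ.real R') R}) ≤ δ * σ.real (cube z l) := by
      have h1 := hsmall (fun _ => u) (fun i => by rw [hΛ2]; rwa [hI] at hu)
      have h2 : stoppingSet σ b c_acc z l (fun _ => u) =
          ⋃₀ {R | Maximal (fun R' => R' ∈ dyadicGrid (a u) (2 * Λ) ∧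
            ‖∫ x in R', b x ∂σ‖ < c_acc * σ.real R') R} := by
        rw [stoppingSet, randomGrid, ← hΛ, ha]
      rw [h2] at h1
      refine (measureReal_congr (ae_eq_set_union hH' (ae_eq_refl _))).trans_le (h1.trans ?_)
      gcongr
    have hV : σ.real {x | x ∈ cube z l \ H' ∧ ENNReal.ofReal lam₀ < squareFn k σ l b x} ≤
        (1 - δ) / 4 * σ.real (cube z l) := by
      refine le_trans (measureReal_mono
        (s₂ := {x | x ∈ cube z l \ H ∧ ENNReal.ofReal lam₀ < squareFn k σ l b x}) ?_) ?_
      · exact fun x hx => ⟨⟨hx.1.1, fun h => hx.1.2 (hHH' h)⟩, hx.2⟩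
      · refine le_mul_of_quotient_mul_le hM0 hd measureReal_nonneg ?_
        rw [← hlam₀s]
        exact (hweak lam₀ hlam₀0).trans (by gcongr)
    have hErr : σ.real {x ∈ F | ENNReal.ofReal lam < totalError k σ (a u) (2 * Λ) l η b x} ≤
        (1 - δ) / 4 * σ.real (cube z l) := by
      refine le_mul_of_quotient_mul_le (M := E * C_b ^ 2) (by positivity) hd measureReal_nonneg ?_
      rw [← hlam, ← huniv]
      have h1 := mul_measure_totalError_le (η := η) hk hm hα hL hη0 hA0
        ((hFQ.trans Set.sdiff_subset).trans (hQa u hu)) (hσQ.mono fun y hy => hQa u hu hy) hbL hFm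
        hFg l lam
      have h2 := h1.trans (mul_le_mul_right (lintegral_enorm_sq_le_of_bound hbC) _)
      rw [← hE, ← mul_assoc, ← ENNReal.ofReal_mul hE0] at h2
      have h3 := ENNReal.toReal_mono (by finiteness) h2
      rwa [ENNReal.toReal_mul, ENNReal.toReal_mul, ENNReal.toReal_ofReal hlam0.le,
        ENNReal.toReal_ofReal (by positivity)] at h3
    have := le_measureReal_stableSet (c := c_acc) hL (hQa u hu) hF hT hV hErr
    rw [huniv]
    refine le_trans (le_of_eq ?_) this
    rw [hτ]
    ring
  -- the big piece
  refine ⟨frequentSet (ProbabilityTheory.cond volume I)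
    (fun u => stableSet k σ F b (2 * Λ) l η c_acc lam (a u)) τ, measurableSet_frequentSet hSm,
    (frequentSet_subset hτ0 fun u x hx => hx.1).trans hFQ, ?_, fun f hf => ?_⟩
  · rw [← huniv]
    exact le_measureReal_frequentSet hSm hτ0 (haeI.mono hbig)
  · refine eLpNorm_indicator_squareFn_le (measurableSet_frequentSet hSm) hτ0 hB0 ?_
    simp only [squareFn_sq_eq_tsum hL hlL]
    refine mul_lintegral_frequentSet_le hSm hτ0 (Γ := fun u i => goodSet (a u) (2 * Λ) η i)
      (measurableSet_goodSet_prod ham _ η) (fun x i => ?_)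
      (fun i => hk.measurable_timePiece hf.1 l i) (haeI.mono fun u hu => ?_)
    · rw [hI, ha]
      exact cond_not_mem_goodSet_le hΛ0 hη0.le hη1 hητ z x i
    · rw [hB, hE]
      exact tsum_lintegral_stableSet_le hk hm hα hL hη0 hA0
        ((hFQ.trans Set.sdiff_subset).trans (hQa u hu)) (hσQ.mono fun y hy => hQa u hu hy) hb hf hFm
        hFg hlL hacc hlam0.le hFV
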